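/- Let $\mathbb{G}\subseteq S_N^+$ be a quantum permutation group, given by an algebra of continuous functions on it: a nonzero unital $\mathrm{C}^*$-algebra $C(\mathbb{G})$ generated by the entries of a magic unitary $u=(u_{ij})\in M_N(C(\mathbb{G}))$ (each $u_{ij}$ is a projection and $\sum_k u_{ik}=1=\sum_k u_{kj}$), with a unital $*$-homomorphism $\Delta:C(\mathbb{G})\to C(\mathbb{G})\otimes_{\min} C(\mathbb{G})$ such that $\Delta(u_{ij})=\sum_k u_{ik}\otimes u_{kj}$. The convolution of states $\varphi,\psi$ of $C(\mathbb{G})$ is the state $\varphi\star\psi=(\varphi\otimes\psi)\Delta$. Let $G_{\mathbb{G}}$ be the set of deterministic permutations in $\mathbb{G}$, i.e. of the states $\varphi$ of $C(\mathbb{G})$ for which $(\varphi(u_{ij}))_{i,j}$ is a permutation matrix. Let $\mathcal{O}(\mathbb{G})\subseteq C(\mathbb{G})$ be the $*$-algebra generated by the $u_{ij}$. Then: 1. $G_{\mathbb{G}}$ is either empty or a group under $\star$. 2. There is a (necessarily unique) counit $\varepsilon:\mathcal{O}(\mathbb{G})\to\mathbb{C}$, the unital $*$-homomorphism with $\varepsilon(u_{ij})=\delta_{i,j}$;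 and $G_{\mathbb{G}}$ is a group under $\star$ if and only if $\varepsilon$ is the restriction to $\mathcal{O}(\mathbb{G})$ of a state of $C(\mathbb{G})$. 3. If $\mathbb{G}$ is coamenable, i.e. every completion of $\mathcal{O}(\mathbb{G})$ to an algebra of continuous functions on $\mathbb{G}$ is canonically isomorphic to $C(\mathbb{G})$ (by a $*$-isomorphism that extends the identity of $\mathcal{O}(\mathbb{G})$), then $G_{\mathbb{G}}$ is a group under $\star$. 4. If $C(\mathbb{G})$ is the universal completion of $\mathcal{O}(\mathbb{G})$, i.e. every unital $*$-homomorphism from $\mathcal{O}(\mathbb{G})$ to a unital $\mathrm{C}^*$-algebra extends to $C(\mathbb{G})$, then $G_{\mathbb{G}}$ is a group under $\star$. 5. If $N=4$, that is $\mathbb{G}\subseteq S_4^+$, then $G_{\mathbb{G}}$ is a group under $\star$. -/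

import Mathlib

open scoped ComplexOrder InnerProductSpace TensorProduct ENNReal
open UniformSpace

universe u v

noncomputable section

namespace QuantumPerm

/-! ### States -/

/-- A state of a unital C*-algebra: a linear functional that is non-negative on all `a* a` and has
value `1` at the unit. On a unital C*-algebra, a positive functional `φ` has norm `φ 1`, so that
these are the positive functionals of norm one. -/
structure State (A : Type u) [CStarAlgebra A] extends A →ₗ[ℂ] ℂ where
  nonneg' : ∀ a : A, 0 ≤ toFun (star a * a)
  map_one' : toFun 1 = 1

namespace State

variable {A : Type u} [CStarAlgebra A] {B : Type v} [CStarAlgebra B]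

instance : FunLike (State A) A ℂ where
  coe φ := φ.toFun
  coe_injective φ ψ h := by
    rcases φ with ⟨φ, _, _⟩
    rcases ψ with ⟨ψ, _, _⟩
    congr
    exact DFunLike.coe_injective h

instance : LinearMapClass (State A) ℂ A ℂ where
  map_add φ := φ.map_add'
  map_smulₛₗ φ := φ.map_smul'

@[ext] theorem ext {φ ψ : State A} (h : ∀ a, φ a = ψ a) : φ = ψ := DFunLike.ext _ _ h

theorem nonneg (φ : State A) (a : A) : 0 ≤ φ (star a * a) := φ.nonneg' a

theorem map_one (φ : State A) : φ 1 = 1 := φ.map_one'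

/-- The state `φ ∘ f`, for a unital *-homomorphism `f`. -/
def comp (φ : State B) (f : A →⋆ₐ[ℂ] B) : State A where
  toLinearMap := φ.toLinearMap ∘ₗ f.toAlgHom.toLinearMap
  nonneg' a := by
    have := φ.nonneg (f a)
    rwa [← map_star, ← map_mul] at this
  map_one' := by
    have := φ.map_one
    rwa [← _root_.map_one f] at this

@[simp] theorem comp_apply (φ : State B) (f : A →⋆ₐ[ℂ] B) (a : A) : φ.comp f a = φ (f a) := rfl

end State

/-! ### The GNS representation of a state -/

section GNS

variable {A : Type u} [CStarAlgebra A]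

/-- A state as a positive linear map, for the order of the C*-algebra `A`. -/
def State.toPos (φ : State A) :
    @PositiveLinearMap ℂ A ℂ _ _ (CStarAlgebra.spectralOrder A) _ _ _ _ :=
  letI := CStarAlgebra.spectralOrder A
  haveI := CStarAlgebra.spectralOrderedRing A
  PositiveLinearMap.mk₀ φ.toLinearMap fun a ha => by
    obtain ⟨b, rfl⟩ := CStarAlgebra.nonneg_iff_eq_star_mul_self.mp ha
    exact φ.nonneg b

/-- The GNS Hilbert space of a state. -/
def State.H (φ : State A) : Type u :=
  letI := CStarAlgebra.spectralOrder A
  haveI := CStarAlgebra.spectralOrderedRing A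
  φ.toPos.GNS

instance (φ : State A) : NormedAddCommGroup φ.H :=
  letI := CStarAlgebra.spectralOrder A
  haveI := CStarAlgebra.spectralOrderedRing A
  inferInstanceAs (NormedAddCommGroup φ.toPos.GNS)

instance (φ : State A) : InnerProductSpace ℂ φ.H :=
  letI := CStarAlgebra.spectralOrder A
  haveI := CStarAlgebra.spectralOrderedRing A
  inferInstanceAs (InnerProductSpace ℂ φ.toPos.GNS)

instance (φ : State A) : CompleteSpace φ.H :=
  letI := CStarAlgebra.spectralOrder A
  haveI := CStarAlgebra.spectralOrderedRing A
  inferInstanceAs (CompleteSpace φ.toPos.GNS)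

/-- The GNS representation of a state. -/
def State.rep (φ : State A) : A →⋆ₐ[ℂ] (φ.H →L[ℂ] φ.H) :=
  letI := CStarAlgebra.spectralOrder A
  haveI := CStarAlgebra.spectralOrderedRing A
  φ.toPos.gnsStarAlgHom

/-- The canonical cyclic vector of the GNS representation. -/
def State.vec (φ : State A) : φ.H :=
  letI := CStarAlgebra.spectralOrder A
  haveI := CStarAlgebra.spectralOrderedRing A
  ((φ.toPos.toPreGNS 1 : φ.toPos.PreGNS) : Completion φ.toPos.PreGNS)

theorem inner_gns {A : Type u} [CStarAlgebra A] [PartialOrder A] [StarOrderedRing A]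
    (f : A →ₚ[ℂ] ℂ) (a : A) :
    ⟪((f.toPreGNS 1 : f.PreGNS) : f.GNS), f.gnsStarAlgHom a ((f.toPreGNS 1 : f.PreGNS) : f.GNS)⟫_ℂ
      = f a := by
  rw [PositiveLinearMap.gnsStarAlgHom_apply]
  change ⟪((f.toPreGNS 1 : f.PreGNS) : f.GNS),
    f.gnsNonUnitalStarAlgHom a ((f.toPreGNS 1 : f.PreGNS) : f.GNS)⟫_ℂ = f a
  rw [PositiveLinearMap.gnsNonUnitalStarAlgHom_apply_coe, Completion.inner_coe,
    PositiveLinearMap.preGNS_inner_def]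
  simp

theorem State.inner_vec (φ : State A) (a : A) : ⟪φ.vec, φ.rep a φ.vec⟫_ℂ = φ a :=
  letI := CStarAlgebra.spectralOrder A
  haveI := CStarAlgebra.spectralOrderedRing A
  inner_gns φ.toPos a

theorem State.inner_vec_self (φ : State A) : ⟪φ.vec, φ.vec⟫_ℂ = 1 := by
  have := φ.inner_vec 1
  rwa [_root_.map_one, one_apply_eq_self, φ.map_one] at this

theorem State.vec_ne_zero (φ : State A) : φ.vec ≠ 0 := by
  intro h
  have := φ.inner_vec_self
  rw [h, inner_zero_left] at this
  exact zero_ne_one this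

end GNS

/-! ### The minimal tensor product of C*-algebras -/

section MinTensor

/-- The Hilbert space tensor product. -/
def HTensor (H : Type u) (K : Type v) [NormedAddCommGroup H] [InnerProductSpace ℂ H]
    [NormedAddCommGroup K] [InnerProductSpace ℂ K] : Type (max u v) :=
  Completion (H ⊗[ℂ] K)

section HTensor
variable (H : Type u) (K : Type v) [NormedAddCommGroup H] [InnerProductSpace ℂ H]
    [NormedAddCommGroup K] [InnerProductSpace ℂ K]

instance : NormedAddCommGroup (HTensor H K) :=
  inferInstanceAs (NormedAddCommGroup (Completion (H ⊗[ℂ] K)))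

instance : InnerProductSpace ℂ (HTensor H K) :=
  inferInstanceAs (InnerProductSpace ℂ (Completion (H ⊗[ℂ] K)))

instance : CompleteSpace (HTensor H K) :=
  inferInstanceAs (CompleteSpace (Completion (H ⊗[ℂ] K)))

variable {H K}

/-- The inclusion of the algebraic tensor product. -/
def HTensor.incl (x : H ⊗[ℂ] K) : HTensor H K := (x : Completion (H ⊗[ℂ] K))

theorem HTensor.incl_add (x y : H ⊗[ℂ] K) : incl (x + y) = incl x + incl y :=
  Completion.coe_add x y

theorem HTensor.incl_smul (r : ℂ) (x : H ⊗[ℂ] K) : incl (r • x) = r • incl x :=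
  Completion.coe_smul r x

theorem HTensor.inner_incl (x y : H ⊗[ℂ] K) : ⟪incl x, incl y⟫_ℂ = ⟪x, y⟫_ℂ :=
  Completion.inner_coe x y

theorem HTensor.norm_incl (x : H ⊗[ℂ] K) : ‖incl x‖ = ‖x‖ := Completion.norm_coe x

theorem HTensor.denseRange_incl : DenseRange (incl : H ⊗[ℂ] K → HTensor H K) :=
  Completion.denseRange_coe

end HTensor

/-- The bounded operator `S ⊗ T` on the Hilbert space tensor product. -/
def opTensor {H : Type u} {K : Type v} [NormedAddCommGroup H] [InnerProductSpace ℂ H]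
    [NormedAddCommGroup K] [InnerProductSpace ℂ K] (S : H →L[ℂ] H) (T : K →L[ℂ] K) :
    HTensor H K →L[ℂ] HTensor H K :=
  ContinuousLinearMap.completion (TensorProduct.mapL S T)

variable {A : Type u} [CStarAlgebra A] {B : Type v} [CStarAlgebra B]

section opTensor
variable {H : Type u} {K : Type v} [NormedAddCommGroup H] [InnerProductSpace ℂ H]
    [NormedAddCommGroup K] [InnerProductSpace ℂ K]

theorem op_ext {S T : HTensor H K →L[ℂ] HTensor H K}
    (h : ∀ x : H ⊗[ℂ] K, S (HTensor.incl x) = T (HTensor.incl x)) : S = T :=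
  DFunLike.coe_injective
    (HTensor.denseRange_incl.equalizer S.continuous T.continuous (funext h))

theorem opTensor_incl (S : H →L[ℂ] H) (T : K →L[ℂ] K) (x : H ⊗[ℂ] K) :
    opTensor S T (HTensor.incl x) = HTensor.incl (TensorProduct.mapL S T x) :=
  ContinuousLinearMap.completion_apply_coe _ x

theorem opTensor_mul (S S' : H →L[ℂ] H) (T T' : K →L[ℂ] K) :
    opTensor (S * S') (T * T') = opTensor S T * opTensor S' T' :=
  op_ext fun x => by
    rw [mul_apply_eq_comp, opTensor_incl, opTensor_incl, opTensor_incl, TensorProduct.mapL_mul]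
    rfl

theorem opTensor_one : opTensor (1 : H →L[ℂ] H) (1 : K →L[ℂ] K) = 1 :=
  op_ext fun x => by
    rw [opTensor_incl]
    exact congrArg _ (congrArg (fun f : (H ⊗[ℂ] K) →L[ℂ] (H ⊗[ℂ] K) => f x)
      TensorProduct.mapL_id_id)

theorem opTensor_add_left (S S' : H →L[ℂ] H) (T : K →L[ℂ] K) :
    opTensor (S + S') T = opTensor S T + opTensor S' T :=
  op_ext fun x => by
    rw [add_apply, opTensor_incl, opTensor_incl, opTensor_incl, TensorProduct.mapL_add_left,
      add_apply, HTensor.incl_add]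

theorem opTensor_add_right (S : H →L[ℂ] H) (T T' : K →L[ℂ] K) :
    opTensor S (T + T') = opTensor S T + opTensor S T' :=
  op_ext fun x => by
    rw [add_apply, opTensor_incl, opTensor_incl, opTensor_incl, TensorProduct.mapL_add_right,
      add_apply, HTensor.incl_add]

theorem opTensor_smul_left (r : ℂ) (S : H →L[ℂ] H) (T : K →L[ℂ] K) :
    opTensor (r • S) T = r • opTensor S T :=
  op_ext fun x => by
    rw [smul_apply, opTensor_incl, opTensor_incl, TensorProduct.mapL_smul_left,
      smul_apply, HTensor.incl_smul]

theorem opTensor_smul_right (r : ℂ) (S : H →L[ℂ] H) (T : K →L[ℂ] K) :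
    opTensor S (r • T) = r • opTensor S T :=
  op_ext fun x => by
    rw [smul_apply, opTensor_incl, opTensor_incl, TensorProduct.mapL_smul_right,
      smul_apply, HTensor.incl_smul]

theorem opTensor_adjoint [CompleteSpace H] [CompleteSpace K] (S : H →L[ℂ] H) (T : K →L[ℂ] K) :
    star (opTensor S T) = opTensor (star S) (star T) := by
  rw [ContinuousLinearMap.star_eq_adjoint, eq_comm, ContinuousLinearMap.eq_adjoint_iff]
  intro x y
  have key (x y : H ⊗[ℂ] K) : ⟪TensorProduct.mapL (star S) (star T) x, y⟫_ℂ
      = ⟪x, TensorProduct.mapL S T y⟫_ℂ := by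
    induction x with
    | zero => simp
    | add x x' hx hx' => simp only [map_add, inner_add_left, hx, hx']
    | tmul a b =>
      induction y with
      | zero => simp
      | add y y' hy hy' => simp only [map_add, inner_add_right, hy, hy']
      | tmul c d =>
        simp [ContinuousLinearMap.star_eq_adjoint, ContinuousLinearMap.adjoint_inner_left]
  refine HTensor.denseRange_incl.induction_on₂
    (p := fun x y => ⟪opTensor (star S) (star T) x, y⟫_ℂ = ⟪x, opTensor S T y⟫_ℂ) ?_ ?_ x y
  · exact isClosed_eq (by fun_prop) (by fun_prop)
  · intro x y
    rw [opTensor_incl, opTensor_incl, HTensor.inner_incl, HTensor.inner_incl, key]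

theorem norm_opTensor_le (S : H →L[ℂ] H) (T : K →L[ℂ] K) : ‖opTensor S T‖ ≤ ‖S‖ * ‖T‖ := by
  refine ContinuousLinearMap.opNorm_le_bound _ (by positivity) fun x => ?_
  refine HTensor.denseRange_incl.induction_on
    (p := fun x => ‖opTensor S T x‖ ≤ ‖S‖ * ‖T‖ * ‖x‖) x ?_ ?_
  · exact isClosed_le (by fun_prop) (by fun_prop)
  · intro x
    rw [opTensor_incl, HTensor.norm_incl, HTensor.norm_incl]
    exact (TensorProduct.mapL S T).le_of_opNorm_le (TensorProduct.norm_mapL_le S T) x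

/-- The algebra homomorphism `π ⊗ ρ` on the algebraic tensor product. -/
def repTensorAux [CompleteSpace H] [CompleteSpace K]
    (π : A →⋆ₐ[ℂ] (H →L[ℂ] H)) (ρ : B →⋆ₐ[ℂ] (K →L[ℂ] K)) :
    A ⊗[ℂ] B →ₐ[ℂ] (HTensor H K →L[ℂ] HTensor H K) :=
  Algebra.TensorProduct.lift
    (AlgHom.ofLinearMap
      { toFun := fun a => opTensor (π a) 1
        map_add' := fun a a' => by rw [map_add, opTensor_add_left]
        map_smul' := fun r a => by rw [map_smul, opTensor_smul_left]; rfl }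
      (by change opTensor (π 1) 1 = 1; rw [map_one, opTensor_one])
      (fun a a' => by
        change opTensor (π (a * a')) 1 = opTensor (π a) 1 * opTensor (π a') 1
        rw [map_mul, ← opTensor_mul, one_mul]))
    (AlgHom.ofLinearMap
      { toFun := fun b => opTensor 1 (ρ b)
        map_add' := fun a a' => by rw [map_add, opTensor_add_right]
        map_smul' := fun r a => by rw [map_smul, opTensor_smul_right]; rfl }
      (by change opTensor 1 (ρ 1) = 1; rw [map_one, opTensor_one])
      (fun b b' => by
        change opTensor 1 (ρ (b * b')) = opTensor 1 (ρ b) * opTensor 1 (ρ b')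
        rw [map_mul, ← opTensor_mul, one_mul]))
    (fun a b => by
      change opTensor (π a) 1 * opTensor 1 (ρ b) = opTensor 1 (ρ b) * opTensor (π a) 1
      rw [← opTensor_mul, ← opTensor_mul, one_mul, one_mul, mul_one, mul_one])

theorem repTensorAux_tmul [CompleteSpace H] [CompleteSpace K]
    (π : A →⋆ₐ[ℂ] (H →L[ℂ] H)) (ρ : B →⋆ₐ[ℂ] (K →L[ℂ] K)) (a : A) (b : B) :
    repTensorAux π ρ (a ⊗ₜ b) = opTensor (π a) (ρ b) := by
  rw [repTensorAux, Algebra.TensorProduct.lift_tmul]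
  change opTensor (π a) 1 * opTensor 1 (ρ b) = _
  rw [← opTensor_mul, one_mul, mul_one]

theorem repTensorAux_star [CompleteSpace H] [CompleteSpace K]
    (π : A →⋆ₐ[ℂ] (H →L[ℂ] H)) (ρ : B →⋆ₐ[ℂ] (K →L[ℂ] K)) (x : A ⊗[ℂ] B) :
    repTensorAux π ρ (star x) = star (repTensorAux π ρ x) := by
  induction x with
  | zero => rw [star_zero, map_zero, ContinuousLinearMap.star_eq_adjoint, map_zero]
  | add x y hx hy =>
    rw [star_add, map_add, map_add, hx, hy]
    simp only [ContinuousLinearMap.star_eq_adjoint, map_add]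
  | tmul a b =>
    rw [TensorProduct.star_tmul, repTensorAux_tmul, repTensorAux_tmul, opTensor_adjoint,
      map_star, map_star]

/-- The representation `π ⊗ ρ` of the algebraic tensor product on the Hilbert space tensor
product, with `(π ⊗ ρ)(a ⊗ b) = π a ⊗ ρ b`. -/
def repTensor [CompleteSpace H] [CompleteSpace K]
    (π : A →⋆ₐ[ℂ] (H →L[ℂ] H)) (ρ : B →⋆ₐ[ℂ] (K →L[ℂ] K)) :
    A ⊗[ℂ] B →⋆ₐ[ℂ] (HTensor H K →L[ℂ] HTensor H K) where
  toAlgHom := repTensorAux π ρ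
  map_star' := repTensorAux_star π ρ

theorem repTensor_tmul [CompleteSpace H] [CompleteSpace K]
    (π : A →⋆ₐ[ℂ] (H →L[ℂ] H)) (ρ : B →⋆ₐ[ℂ] (K →L[ℂ] K)) (a : A) (b : B) :
    repTensor π ρ (a ⊗ₜ b) = opTensor (π a) (ρ b) := repTensorAux_tmul π ρ a b

end opTensor

/-- The Hilbert space tensor product of two GNS spaces. -/
abbrev PairH (p : State A × State B) : Type (max u v) := HTensor p.1.H p.2.H

/-- The product of the canonical cyclic vectors. -/
def pairVec (p : State A × State B) : PairH p := HTensor.incl (p.1.vec ⊗ₜ[ℂ] p.2.vec)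

theorem inner_pairVec (p : State A × State B) (S : p.1.H →L[ℂ] p.1.H) (T : p.2.H →L[ℂ] p.2.H) :
    ⟪pairVec p, opTensor S T (pairVec p)⟫_ℂ = ⟪p.1.vec, S p.1.vec⟫_ℂ * ⟪p.2.vec, T p.2.vec⟫_ℂ := by
  rw [pairVec, opTensor_incl, HTensor.inner_incl, TensorProduct.mapL_tmul,
    TensorProduct.inner_tmul]

theorem inner_pairVec_self (p : State A × State B) : ⟪pairVec p, pairVec p⟫_ℂ = 1 := by
  rw [pairVec, HTensor.inner_incl, TensorProduct.inner_tmul, p.1.inner_vec_self,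
    p.2.inner_vec_self, one_mul]

theorem pairVec_ne_zero (p : State A × State B) : pairVec p ≠ 0 := by
  intro h
  have h1 := inner_pairVec_self p
  rw [h, inner_zero_left] at h1
  exact zero_ne_one h1

/-- The bounded operators on `H_φ ⊗ H_ψ`. -/
def PairOp (p : State A × State B) : Type (max u v) := PairH p →L[ℂ] PairH p

instance (p : State A × State B) : CStarAlgebra (PairOp p) :=
  { (inferInstance : NormedRing (PairH p →L[ℂ] PairH p)),
    (inferInstance : StarRing (PairH p →L[ℂ] PairH p)),
    (inferInstance : CompleteSpace (PairH p →L[ℂ] PairH p)),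
    (inferInstance : CStarRing (PairH p →L[ℂ] PairH p)),
    (inferInstance : NormedAlgebra ℂ (PairH p →L[ℂ] PairH p)),
    (inferInstance : StarModule ℂ (PairH p →L[ℂ] PairH p)) with }

instance (p : State A × State B) : Nontrivial (PairOp p) :=
  haveI : Nontrivial (PairH p) := ⟨⟨_, _, pairVec_ne_zero p⟩⟩
  inferInstanceAs (Nontrivial (PairH p →L[ℂ] PairH p))

/-- The representation `π_φ ⊗ π_ψ` of the algebraic tensor product. -/
def pairRep (p : State A × State B) : A ⊗[ℂ] B →⋆ₐ[ℂ] PairOp p := repTensor p.1.rep p.2.rep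

instance {ι : Type u} (E : ι → Type v) [∀ i, CStarAlgebra (E i)] [∀ i, Nontrivial (E i)] :
    CStarAlgebra (lp E ∞) where

/-- The bounded families of operators on the Hilbert spaces `H_φ ⊗ H_ψ`, where `φ` and `ψ` run
over all states of `A` and of `B`; a C*-algebra with the supremum norm. -/
def PairOps (A : Type u) [CStarAlgebra A] (B : Type v) [CStarAlgebra B] : Type (max u v) :=
  lp (fun p : State A × State B => PairOp p) ∞

instance : CStarAlgebra (PairOps A B) :=
  inferInstanceAs (CStarAlgebra (lp (fun p : State A × State B => PairOp p) ∞))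

/-- The component of a family of operators at a pair of states. -/
def PairOps.app (x : PairOps A B) (p : State A × State B) : PairH p →L[ℂ] PairH p := x.1 p

theorem PairOps.ext {x y : PairOps A B} (h : ∀ p, x.app p = y.app p) : x = y :=
  Subtype.ext (funext h)

theorem exists_bound (x : A ⊗[ℂ] B) :
    ∃ C : ℝ, ∀ p : State A × State B, ‖pairRep p x‖ ≤ C := by
  induction x with
  | zero => exact ⟨0, fun p => by rw [map_zero, norm_zero]⟩
  | add x y hx hy =>
    obtain ⟨C, hC⟩ := hx
    obtain ⟨D, hD⟩ := hy
    exact ⟨C + D, fun p => by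
      rw [map_add]; exact (norm_add_le _ _).trans (add_le_add (hC p) (hD p))⟩
  | tmul a b =>
    refine ⟨‖a‖ * ‖b‖, fun p => ?_⟩
    change ‖repTensor p.1.rep p.2.rep (a ⊗ₜ b)‖ ≤ _
    rw [repTensor_tmul]
    exact (norm_opTensor_le _ _).trans (mul_le_mul (NonUnitalStarAlgHom.norm_apply_le _ a)
      (NonUnitalStarAlgHom.norm_apply_le _ b) (norm_nonneg _) (norm_nonneg _))

/-- The direct sum of the representations `π_φ ⊗ π_ψ` of the algebraic tensor product, where
`π_φ` and `π_ψ` are the GNS representations. -/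
def spatialRep (A : Type u) [CStarAlgebra A] (B : Type v) [CStarAlgebra B] :
    A ⊗[ℂ] B →⋆ₐ[ℂ] PairOps A B where
  toFun x := ⟨fun p => pairRep p x, by
    obtain ⟨C, hC⟩ := exists_bound x
    exact memℓp_infty ⟨C, by rintro _ ⟨p, rfl⟩; exact hC p⟩⟩
  map_one' := PairOps.ext fun p => map_one (pairRep p)
  map_mul' x y := PairOps.ext fun p => map_mul (pairRep p) x y
  map_zero' := PairOps.ext fun p => map_zero (pairRep p)
  map_add' x y := PairOps.ext fun p => map_add (pairRep p) x y
  commutes' r := PairOps.ext fun p => AlgHomClass.commutes (pairRep p) r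
  map_star' x := PairOps.ext fun p => map_star (pairRep p) x

/-- The minimal (spatial) tensor product of two unital C*-algebras: the closure of the algebraic
tensor product in the spatial norm `‖x‖ = sup ‖(π_φ ⊗ π_ψ)(x)‖`, the supremum being over all
states `φ` of `A` and `ψ` of `B` (equivalently, the norm of `x` under the tensor product of the
universal representations). -/
def MinTensor (A : Type u) [CStarAlgebra A] (B : Type v) [CStarAlgebra B] : Type (max u v) :=
  (spatialRep A B).range.topologicalClosure

instance : CStarAlgebra (MinTensor A B) :=
  haveI : IsClosed ((spatialRep A B).range.topologicalClosure : Set (PairOps A B)) :=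
    StarSubalgebra.isClosed_topologicalClosure _
  StarSubalgebra.cstarAlgebra (spatialRep A B).range.topologicalClosure

/-- The inclusion of the minimal tensor product in the C*-algebra of families of operators. -/
def MinTensor.val : MinTensor A B →⋆ₐ[ℂ] PairOps A B :=
  (spatialRep A B).range.topologicalClosure.subtype

/-- The canonical map from the algebraic tensor product to the minimal tensor product. -/
def MinTensor.of : A ⊗[ℂ] B →⋆ₐ[ℂ] MinTensor A B :=
  (StarSubalgebra.inclusion (StarSubalgebra.le_topologicalClosure _)).comp
    (spatialRep A B).rangeRestrict

/-- The elementary tensor `a ⊗ b` in the minimal tensor product. -/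
def tmin (a : A) (b : B) : MinTensor A B := MinTensor.of (a ⊗ₜ b)

/-- The vector state of the product of the cyclic vectors in `H_φ ⊗ H_ψ`. -/
def pairState (p : State A × State B) : State (MinTensor A B) where
  toFun x := ⟪pairVec p, (MinTensor.val x).app p (pairVec p)⟫_ℂ
  map_add' x y := by
    rw [map_add]
    change ⟪pairVec p, ((MinTensor.val x).app p + (MinTensor.val y).app p) (pairVec p)⟫_ℂ = _
    rw [add_apply, inner_add_right]
  map_smul' r x := by
    rw [map_smul]
    change ⟪pairVec p, (r • (MinTensor.val x).app p) (pairVec p)⟫_ℂ = _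
    rw [smul_apply, inner_smul_right]; rfl
  nonneg' x := by
    rw [map_mul, map_star]
    change 0 ≤ ⟪pairVec p, (star ((MinTensor.val x).app p) * (MinTensor.val x).app p) (pairVec p)⟫_ℂ
    rw [mul_apply_eq_comp, ContinuousLinearMap.star_eq_adjoint,
      ContinuousLinearMap.adjoint_inner_right, inner_self_eq_norm_sq_to_K]
    have h : (0 : ℝ) ≤ ‖(MinTensor.val x).app p (pairVec p)‖ ^ 2 := sq_nonneg _
    have h' := Complex.zero_le_real.mpr h
    rwa [Complex.ofReal_pow] at h'
  map_one' := by
    rw [map_one]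
    exact inner_pairVec_self p

theorem pairState_tmin (p : State A × State B) (a : A) (b : B) :
    pairState p (tmin a b) = p.1 a * p.2 b := by
  change ⟪pairVec p, repTensor p.1.rep p.2.rep (a ⊗ₜ b) (pairVec p)⟫_ℂ = _
  rw [repTensor_tmul, inner_pairVec, State.inner_vec, State.inner_vec]

/-- The product state `φ ⊗ ψ` on the minimal tensor product. -/
def State.prod (φ : State A) (ψ : State B) : State (MinTensor A B) := pairState (φ, ψ)

/-- The product state is `φ ⊗ ψ` on elementary tensors (and it is determined by this, being
linear and continuous). -/
theorem State.prod_tmin (φ : State A) (ψ : State B) (a : A) (b : B) :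
    φ.prod ψ (tmin a b) = φ a * ψ b := pairState_tmin (φ, ψ) a b

end MinTensor

/-! ### Quantum permutation groups -/

/-- A compact matrix quantum group `𝔾`, given by an algebra `A = C(𝔾)` of continuous functions on
it together with a fundamental representation `u`: a unital C*-algebra generated by the entries of
the unitary `u`, with `uᵗ` invertible, and a unital *-homomorphism `Δ : A → A ⊗ A` into the minimal
tensor product with `Δ (u i j) = ∑ k, u i k ⊗ u k j`. Coassociativity of `Δ` and the
Baaj-Skandalis cancellation property are consequences and therefore not required. -/
structure CompactMatrixQuantumGroup (N : ℕ) (A : Type u) [CStarAlgebra A] where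
  /-- the fundamental representation -/
  u : Matrix (Fin N) (Fin N) A
  unitary : u ∈ unitary (Matrix (Fin N) (Fin N) A)
  isUnit_transpose : IsUnit u.transpose
  generates :
    (StarAlgebra.adjoin ℂ (Set.range fun p : Fin N × Fin N => u p.1 p.2)).topologicalClosure = ⊤
  /-- the comultiplication -/
  comul : A →⋆ₐ[ℂ] MinTensor A A
  comul_u : ∀ i j, comul (u i j) = ∑ k, tmin (u i k) (u k j)

/-- A magic unitary: a matrix of projections whose rows and columns are partitions of unity. -/
structure IsMagicUnitary {N : ℕ} {A : Type u} [CStarAlgebra A] (u : Matrix (Fin N) (Fin N) A) :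
    Prop where
  isStarProjection : ∀ i j, IsStarProjection (u i j)
  row_sum : ∀ i, ∑ k, u i k = 1
  col_sum : ∀ j, ∑ k, u k j = 1

/-- A quantum permutation group `𝔾 ⊆ S_N⁺`, with `C(𝔾) = A`: a compact matrix quantum group whose
fundamental representation is an `N × N` magic unitary. -/
structure QuantumPermutationGroup (N : ℕ) (A : Type u) [CStarAlgebra A] extends
    CompactMatrixQuantumGroup N A where
  magic : IsMagicUnitary u

namespace QuantumPermutationGroup

variable {N : ℕ} {A : Type u} [CStarAlgebra A] (G : QuantumPermutationGroup N A)

/-- The Birkhoff slice `Φ(φ) = (φ (u i j))` of a quantum permutation, that is, of a state `φ`. -/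
def birkhoff (φ : State A) : Matrix (Fin N) (Fin N) ℂ := Matrix.of fun i j => φ (G.u i j)

/-- The permutation matrix of `σ`, with a one at `(i, j)` if `σ j = i`. -/
def permMatrix (σ : Equiv.Perm (Fin N)) : Matrix (Fin N) (Fin N) ℂ :=
  Matrix.of fun i j => if σ j = i then 1 else 0

/-- The set of deterministic permutations in `𝔾`: the states whose Birkhoff slice is a permutation
matrix. -/
def deterministic : Set (State A) := {φ | ∃ σ : Equiv.Perm (Fin N), G.birkhoff φ = permMatrix σ}

/-- The quantum group law: the convolution `φ ⋆ ψ = (φ ⊗ ψ) Δ` of states. -/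
def conv (φ ψ : State A) : State A := (φ.prod ψ).comp G.comul

/-- A set of states is a group under convolution: it is closed under convolution and a group with
this operation. -/
def IsGroupUnderConv (S : Set (State A)) : Prop :=
  ∃ _ : Group S, ∀ φ ψ : S, ((φ * ψ : S) : State A) = G.conv φ ψ

/-- The *-algebra of regular functions, generated by the entries of `u`. -/
def regular : StarSubalgebra ℂ A :=
  StarAlgebra.adjoin ℂ (Set.range fun p : Fin N × Fin N => G.u p.1 p.2)

/-- The generator `u i j` as a regular function. -/
def gen (i j : Fin N) : G.regular := ⟨G.u i j, StarAlgebra.subset_adjoin ℂ _ ⟨(i, j), rfl⟩⟩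

/-- A unital *-homomorphism `ε` on the regular functions is the counit if `ε (u i j) = δ_ij`. -/
def IsCounit (ε : G.regular →⋆ₐ[ℂ] ℂ) : Prop := ∀ i j, ε (G.gen i j) = if i = j then 1 else 0

/-- There is at most one counit. -/
theorem IsCounit.unique {ε ε' : G.regular →⋆ₐ[ℂ] ℂ} (h : G.IsCounit ε) (h' : G.IsCounit ε') :
    ε = ε' := by
  refine StarAlgHom.ext_adjoin fun x hx => ?_
  obtain ⟨p, hp⟩ := hx
  obtain rfl : x = G.gen p.1 p.2 := Subtype.ext hp.symm
  exact (h p.1 p.2).trans (h' p.1 p.2).symm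

/-- A functional on the regular functions is a state (of `C(𝔾)`) if it is the restriction of a
state of the C*-algebra `C(𝔾) = A`. -/
def IsStateOn (ε : G.regular →⋆ₐ[ℂ] ℂ) : Prop := ∃ φ : State A, ∀ x : G.regular, φ x = ε x

/-- `H` is an algebra of continuous functions on the same quantum group, that is, `C(H) = B` is
another completion of the regular functions of `G`: the assignment `u i j ↦ v i j` gives an
isomorphism between the *-algebras of regular functions (which then respects the
comultiplications). -/
def SameRegular {B : Type u} [CStarAlgebra B] (H : QuantumPermutationGroup N B) : Prop :=
  ∃ e : G.regular ≃⋆ₐ[ℂ] H.regular, ∀ i j, e (G.gen i j) = H.gen i j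

/-- Coamenability: all completions of the algebra of regular functions are canonically isomorphic,
i.e. every completion is isomorphic to `C(𝔾)` by an isomorphism that extends the identification of
the regular functions. -/
def IsCoamenable : Prop :=
  ∀ (B : Type u) [CStarAlgebra B] (H : QuantumPermutationGroup N B), G.SameRegular H →
    ∃ e : A ≃⋆ₐ[ℂ] B, ∀ i j, e (G.u i j) = H.u i j

/-- `C(𝔾)` is the universal completion: every unital *-homomorphism from the regular functions to
a unital C*-algebra extends to `C(𝔾)`. -/
def IsUniversal : Prop :=
  ∀ (B : Type u) [CStarAlgebra B] (π : G.regular →⋆ₐ[ℂ] B),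
    ∃ ρ : A →⋆ₐ[ℂ] B, ∀ x : G.regular, ρ x = π x

end QuantumPermutationGroup

end QuantumPerm

end

namespace QuantumPerm

/-! ### Elementary properties of states -/

namespace State

variable {A : Type u} [CStarAlgebra A] {B : Type v} [CStarAlgebra B]

/-! A deterministic state takes only the values 0 and 1 on the projections `u i j`, so its GNS
vector is a joint eigenvector of all of them and hence of all of `A`: the state is a character,
determined by its Birkhoff slice (`definiteSubalgebra_eq_top`, `eq_of_birkhoff_eq`). Slices multiply
under convolution, so the deterministic states embed as a subsemigroup of a finite symmetric group.
Such a subsemigroup is a group once it is nonempty, and its identity restricts to the counit. Hence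
every claim, apart from the existence of the counit, comes down to finding a single deterministic
state.

The counit is obtained without a Haar state. Let `w` be a corepresentation for which both `w` and
its entrywise adjoint are unitary, and let `V` be the span of its slices, an algebra by convolution.
Left multiplication by `w` maps `V ⊗ A` to itself, and its matrix `M` in a Hilbert-Schmidt
orthonormal basis of `V` is isometric together with its entrywise adjoint; a trace argument makes
`M` unitary (`mul_conjTranspose_eq_one_of_biisometry`). From `w = w y` with `y` in `V ⊗ A` follows
`y = 1`, so `1 ∈ V`; in the same way `V` is closed under adjoints. Thus a linear relation between
the coefficients of `w` holds for the identity matrix too. Since polynomials in the `u i j` are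
combinations of such coefficients, evaluation at the identity matrix is well defined on regular
functions (`evalOne_eq_zero`).

For a universal completion the counit extends. In the coamenable case, either the counit is bounded
and extends by continuity, or it is unbounded; then the graph of the counit is dense in `A × ℂ`,
which is therefore another completion, and coamenability gives an isomorphism from `A` onto it whose
second component is the required character.

For `N = 4` it suffices that the character `∑ u i i` has norm at least 4
(`deterministic_nonempty_of_le_norm`). For an `n`-dimensional `w` with slice algebra `V` and
character `χ`, one has `n² ≤ dim V · dim V'`, where `V'` is the commutant, and `dim V' ≤ ‖χ‖²`,
because elements of `V'` are fixed vectors of `w ⊗ w̄` and the mean ergodic theorem bounds the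
number of fixed vectors by the norm of the character. In the basis of characters of the Klein
four-group the coefficients of `u` commute up to sign, so the `k`-th tensor power has a slice
algebra of polynomially bounded dimension, whence `4 ^ (2 * k) ≤ (k + 1) ^ 16 * ‖χ‖ ^ (2 * k)`,
which for large `k` forces `‖χ‖ ≥ 4`. -/

theorem norm_vec (φ : State A) : ‖φ.vec‖ = 1 := by
  have h := φ.inner_vec_self
  rw [inner_self_eq_norm_sq_to_K] at h
  have h' : ‖φ.vec‖ ^ 2 = 1 := by
    rw [← Complex.ofReal_inj]; simpa using h
  nlinarith [norm_nonneg φ.vec]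

theorem apply_star (φ : State A) (a : A) : φ (star a) = star (φ a) := by
  rw [← φ.inner_vec, ← φ.inner_vec, StarHomClass.map_star, ContinuousLinearMap.star_eq_adjoint,
    ContinuousLinearMap.adjoint_inner_right]
  exact (inner_conj_symm _ _).symm

theorem norm_rep_le (φ : State A) (a : A) : ‖φ.rep a‖ ≤ ‖a‖ :=
  NonUnitalStarAlgHom.norm_apply_le _ a

theorem apply_star_mul (φ : State A) (a b : A) :
    φ (star a * b) = ⟪φ.rep a φ.vec, φ.rep b φ.vec⟫_ℂ := by
  rw [← φ.inner_vec, map_mul, StarHomClass.map_star, mul_apply_eq_comp,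
    ContinuousLinearMap.star_eq_adjoint, ContinuousLinearMap.adjoint_inner_right]

theorem apply_star_mul_self (φ : State A) (a : A) :
    φ (star a * a) = ((‖φ.rep a φ.vec‖ ^ 2 : ℝ) : ℂ) := by
  rw [apply_star_mul, inner_self_eq_norm_sq_to_K]
  norm_cast

theorem norm_apply_le (φ : State A) (a : A) : ‖φ a‖ ≤ ‖a‖ := by
  rw [← φ.inner_vec]
  refine (norm_inner_le_norm _ _).trans ?_
  rw [norm_vec, one_mul]
  refine ((φ.rep a).le_opNorm _).trans ?_
  rw [norm_vec, mul_one]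
  exact φ.norm_rep_le a

theorem continuous (φ : State A) : Continuous φ :=
  AddMonoidHomClass.continuous_of_bound φ 1 fun a => by simpa using φ.norm_apply_le a

theorem norm_sq_apply_le (φ : State A) (a : A) : ‖φ a‖ ^ 2 ≤ (φ (star a * a)).re := by
  rw [apply_star_mul_self, Complex.ofReal_re, ← φ.inner_vec]
  refine pow_le_pow_left₀ (norm_nonneg _) ?_ 2
  simpa [norm_vec] using norm_inner_le_norm (𝕜 := ℂ) φ.vec (φ.rep a φ.vec)

theorem re_apply_mul_le (φ : State A) (a b : A) :
    (φ (star (a * b) * (a * b))).re ≤ ‖a‖ ^ 2 * (φ (star b * b)).re := by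
  rw [apply_star_mul_self, apply_star_mul_self, Complex.ofReal_re, Complex.ofReal_re, map_mul,
    mul_apply_eq_comp, ← mul_pow]
  exact pow_le_pow_left₀ (norm_nonneg _) (((φ.rep a).le_opNorm _).trans
    (mul_le_mul_of_nonneg_right (φ.norm_rep_le a) (norm_nonneg _))) 2

theorem map_algebraMap (φ : State A) (r : ℂ) : φ (algebraMap ℂ A r) = r := by
  rw [Algebra.algebraMap_eq_smul_one, map_smul, φ.map_one, smul_eq_mul, mul_one]

/-- A functional of norm one that is unital is a state. -/
theorem exists_eq_of_norm_le (f : A →L[ℂ] ℂ) (hf : ‖f‖ ≤ 1) (h1 : f 1 = 1) :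
    ∃ φ : State A, ∀ a, φ a = f a := by
  have hb (a : A) : ‖f a‖ ≤ ‖a‖ := by simpa using f.le_of_opNorm_le hf a
  -- Test on `x + it`: its norm squared is at most `‖x‖² + t²`, while `|f (x + it)|²` contains `(β +
  -- t)²`; the term linear in `t` must then vanish.
  have him (x : A) (hx : IsSelfAdjoint x) : (f x).im = 0 := by
    by_contra h
    set β := (f x).im
    have key (t : ℝ) : β ^ 2 + 2 * β * t ≤ ‖x‖ ^ 2 * ‖(1 : A)‖ ^ 2 + ‖x‖ ^ 2 := by
      have hN : ‖(1 : A)‖ ≤ 1 := by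
        have : ‖(1 : A)‖ * ‖(1 : A)‖ = ‖(1 : A)‖ := by
          have := CStarRing.norm_star_mul_self (x := (1 : A)); rw [star_one, one_mul] at this
          exact this.symm
        nlinarith [norm_nonneg (1 : A)]
      have h2 : ‖x + (t * Complex.I) • (1 : A)‖ ^ 2 ≤ ‖x‖ ^ 2 + t ^ 2 := by
        rw [sq, ← CStarRing.norm_star_mul_self]
        have : star (x + (t * Complex.I) • (1 : A)) * (x + (t * Complex.I) • (1 : A))
            = x * x + ((t : ℂ) ^ 2) • (1 : A) := by
          rw [star_add, hx.star_eq, star_smul, star_one]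
          have hI : star ((t : ℂ) * Complex.I) = -(t * Complex.I) := by simp
          rw [hI]
          simp only [add_mul, mul_add, mul_smul_comm, mul_one, neg_smul,
            smul_add, smul_neg, smul_smul]
          have : (t * Complex.I) * (t * Complex.I) = -(t : ℂ) ^ 2 := by
            ring_nf; simp
          rw [this]
          simp
        rw [this]
        refine (norm_add_le _ _).trans (add_le_add ?_ ?_)
        · rw [sq]; exact norm_mul_le _ _
        · refine (norm_smul_le _ _).trans ?_
          have : ‖(t : ℂ) ^ 2‖ = t ^ 2 := by simp
          rw [this]
          nlinarith [sq_nonneg t]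
      have h3 := hb (x + (t * Complex.I) • (1 : A))
      have h4 := pow_le_pow_left₀ (norm_nonneg _) h3 2
      rw [map_add, map_smul, h1, smul_eq_mul, mul_one, ← Complex.normSq_eq_norm_sq,
        Complex.normSq_apply] at h4
      simp only [Complex.add_re, Complex.mul_re, Complex.ofReal_re, Complex.I_re, mul_zero,
        Complex.ofReal_im, Complex.I_im, mul_one, sub_self, add_zero, Complex.add_im,
        Complex.mul_im] at h4
      change (f x).re * (f x).re + (β + t) * (β + t) ≤ _ at h4
      nlinarith [sq_nonneg (f x).re, sq_nonneg (‖x‖ * ‖(1 : A)‖)]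
    -- This `t` makes `2βt` exceed the bound by exactly 1.
    have h5 := key ((‖x‖ ^ 2 * ‖(1 : A)‖ ^ 2 + ‖x‖ ^ 2 + 1) / (2 * β))
    have h6 : 2 * β * ((‖x‖ ^ 2 * ‖(1 : A)‖ ^ 2 + ‖x‖ ^ 2 + 1) / (2 * β))
        = ‖x‖ ^ 2 * ‖(1 : A)‖ ^ 2 + ‖x‖ ^ 2 + 1 := by field_simp
    rw [h6] at h5
    nlinarith [sq_nonneg β]
  refine ⟨⟨f.toLinearMap, fun a => ?_, h1⟩, fun a => rfl⟩
  let := CStarAlgebra.spectralOrder A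
  have := CStarAlgebra.spectralOrderedRing A
  have ha : 0 ≤ star a * a := star_mul_self_nonneg a
  set x := star a * a
  change 0 ≤ f x
  rw [Complex.le_def]
  refine ⟨?_, (him x ha.isSelfAdjoint).symm⟩
  have h7 : ‖algebraMap ℝ A ‖x‖ - x‖ ≤ ‖x‖ := by
    have h8 : x ≤ algebraMap ℝ A ‖x‖ := ha.isSelfAdjoint.le_algebraMap_norm_self
    refine (CStarAlgebra.norm_le_iff_le_algebraMap _ (norm_nonneg _) (sub_nonneg.mpr h8)).mpr ?_
    exact sub_le_self _ ha
  have h8 := (hb _).trans h7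
  rw [map_sub, Algebra.algebraMap_eq_smul_one, ← Complex.coe_smul, map_smul, h1, smul_eq_mul,
    mul_one] at h8
  have h9 := (Complex.re_le_norm _).trans h8
  simp only [Complex.sub_re, Complex.ofReal_re] at h9
  change 0 ≤ (f x).re
  linarith

/-- The norm of a self-adjoint element is attained, up to a sign, at a state. -/
theorem exists_norm_eq_of_mem_spectrum [Nontrivial A] {a : A}
    (h : ‖a‖ ∈ spectrum ℝ a) : ∃ φ : State A, φ a = ‖a‖ := by
  have h2 : ‖a‖ + ‖a‖ ≤ ‖a + algebraMap ℝ A ‖a‖‖ := by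
    have h3 : ‖a‖ + ‖a‖ ∈ spectrum ℝ (a + algebraMap ℝ A ‖a‖) := by
      rw [add_comm a, spectrum.add_mem_add_iff]; exact h
    have := spectrum.norm_le_norm_of_mem h3
    refine le_trans (le_abs_self _) this
  by_cases h0 : a = 0
  · obtain ⟨f, hf, hf1⟩ := exists_dual_vector ℂ (1 : A) (by simp)
    have hf1' : f 1 = 1 := by rw [hf1]; simp
    obtain ⟨φ, -⟩ := exists_eq_of_norm_le f hf.le hf1'
    exact ⟨φ, by simp [h0]⟩
  have hpos : 0 < ‖a‖ := norm_pos_iff.mpr h0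
  -- The norm of `a + ‖a‖` is at least `2‖a‖`, while `|f a| ≤ ‖a‖` and `|f 1| ≤ 1`. A norming
  -- functional must attain both bounds, so it is unital.
  obtain ⟨f, hf, hf1⟩ := exists_dual_vector ℂ (a + algebraMap ℝ A ‖a‖)
    (norm_ne_zero_iff.mpr (norm_pos_iff.mp (by linarith)))
  have hb (a : A) : ‖f a‖ ≤ ‖a‖ := by simpa using f.le_of_opNorm_le hf.le a
  rw [map_add, Algebra.algebraMap_eq_smul_one, ← Complex.coe_smul, map_smul, smul_eq_mul] at hf1
  rw [Algebra.algebraMap_eq_smul_one, ← Complex.coe_smul] at h2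
  have hre := congrArg Complex.re hf1
  have hA := (Complex.re_le_norm _).trans (hb a)
  have h11 := hb 1
  rw [norm_one] at h11
  have hB := (Complex.re_le_norm _).trans h11
  simp only [Complex.add_re, Complex.mul_re, Complex.ofReal_re, Complex.ofReal_im, zero_mul,
    sub_zero] at hre
  change _ = ‖_‖ at hre
  have e1 : (f 1).re = 1 := by nlinarith
  have e2 : (f a).re = ‖a‖ := by nlinarith
  have real_of (z : ℂ) (r : ℝ) (hz : z.re = r) (hn : ‖z‖ ≤ r) : z = r := by
    have h5 : ‖z‖ ^ 2 ≤ r ^ 2 := pow_le_pow_left₀ (norm_nonneg _) hn 2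
    rw [← Complex.normSq_eq_norm_sq, Complex.normSq_apply, hz] at h5
    refine Complex.ext (by simpa using hz) ?_
    have : z.im ^ 2 ≤ 0 := by nlinarith
    simpa using pow_eq_zero_iff (two_ne_zero) |>.mp (le_antisymm this (sq_nonneg _))
  obtain ⟨φ, hφ⟩ := exists_eq_of_norm_le f hf.le (by simpa using real_of _ 1 e1 h11)
  exact ⟨φ, by rw [hφ]; exact real_of _ _ e2 (hb a)⟩

theorem exists_norm_apply_eq [Nontrivial A] {a : A} (ha : IsSelfAdjoint a) :
    ∃ φ : State A, ‖φ a‖ = ‖a‖ := by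
  rcases CStarAlgebra.norm_or_neg_norm_mem_spectrum (a := a) ha with h | h
  · obtain ⟨φ, hφ⟩ := exists_norm_eq_of_mem_spectrum h
    exact ⟨φ, by simp [hφ]⟩
  · have h' : ‖-a‖ ∈ spectrum ℝ (-a) := by
      rw [norm_neg, ← spectrum.neg_eq]; simpa using h
    obtain ⟨φ, hφ⟩ := exists_norm_eq_of_mem_spectrum h'
    refine ⟨φ, ?_⟩
    rw [map_neg, norm_neg] at hφ
    rw [← norm_neg, hφ]; simp

instance [Nontrivial A] : Nonempty (State A) :=
  (exists_norm_apply_eq (IsSelfAdjoint.one A)).nonempty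

/-- States separate the points of a C*-algebra. -/
theorem eq_zero_of_forall [Nontrivial A] {a : A} (h : ∀ φ : State A, φ a = 0) : a = 0 := by
  have key (b : A) (hb : IsSelfAdjoint b) (h : ∀ φ : State A, φ b = 0) : b = 0 := by
    obtain ⟨φ, hφ⟩ := exists_norm_apply_eq hb
    rw [h, norm_zero] at hφ
    exact norm_eq_zero.mp hφ.symm
  have h1 : a + star a = 0 := key _ (IsSelfAdjoint.add_star_self a) fun φ => by
    rw [map_add, φ.apply_star, h, star_zero, add_zero]
  have h2 : Complex.I • (a - star a) = 0 := by
    refine key _ ?_ fun φ => by rw [map_smul, map_sub, φ.apply_star, h, star_zero, sub_zero, smul_zero]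
    rw [IsSelfAdjoint, star_smul, star_sub, star_star]
    simp only [RCLike.star_def, Complex.conj_I, neg_smul, smul_sub]
    abel
  have h3 : a - star a = 0 := (smul_eq_zero.mp h2).resolve_left Complex.I_ne_zero
  have h4 : (2 : ℂ) • a = 0 := by
    have : (2 : ℂ) • a = (a + star a) + (a - star a) := by rw [two_smul]; abel
    rw [this, h1, h3, add_zero]
  exact (smul_eq_zero.mp h4).resolve_left two_ne_zero

theorem eq_of_forall [Nontrivial A] {a b : A} (h : ∀ φ : State A, φ a = φ b) : a = b :=
  sub_eq_zero.mp (eq_zero_of_forall fun φ => by rw [map_sub, h, sub_self])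

theorem eq_zero_of_sum_star_mul_self_eq_zero [Nontrivial A] {ι : Type*} (s : Finset ι) (f : ι → A)
    (h : ∑ i ∈ s, star (f i) * f i = 0) {i : ι} (hi : i ∈ s) : f i = 0 := by
  have : star (f i) * f i = 0 := eq_zero_of_forall fun φ => by
    have h1 : ∑ i ∈ s, φ (star (f i) * f i) = 0 := by rw [← map_sum, h, map_zero]
    exact (Finset.sum_eq_zero_iff_of_nonneg fun j _ => φ.nonneg _).mp h1 i hi
  exact CStarRing.star_mul_self_eq_zero_iff _ |>.mp this

end State

end QuantumPerm
namespace QuantumPerm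

/-! ### Deterministic permutations -/

namespace State

variable {A : Type u} [CStarAlgebra A]

theorem apply_mul_of_rep_vec (φ : State A) {x y : A} (hx : φ.rep x φ.vec = φ x • φ.vec)
    (hy : φ.rep y φ.vec = φ y • φ.vec) : φ (x * y) = φ x * φ y := by
  rw [← φ.inner_vec (x * y), map_mul, mul_apply_eq_comp, hy, ContinuousLinearMap.map_smul, hx,
    inner_smul_right, inner_smul_right, φ.inner_vec_self, mul_one, mul_comm]

/-- The *-subalgebra of all elements for which the cyclic vector is a joint eigenvector of the
element and its adjoint. -/
def definiteSubalgebra (φ : State A) : StarSubalgebra ℂ A where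
  carrier := {x | φ.rep x φ.vec = φ x • φ.vec ∧ φ.rep (star x) φ.vec = φ (star x) • φ.vec}
  mul_mem' {x y} hx hy := by
    refine ⟨?_, ?_⟩
    · rw [apply_mul_of_rep_vec φ hx.1 hy.1, map_mul, mul_apply_eq_comp, hy.1,
        ContinuousLinearMap.map_smul, hx.1, smul_smul, mul_comm]
    · rw [star_mul, apply_mul_of_rep_vec φ hy.2 hx.2, map_mul, mul_apply_eq_comp, hx.2,
        ContinuousLinearMap.map_smul, hy.2, smul_smul, mul_comm]
  add_mem' {x y} hx hy := by
    refine ⟨?_, ?_⟩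
    · rw [map_add, map_add, add_apply, hx.1, hy.1, add_smul]
    · rw [star_add, map_add, map_add, add_apply, hx.2, hy.2, add_smul]
  algebraMap_mem' r := by
    have key (r : ℂ) : φ.rep (algebraMap ℂ A r) φ.vec = φ (algebraMap ℂ A r) • φ.vec := by
      rw [φ.map_algebraMap, AlgHomClass.commutes]
      rfl
    refine ⟨key r, ?_⟩
    rw [← algebraMap_star_comm]
    exact key _
  star_mem' {x} hx := by
    refine ⟨hx.2, ?_⟩
    rw [star_star]
    exact hx.1

theorem isClosed_definiteSubalgebra (φ : State A) :
    IsClosed (φ.definiteSubalgebra : Set A) := by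
  have hr : Continuous φ.rep :=
    AddMonoidHomClass.continuous_of_bound φ.rep 1 fun a => by simpa using φ.norm_rep_le a
  have hφ := φ.continuous
  have h1 : Continuous fun x => φ.rep x φ.vec := by fun_prop
  have h2 : Continuous fun x => φ x • φ.vec := by fun_prop
  have h3 : Continuous (star : A → A) := continuous_star
  exact (isClosed_eq h1 h2).inter (isClosed_eq (h1.comp h3) (h2.comp h3))

/-- With `ξ` the cyclic vector, `‖(p - φ p) ξ‖² = φ p (1 - φ p)`, which is zero exactly at the two
extreme values. -/
theorem mem_definiteSubalgebra_of_isStarProjection (φ : State A) {p : A} (hp : IsStarProjection p)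
    (h : φ p = 0 ∨ φ p = 1) : p ∈ φ.definiteSubalgebra := by
  have hs : star p = p := hp.isSelfAdjoint.star_eq
  have key : φ.rep p φ.vec = φ p • φ.vec := by
    have h1 : φ.rep (p - algebraMap ℂ A (φ p)) φ.vec = 0 := by
      rw [← norm_eq_zero, ← sq_eq_zero_iff, ← Complex.ofReal_inj, ← apply_star_mul_self]
      have hs' : star (φ p) = φ p := by rw [← apply_star, hs]
      have e : star (p - algebraMap ℂ A (φ p)) * (p - algebraMap ℂ A (φ p))
          = p - φ p • p - φ p • p + (φ p * φ p) • 1 := by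
        rw [star_sub, hs, ← algebraMap_star_comm, hs', Algebra.algebraMap_eq_smul_one]
        simp only [sub_mul, mul_sub, mul_smul_comm, smul_mul_assoc, one_mul, mul_one,
          hp.isIdempotentElem.eq, smul_smul, smul_sub]
        abel
      rw [e, map_add, map_sub, map_sub, map_smul, map_smul, φ.map_one]
      rcases h with h | h <;> simp [h]
    rw [map_sub, sub_apply, AlgHomClass.commutes, sub_eq_zero] at h1
    exact h1
  exact ⟨key, by rw [hs]; exact key⟩

/-- A state whose definite subalgebra is everything is a character. -/
def toStarAlgHom (φ : State A) (h : φ.definiteSubalgebra = ⊤) : A →⋆ₐ[ℂ] ℂ where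
  toFun := φ
  map_one' := φ.map_one
  map_mul' x y := φ.apply_mul_of_rep_vec
    (show x ∈ φ.definiteSubalgebra by rw [h]; trivial).1
    (show y ∈ φ.definiteSubalgebra by rw [h]; trivial).1
  map_zero' := map_zero φ
  map_add' := map_add φ
  commutes' := φ.map_algebraMap
  map_star' := φ.apply_star

/-- A character is a state. -/
def ofStarAlgHom (f : A →⋆ₐ[ℂ] ℂ) : State A where
  toLinearMap := f.toAlgHom.toLinearMap
  nonneg' a := by
    change 0 ≤ f (star a * a)
    rw [map_mul, StarHomClass.map_star]
    exact star_mul_self_nonneg _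
  map_one' := _root_.map_one f

end State

namespace QuantumPermutationGroup

variable {N : ℕ} {A : Type u} [CStarAlgebra A] (G : QuantumPermutationGroup N A)

theorem birkhoff_conv (φ ψ : State A) :
    G.birkhoff (G.conv φ ψ) = G.birkhoff φ * G.birkhoff ψ := by
  ext i j
  change φ.prod ψ (G.comul (G.u i j)) = _
  rw [G.comul_u, map_sum, Matrix.mul_apply]
  exact Finset.sum_congr rfl fun k _ => State.prod_tmin _ _ _ _

theorem permMatrix_mul (σ τ : Equiv.Perm (Fin N)) :
    permMatrix (σ * τ) = permMatrix σ * permMatrix τ := by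
  ext i j
  change (if σ (τ j) = i then (1 : ℂ) else 0) = _
  simp only [permMatrix, Matrix.of_apply, Matrix.mul_apply, mul_ite, mul_one, mul_zero, Finset.sum_ite_eq, Finset.mem_univ, if_true]

theorem permMatrix_injective : Function.Injective (permMatrix (N := N)) := by
  intro σ τ h
  ext1 j
  have := congrFun (congrFun h (σ j)) j
  simp only [permMatrix, Matrix.of_apply, if_true] at this
  by_contra hne
  rw [if_neg (Ne.symm hne)] at this
  exact one_ne_zero this

variable {G}

theorem definiteSubalgebra_eq_top {φ : State A} (h : φ ∈ G.deterministic) :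
    φ.definiteSubalgebra = ⊤ := by
  obtain ⟨σ, hσ⟩ := h
  rw [eq_top_iff, ← G.generates]
  refine StarSubalgebra.topologicalClosure_minimal (StarAlgebra.adjoin_le ?_)
    φ.isClosed_definiteSubalgebra
  rintro _ ⟨p, rfl⟩
  refine φ.mem_definiteSubalgebra_of_isStarProjection (G.magic.isStarProjection _ _) ?_
  have := congrFun (congrFun hσ p.1) p.2
  change φ (G.u p.1 p.2) = if σ p.2 = p.1 then 1 else 0 at this
  rw [this]
  split_ifs <;> simp

/-- Two characters that agree on the generators are equal. -/
theorem starAlgHom_ext {f g : A →⋆ₐ[ℂ] ℂ} (h : ∀ i j, f (G.u i j) = g (G.u i j)) : f = g := by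
  refine StarAlgHom.ext fun x => ?_
  have hc (f : A →⋆ₐ[ℂ] ℂ) : Continuous f := (State.ofStarAlgHom f).continuous
  have hx : x ∈ (StarAlgebra.adjoin ℂ (Set.range fun p : Fin N × Fin N =>
    G.u p.1 p.2)).topologicalClosure := by rw [G.generates]; trivial
  have hle : (StarAlgebra.adjoin ℂ (Set.range fun p : Fin N × Fin N => G.u p.1 p.2))
      ≤ StarAlgHom.equalizer f g := by
    refine StarAlgebra.adjoin_le ?_
    rintro _ ⟨p, rfl⟩
    exact h _ _
  exact StarSubalgebra.topologicalClosure_minimal hle (isClosed_eq (hc f) (hc g)) hx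

theorem eq_of_birkhoff_eq {φ ψ : State A} (hφ : φ ∈ G.deterministic) (hψ : ψ ∈ G.deterministic)
    (h : G.birkhoff φ = G.birkhoff ψ) : φ = ψ := by
  have := starAlgHom_ext (G := G) (f := φ.toStarAlgHom (definiteSubalgebra_eq_top hφ))
    (g := ψ.toStarAlgHom (definiteSubalgebra_eq_top hψ))
    fun i j => congrFun (congrFun h i) j
  exact State.ext fun a => DFunLike.congr_fun this a

variable (G)

/-- The deterministic permutations in `𝔾` are a group under convolution unless there are none. -/
theorem isGroupUnderConv_of_nonempty (h : G.deterministic.Nonempty) :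
    G.IsGroupUnderConv G.deterministic := by
  classical
  choose f hf using fun φ : G.deterministic => φ.2
  have hinj : Function.Injective f := fun φ ψ h => Subtype.ext
    (eq_of_birkhoff_eq φ.2 ψ.2 (by rw [hf, hf, h]))
  have hmem (φ ψ : G.deterministic) : G.conv φ ψ ∈ G.deterministic :=
    ⟨f φ * f ψ, by rw [birkhoff_conv, permMatrix_mul, hf, hf]⟩
  have hmul (φ ψ : G.deterministic) : f ⟨G.conv φ ψ, hmem φ ψ⟩ = f φ * f ψ :=
    permMatrix_injective (by rw [← hf, permMatrix_mul, ← hf, ← hf]; exact birkhoff_conv _ _ _)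
  let S : Subsemigroup (Equiv.Perm (Fin N)) :=
    { carrier := Set.range f
      mul_mem' := by
        rintro _ _ ⟨φ, rfl⟩ ⟨ψ, rfl⟩
        exact ⟨_, hmul φ ψ⟩ }
  -- A semigroup contains only the positive powers of its elements; the order of `σ` being finite,
  -- these include the identity and the inverse.
  have hpow (σ : Equiv.Perm (Fin N)) (hσ : σ ∈ Set.range f) (n : ℕ) : σ ^ (n + 1) ∈ Set.range f := by
    induction n with
    | zero => simpa using hσ
    | succ n ih => rw [pow_succ]; exact S.mul_mem ih hσ
  have hone : (1 : Equiv.Perm (Fin N)) ∈ Set.range f := by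
    obtain ⟨φ, hφ⟩ := h
    have := hpow (f ⟨φ, hφ⟩) ⟨_, rfl⟩ (orderOf (f ⟨φ, hφ⟩) - 1)
    rwa [Nat.sub_add_cancel (orderOf_pos _), pow_orderOf_eq_one] at this
  let T : Subgroup (Equiv.Perm (Fin N)) :=
    { carrier := Set.range f
      mul_mem' := S.mul_mem'
      one_mem' := hone
      inv_mem' := by
        intro σ hσ
        rw [inv_eq_of_mul_eq_one_right (a := σ) (b := σ ^ (orderOf σ - 1))]
        -- The exponent `orderOf σ - 1` is zero for `σ = 1`, which `hpow` does not cover.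
        · rcases Nat.eq_zero_or_pos (orderOf σ - 1) with h0 | h0
          · rw [h0, pow_zero]; exact hone
          · rw [← Nat.sub_add_cancel h0]; exact hpow σ hσ _
        · rw [← pow_succ', Nat.sub_add_cancel (orderOf_pos _), pow_orderOf_eq_one] }
  let e : G.deterministic ≃ T := Equiv.ofInjective f hinj
  refine ⟨e.group, fun φ ψ => ?_⟩
  let := e.group
  change ((e.symm (e φ * e ψ) : G.deterministic) : State A) = _
  have : e φ * e ψ = e ⟨G.conv φ ψ, hmem φ ψ⟩ := Subtype.ext (hmul φ ψ).symm
  rw [this, Equiv.symm_apply_apply]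

theorem isGroupUnderConv_iff_nonempty :
    G.IsGroupUnderConv G.deterministic ↔ G.deterministic.Nonempty :=
  ⟨fun ⟨_, _⟩ => ⟨_, (1 : G.deterministic).2⟩, G.isGroupUnderConv_of_nonempty⟩

/-- If there are deterministic permutations, then the identity is among them. -/
theorem exists_birkhoff_eq_one (h : G.deterministic.Nonempty) :
    ∃ φ ∈ G.deterministic, G.birkhoff φ = permMatrix 1 := by
  obtain ⟨_, hG⟩ := G.isGroupUnderConv_of_nonempty h
  obtain ⟨σ, hσ⟩ := (1 : G.deterministic).2
  refine ⟨_, (1 : G.deterministic).2, ?_⟩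
  -- The slice of the neutral element is an idempotent permutation matrix, and the only idempotent
  -- permutation is 1.
  have h1 := hG 1 1
  rw [mul_one] at h1
  have h2 := G.birkhoff_conv (1 : G.deterministic) (1 : G.deterministic)
  rw [← h1, hσ, ← permMatrix_mul] at h2
  have : σ = 1 := by simpa using permMatrix_injective h2
  rw [hσ, this]

theorem deterministic_nonempty_of_isStateOn {ε : G.regular →⋆ₐ[ℂ] ℂ} (hε : G.IsCounit ε)
    (h : G.IsStateOn ε) : G.deterministic.Nonempty := by
  obtain ⟨φ, hφ⟩ := h
  refine ⟨φ, 1, ?_⟩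
  ext i j
  rw [birkhoff, Matrix.of_apply, permMatrix, Matrix.of_apply]
  exact (hφ (G.gen i j)).trans ((hε i j).trans (by simp [eq_comm]))

theorem isStateOn_of_deterministic_nonempty {ε : G.regular →⋆ₐ[ℂ] ℂ} (hε : G.IsCounit ε)
    (h : G.deterministic.Nonempty) : G.IsStateOn ε := by
  obtain ⟨φ, hφ, h1⟩ := G.exists_birkhoff_eq_one h
  refine ⟨φ, fun x => ?_⟩
  have : G.IsCounit ((φ.toStarAlgHom (definiteSubalgebra_eq_top hφ)).comp G.regular.subtype) := by
    intro i j
    refine (congrFun (congrFun h1 i) j).trans ?_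
    simp [permMatrix, eq_comm]
  exact DFunLike.congr_fun (IsCounit.unique G this hε) x

end QuantumPermutationGroup
end QuantumPerm
namespace QuantumPerm

/-! ### Spaces of matrices with the Hilbert-Schmidt inner product -/

section HilbertSchmidt

open Matrix Module

variable {n : Type*} [Fintype n]

/-- A space of complex matrices has a basis that is orthonormal for the Hilbert-Schmidt inner
product. -/
theorem exists_hilbertSchmidt_basis (V : Submodule ℂ (Matrix n n ℂ)) :
    ∃ b : Fin (finrank ℂ V) → Matrix n n ℂ, (∀ i, b i ∈ V) ∧
      (∀ i j, ∑ k, ∑ m, star (b i k m) * b j k m = if i = j then 1 else 0) ∧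
      ∀ X ∈ V, X = ∑ i, (∑ k, ∑ m, star (b i k m) * X k m) • b i := by
  let e : Matrix n n ℂ ≃ₗ[ℂ] EuclideanSpace ℂ (n × n) :=
    (LinearEquiv.curry ℂ ℂ n n).symm.trans (WithLp.linearEquiv 2 ℂ (n × n → ℂ)).symm
  have he (X Y : Matrix n n ℂ) : ⟪e X, e Y⟫_ℂ = ∑ k, ∑ m, star (X k m) * Y k m := by
    rw [PiLp.inner_apply, Fintype.sum_prod_type]
    exact Finset.sum_congr rfl fun k _ => Finset.sum_congr rfl fun m _ => mul_comm _ _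
  let W := V.map (e : Matrix n n ℂ →ₗ[ℂ] EuclideanSpace ℂ (n × n))
  have hW : finrank ℂ W = finrank ℂ V := LinearEquiv.finrank_map_eq e V
  let b := (stdOrthonormalBasis ℂ W).reindex (finCongr hW)
  refine ⟨fun i => e.symm (b i), fun i => ?_, fun i j => ?_, fun X hX => ?_⟩
  · obtain ⟨X, hX, h⟩ := (b i).2
    change e.symm (b i : EuclideanSpace ℂ (n × n)) ∈ V
    rw [← h]
    simpa using hX
  · rw [← he, LinearEquiv.apply_symm_apply, LinearEquiv.apply_symm_apply, ← Submodule.coe_inner]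
    exact (orthonormal_iff_ite.mp b.orthonormal) i j
  · apply e.injective
    have h := congrArg Subtype.val (b.sum_repr' ⟨e X, Submodule.mem_map_of_mem hX⟩)
    rw [map_sum]
    simp only [map_smul, LinearEquiv.apply_symm_apply]
    refine h.symm.trans ?_
    simp only [Submodule.coe_sum, Submodule.coe_smul]
    refine Finset.sum_congr rfl fun i _ => ?_
    have h1 := he (e.symm (b i)) X
    rw [LinearEquiv.apply_symm_apply] at h1
    exact congrArg (· • (b i : EuclideanSpace ℂ (n × n))) h1

end HilbertSchmidt

/-! ### Corepresentations -/

section MinTensor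

variable {A : Type u} [CStarAlgebra A] {B : Type v} [CStarAlgebra B]

theorem tmin_mul (a a' : A) (b b' : B) : tmin (a * a') (b * b') = tmin a b * tmin a' b' := by
  rw [tmin, tmin, tmin, ← map_mul, Algebra.TensorProduct.tmul_mul_tmul]

theorem tmin_star (a : A) (b : B) : tmin (star a) (star b) = star (tmin a b) := by
  rw [tmin, tmin, ← StarHomClass.map_star, TensorProduct.star_tmul]

theorem tmin_one : tmin (1 : A) (1 : B) = 1 := by
  rw [tmin, ← Algebra.TensorProduct.one_def, map_one]

theorem tmin_sum_left {ι : Type*} (s : Finset ι) (f : ι → A) (b : B) :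
    tmin (∑ i ∈ s, f i) b = ∑ i ∈ s, tmin (f i) b := by
  simp only [tmin, TensorProduct.sum_tmul, map_sum]

theorem tmin_sum_right {ι : Type*} (s : Finset ι) (a : A) (f : ι → B) :
    tmin a (∑ i ∈ s, f i) = ∑ i ∈ s, tmin a (f i) := by
  simp only [tmin, TensorProduct.tmul_sum, map_sum]

theorem tmin_smul_left (r : ℂ) (a : A) (b : B) : tmin (r • a) b = r • tmin a b := by
  simp only [tmin, ← TensorProduct.smul_tmul', map_smul]

theorem tmin_smul_right (r : ℂ) (a : A) (b : B) : tmin a (r • b) = r • tmin a b := by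
  simp only [tmin, TensorProduct.tmul_smul, map_smul]

theorem tmin_zero_left (b : B) : tmin (0 : A) b = 0 := by
  rw [tmin, TensorProduct.zero_tmul, map_zero]

theorem tmin_zero_right (a : A) : tmin a (0 : B) = 0 := by
  rw [tmin, TensorProduct.tmul_zero, map_zero]

end MinTensor

open Matrix

/-- A finite-dimensional unitary corepresentation whose entrywise adjoint is unitary as well. -/
structure IsBiunitaryCorep {A : Type u} [CStarAlgebra A] (Δ : A →⋆ₐ[ℂ] MinTensor A A)
    {n : Type*} [Fintype n] [DecidableEq n] (w : Matrix n n A) : Prop where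
  comul : ∀ i j, Δ (w i j) = ∑ k, tmin (w i k) (w k j)
  conjTranspose_mul : wᴴ * w = 1
  mul_conjTranspose : w * wᴴ = 1
  transpose_mul : wᵀ * w.map star = 1
  mul_transpose : w.map star * wᵀ = 1

namespace IsBiunitaryCorep

variable {A : Type u} [CStarAlgebra A] {Δ : A →⋆ₐ[ℂ] MinTensor A A}
  {n : Type*} [Fintype n] [DecidableEq n] {w : Matrix n n A}
  {m : Type*} [Fintype m] [DecidableEq m] {v : Matrix m m A}

theorem one : IsBiunitaryCorep Δ (1 : Matrix Unit Unit A) where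
  comul i j := by simp [tmin_one]
  conjTranspose_mul := by simp
  mul_conjTranspose := by simp
  transpose_mul := by simp
  mul_transpose := by simp

theorem conj (hw : IsBiunitaryCorep Δ w) : IsBiunitaryCorep Δ (w.map star) where
  comul i j := by
    simp only [Matrix.map_apply, StarHomClass.map_star, hw.comul, star_sum, tmin_star]
  conjTranspose_mul := by
    rw [← hw.transpose_mul]; congr 1; ext; simp
  mul_conjTranspose := by
    rw [← hw.mul_transpose]; congr 1; ext; simp
  transpose_mul := by
    rw [← hw.conjTranspose_mul]; congr 1; ext; simp
  mul_transpose := by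
    rw [← hw.mul_conjTranspose]; congr 1; ext; simp

theorem directSum (hw : IsBiunitaryCorep Δ w) (hv : IsBiunitaryCorep Δ v) :
    IsBiunitaryCorep Δ (fromBlocks w 0 0 v) where
  comul i j := by
    rcases i with i | i <;> rcases j with j | j <;>
      simp [hw.comul, hv.comul, tmin_zero_left, tmin_zero_right]
  conjTranspose_mul := by
    simp [fromBlocks_conjTranspose, fromBlocks_multiply, hw.conjTranspose_mul, hv.conjTranspose_mul]
  mul_conjTranspose := by
    simp [fromBlocks_conjTranspose, fromBlocks_multiply, hw.mul_conjTranspose, hv.mul_conjTranspose]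
  transpose_mul := by
    simp [fromBlocks_transpose, fromBlocks_multiply, fromBlocks_map, hw.transpose_mul,
      hv.transpose_mul]
  mul_transpose := by
    simp [fromBlocks_transpose, fromBlocks_multiply, fromBlocks_map, hw.mul_transpose,
      hv.mul_transpose]

/-- The tensor product of two matrices over a (noncommutative) algebra. -/
def _root_.QuantumPerm.tensorMatrix (w : Matrix n n A) (v : Matrix m m A) :
    Matrix (n × m) (n × m) A :=
  Matrix.of fun p q => w p.1 q.1 * v p.2 q.2

/-- The entries do not commute, so each of the four relations collapses from the inside: the two
adjacent middle factors come from the same corepresentation, and their index is summed first. -/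
theorem tensor (hw : IsBiunitaryCorep Δ w) (hv : IsBiunitaryCorep Δ v) :
    IsBiunitaryCorep Δ (tensorMatrix w v) where
  comul i j := by
    simp only [tensorMatrix, Matrix.of_apply, map_mul, hw.comul, hv.comul, tmin_mul,
      Fintype.sum_prod_type]
    exact Finset.sum_mul_sum _ _ _ _
  conjTranspose_mul := by
    ext i j
    have hw' := congrFun (congrFun hw.conjTranspose_mul i.1) j.1
    have hv' := congrFun (congrFun hv.conjTranspose_mul i.2) j.2
    simp only [Matrix.mul_apply, conjTranspose_apply] at hw' hv'
    simp only [tensorMatrix, Matrix.mul_apply, conjTranspose_apply, Matrix.of_apply, star_mul,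
      Fintype.sum_prod_type_right, mul_assoc]
    simp only [← mul_assoc (star (w _ _)), ← Finset.mul_sum, ← Finset.sum_mul, hw']
    simp only [Matrix.one_apply, ite_mul, one_mul, zero_mul, mul_ite, mul_zero] at hv' ⊢
    by_cases h : i.1 = j.1
    · simp [h, hv', Prod.ext_iff]
    · simp [h, Prod.ext_iff]
  mul_conjTranspose := by
    ext i j
    have hw' := congrFun (congrFun hw.mul_conjTranspose i.1) j.1
    have hv' := congrFun (congrFun hv.mul_conjTranspose i.2) j.2
    simp only [Matrix.mul_apply, conjTranspose_apply] at hw' hv'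
    simp only [tensorMatrix, Matrix.mul_apply, conjTranspose_apply, Matrix.of_apply, star_mul,
      Fintype.sum_prod_type, mul_assoc]
    simp only [← mul_assoc (v _ _), ← Finset.mul_sum, ← Finset.sum_mul, hv']
    simp only [Matrix.one_apply, ite_mul, one_mul, zero_mul, mul_ite, mul_zero] at hw' ⊢
    by_cases h : i.2 = j.2
    · simp [h, hw', Prod.ext_iff]
    · simp [h, Prod.ext_iff]
  transpose_mul := by
    ext i j
    have hw' := congrFun (congrFun hw.transpose_mul i.1) j.1
    have hv' := congrFun (congrFun hv.transpose_mul i.2) j.2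
    simp only [Matrix.mul_apply, transpose_apply, Matrix.map_apply] at hw' hv'
    simp only [tensorMatrix, Matrix.mul_apply, transpose_apply, Matrix.map_apply, Matrix.of_apply,
      star_mul, Fintype.sum_prod_type, mul_assoc]
    simp only [← mul_assoc (v _ _), ← Finset.mul_sum, ← Finset.sum_mul, hv']
    simp only [Matrix.one_apply, ite_mul, one_mul, zero_mul, mul_ite, mul_zero] at hw' ⊢
    by_cases h : i.2 = j.2
    · simp [h, hw', Prod.ext_iff]
    · simp [h, Prod.ext_iff]
  mul_transpose := by
    ext i j
    have hw' := congrFun (congrFun hw.mul_transpose i.1) j.1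
    have hv' := congrFun (congrFun hv.mul_transpose i.2) j.2
    simp only [Matrix.mul_apply, transpose_apply, Matrix.map_apply] at hw' hv'
    simp only [tensorMatrix, Matrix.mul_apply, transpose_apply, Matrix.map_apply, Matrix.of_apply,
      star_mul, Fintype.sum_prod_type_right, mul_assoc]
    simp only [← mul_assoc (star (w _ _)), ← Finset.mul_sum, ← Finset.sum_mul, hw']
    simp only [Matrix.one_apply, ite_mul, one_mul, zero_mul, mul_ite, mul_zero] at hv' ⊢
    by_cases h : i.1 = j.1
    · simp [h, hv', Prod.ext_iff]
    · simp [h, Prod.ext_iff]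

end IsBiunitaryCorep

/-- Compress the row sum by `u i k`: the sum over `l` of `u i k * u i l * u i k` is `u i k`, which
is already the term `l = k`. The other terms are of the form `star x * x` and add up to zero. -/
theorem IsMagicUnitary.mul_eq_zero_of_ne {N : ℕ} {A : Type u} [CStarAlgebra A] [Nontrivial A]
    {u : Matrix (Fin N) (Fin N) A} (hu : IsMagicUnitary u) (i : Fin N) {j k : Fin N} (hjk : j ≠ k) :
    u i j * u i k = 0 := by
  have hs (j : Fin N) : star (u i j) = u i j := (hu.isStarProjection i j).isSelfAdjoint.star_eq
  have hi (j : Fin N) : u i j * u i j = u i j := (hu.isStarProjection i j).isIdempotentElem.eq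
  have h1 : ∑ l ∈ Finset.univ.erase k, star (u i l * u i k) * (u i l * u i k) = 0 := by
    have h2 (l : Fin N) : star (u i l * u i k) * (u i l * u i k) = u i k * u i l * u i k := by
      rw [star_mul, hs, hs, mul_assoc, ← mul_assoc (u i l), hi, mul_assoc]
    simp only [h2]
    have h3 : ∑ l, u i k * u i l * u i k = u i k := by
      rw [← Finset.sum_mul, ← Finset.mul_sum, hu.row_sum, mul_one, hi]
    rw [← Finset.add_sum_erase _ _ (Finset.mem_univ k), hi, hi] at h3
    exact left_eq_add.mp h3.symm
  exact State.eq_zero_of_sum_star_mul_self_eq_zero _ _ h1 (by simp [hjk])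

theorem IsMagicUnitary.transpose {N : ℕ} {A : Type u} [CStarAlgebra A]
    {u : Matrix (Fin N) (Fin N) A} (hu : IsMagicUnitary u) : IsMagicUnitary uᵀ where
  isStarProjection i j := hu.isStarProjection j i
  row_sum := hu.col_sum
  col_sum := hu.row_sum

theorem IsMagicUnitary.map_star {N : ℕ} {A : Type u} [CStarAlgebra A]
    {u : Matrix (Fin N) (Fin N) A} (hu : IsMagicUnitary u) : u.map star = u := by
  ext i j
  exact (hu.isStarProjection i j).isSelfAdjoint.star_eq

theorem IsMagicUnitary.mul_transpose {N : ℕ} {A : Type u} [CStarAlgebra A] [Nontrivial A]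
    {u : Matrix (Fin N) (Fin N) A} (hu : IsMagicUnitary u) : u * uᵀ = 1 := by
  ext i j
  rw [Matrix.mul_apply]
  simp only [Matrix.transpose_apply]
  by_cases h : i = j
  · subst h
    simp only [(hu.isStarProjection _ _).isIdempotentElem.eq, hu.row_sum, Matrix.one_apply_eq]
  · rw [Matrix.one_apply_ne h]
    exact Finset.sum_eq_zero fun k _ => hu.transpose.mul_eq_zero_of_ne k h

theorem QuantumPermutationGroup.isBiunitaryCorep {N : ℕ} {A : Type u} [CStarAlgebra A]
    [Nontrivial A] (G : QuantumPermutationGroup N A) : IsBiunitaryCorep G.comul G.u := by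
  have h1 := G.magic.mul_transpose
  have h2 : G.uᵀ * G.u = 1 := by simpa using G.magic.transpose.mul_transpose
  have h3 : G.uᴴ = G.uᵀ := by
    rw [Matrix.conjTranspose]; exact G.magic.transpose.map_star
  refine ⟨G.comul_u, ?_, ?_, ?_, ?_⟩ <;> simp only [h3, G.magic.map_star, h1, h2]

end QuantumPerm
namespace QuantumPerm
open Matrix

/-! ### The algebra of slices of a corepresentation -/

/-- An isometric matrix whose entrywise adjoint is isometric as well is a unitary. -/
theorem mul_conjTranspose_eq_one_of_biisometry {A : Type u} [CStarAlgebra A] [Nontrivial A]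
    {ι : Type*} [Fintype ι] [DecidableEq ι] {M : Matrix ι ι A} (h : Mᴴ * M = 1)
    (h' : Mᵀ * M.map star = 1) : M * Mᴴ = 1 := by
  set Q := 1 - M * Mᴴ with hQ
  have hQs : Qᴴ = Q := by simp [hQ]
  have hQQ : Qᴴ * Q = Q := by
    have h1 : M * Mᴴ * (M * Mᴴ) = M * Mᴴ := by
      rw [Matrix.mul_assoc, ← Matrix.mul_assoc Mᴴ, h, Matrix.one_mul]
    rw [hQs, hQ, sub_mul, mul_sub, mul_sub, h1]
    simp
  -- The traces of `M * Mᴴ` and of `Mᵀ * M.map star` are the same double sum with the factors in the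
  -- same order, so no commutativity is needed. As `Q = Qᴴ * Q`, a vanishing trace makes `Q` zero.
  have htr : Q.trace = 0 := by
    rw [hQ, Matrix.trace_sub, sub_eq_zero]
    have h1 := congrArg Matrix.trace h'
    rw [← h1]
    simp only [Matrix.trace, Matrix.diag_apply, Matrix.mul_apply, Matrix.transpose_apply,
      Matrix.map_apply, Matrix.conjTranspose_apply]
    exact Finset.sum_comm
  rw [← hQQ] at htr
  simp only [Matrix.trace, Matrix.diag_apply, Matrix.mul_apply, conjTranspose_apply] at htr
  rw [← Fintype.sum_prod_type' (f := fun i k => star (Q k i) * Q k i)] at htr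
  have hQ0 : Q = 0 := by
    ext k i
    exact State.eq_zero_of_sum_star_mul_self_eq_zero _ (fun p : ι × ι => Q p.2 p.1) htr
      (Finset.mem_univ (i, k))
  rw [hQ, sub_eq_zero] at hQ0
  exact hQ0.symm

namespace IsBiunitaryCorep

variable {A : Type u} [CStarAlgebra A] {Δ : A →⋆ₐ[ℂ] MinTensor A A}
  {n : Type*} [Fintype n] [DecidableEq n] {w : Matrix n n A}

/-- The span of the slices of a matrix by states. -/
def _root_.QuantumPerm.sliceSpan {n : Type*} (w : Matrix n n A) : Submodule ℂ (Matrix n n ℂ) :=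
  Submodule.span ℂ (Set.range fun φ : State A => w.map φ)

theorem _root_.QuantumPerm.map_mem_sliceSpan {n : Type*} (w : Matrix n n A) (φ : State A) :
    w.map φ ∈ sliceSpan w :=
  Submodule.subset_span ⟨φ, rfl⟩

theorem map_conv (hw : IsBiunitaryCorep Δ w) (φ ψ : State A) :
    w.map ((φ.prod ψ).comp Δ) = w.map φ * w.map ψ := by
  ext i j
  simp only [Matrix.map_apply, State.comp_apply, hw.comul, map_sum, State.prod_tmin,
    Matrix.mul_apply]

theorem mul_mem_sliceSpan (hw : IsBiunitaryCorep Δ w) {X Y : Matrix n n ℂ}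
    (hX : X ∈ sliceSpan w) (hY : Y ∈ sliceSpan w) : X * Y ∈ sliceSpan w := by
  induction hX using Submodule.span_induction with
  | mem X hX =>
    obtain ⟨φ, rfl⟩ := hX
    induction hY using Submodule.span_induction with
    | mem Y hY =>
      obtain ⟨ψ, rfl⟩ := hY
      change w.map φ * w.map ψ ∈ _
      rw [← hw.map_conv]
      exact map_mem_sliceSpan _ _
    | zero => rw [mul_zero]; exact zero_mem _
    | add X Y _ _ hX hY => rw [mul_add]; exact add_mem hX hY
    | smul r X _ hX => rw [Matrix.mul_smul]; exact Submodule.smul_mem _ _ hX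
  | zero => rw [zero_mul]; exact zero_mem _
  | add X Y _ _ hX hY => rw [add_mul]; exact add_mem hX hY
  | smul r X _ hX => rw [Matrix.smul_mul]; exact Submodule.smul_mem _ _ hX

section

variable {ι : Type*} [Fintype ι] [DecidableEq ι] {q : Type*} [Fintype q]
  {b : ι → Matrix q q ℂ}

/-- Parseval's identity with coefficients in `A`; it turns relations for the expanded matrices into
relations for their coordinates. -/
theorem sum_star_mul_of_orthonormal
    (hb : ∀ i j, ∑ k, ∑ m, star (b i k m) * b j k m = if i = j then 1 else 0) (x y : ι → A) :
    ∑ k, ∑ m, star (∑ i, b i k m • x i) * (∑ i, b i k m • y i) = ∑ i, star (x i) * y i := by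
  have h1 (k m : q) : star (∑ i, b i k m • x i) * (∑ i, b i k m • y i)
      = ∑ i, ∑ j, (star (b i k m) * b j k m) • (star (x i) * y j) := by
    simp only [star_sum, star_smul, Finset.sum_mul_sum, smul_mul_smul_comm]
  simp only [h1]
  have h2 : ∑ k, ∑ m, ∑ i, ∑ j, (star (b i k m) * b j k m) • (star (x i) * y j)
      = ∑ i, ∑ j, (∑ k, ∑ m, star (b i k m) * b j k m) • (star (x i) * y j) := by
    simp only [Finset.sum_smul]
    rw [Finset.sum_congr rfl fun k _ => Finset.sum_comm, Finset.sum_comm]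
    refine Finset.sum_congr rfl fun i _ => ?_
    rw [Finset.sum_congr rfl fun k _ => Finset.sum_comm, Finset.sum_comm]
  rw [h2]
  simp only [hb]
  simp

theorem sum_mul_star_of_orthonormal
    (hb : ∀ i j, ∑ k, ∑ m, star (b i k m) * b j k m = if i = j then 1 else 0) (x y : ι → A) :
    ∑ k, ∑ m, (∑ i, b i k m • x i) * star (∑ i, b i k m • y i) = ∑ i, x i * star (y i) := by
  have h1 (k m : q) : (∑ i, b i k m • x i) * star (∑ i, b i k m • y i)
      = ∑ i, ∑ j, (star (b j k m) * b i k m) • (x i * star (y j)) := by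
    simp only [star_sum, star_smul, Finset.sum_mul_sum, smul_mul_smul_comm, mul_comm]
  simp only [h1]
  have h2 : ∑ k, ∑ m, ∑ i, ∑ j, (star (b j k m) * b i k m) • (x i * star (y j))
      = ∑ i, ∑ j, (∑ k, ∑ m, star (b j k m) * b i k m) • (x i * star (y j)) := by
    simp only [Finset.sum_smul]
    rw [Finset.sum_congr rfl fun k _ => Finset.sum_comm, Finset.sum_comm]
    refine Finset.sum_congr rfl fun i _ => ?_
    rw [Finset.sum_congr rfl fun k _ => Finset.sum_comm, Finset.sum_comm]
  rw [h2]
  simp only [hb]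
  simp

end

/-- Multiplication by a corepresentation is a surjection of the matrices with all slices in the
slice algebra. -/
theorem exists_eq_mul [Nontrivial A] (hw : IsBiunitaryCorep Δ w) {z : Matrix n n A}
    (hz : ∀ φ : State A, z.map φ ∈ sliceSpan w) :
    ∃ y : Matrix n n A, (∀ φ : State A, y.map φ ∈ sliceSpan w) ∧ z = w * y := by
  obtain ⟨b, hbV, hb, hexp⟩ := exists_hilbertSchmidt_basis (sliceSpan w)
  have expand (z : Matrix n n A) (hz : ∀ φ : State A, z.map φ ∈ sliceSpan w) (k m : n) :
      z k m = ∑ i, b i k m • ∑ k', ∑ m', star (b i k' m') • z k' m' := by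
    refine State.eq_of_forall fun φ => ?_
    have h1 := congrFun (congrFun (hexp _ (hz φ)) k) m
    rw [Matrix.map_apply] at h1
    rw [h1, Matrix.sum_apply, map_sum]
    refine Finset.sum_congr rfl fun i _ => ?_
    simp only [Matrix.smul_apply, Matrix.map_apply, map_smul, map_sum, smul_eq_mul]
    rw [mul_comm]
  -- `c j` is `w * b j`. Its slices are products of elements of the slice algebra, so it expands in
  -- the basis with coefficients in `A`; these form the matrix `M` of left multiplication by `w`.
  set c : Fin (Module.finrank ℂ (sliceSpan w)) → Matrix n n A :=
    fun j => Matrix.of fun k m => ∑ l, b j l m • w k l with hc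
  have hcV (j) (φ : State A) : (c j).map φ ∈ sliceSpan w := by
    have : (c j).map φ = w.map φ * b j := by
      ext k m
      simp [hc, Matrix.mul_apply, mul_comm]
    rw [this]
    exact hw.mul_mem_sliceSpan (map_mem_sliceSpan w φ) (hbV j)
  set M : Matrix (Fin (Module.finrank ℂ (sliceSpan w))) (Fin (Module.finrank ℂ (sliceSpan w))) A :=
    Matrix.of fun i j => ∑ k, ∑ m, star (b i k m) • c j k m with hM
  have hcM (j) (k m : n) : c j k m = ∑ i, b i k m • M i j := expand _ (hcV j) k m
  -- Column `m` of `c l` is `w` applied to column `m` of `b l`, and `w` is isometric; `e2` is the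
  -- counterpart for the entrywise adjoint.
  have e1 (l j) (m : n) : ∑ k, star (c l k m) * c j k m = (∑ k, star (b l k m) * b j k m) • 1 := by
    have h1 (k : n) : star (c l k m) * c j k m
        = ∑ s, ∑ t, (star (b l s m) * b j t m) • (star (w k s) * w k t) := by
      simp only [hc, Matrix.of_apply, star_sum, star_smul, Finset.sum_mul_sum, smul_mul_smul_comm]
    have h2 (s t : n) : ∑ k, star (w k s) * w k t = if s = t then 1 else 0 := by
      rw [← Matrix.one_apply, ← hw.conjTranspose_mul]
      simp [Matrix.mul_apply]
    simp only [h1]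
    rw [Finset.sum_comm]
    simp only [fun s => Finset.sum_comm (γ := n) (s := Finset.univ) (t := Finset.univ)
      (f := fun k t => (star (b l s m) * b j t m) • (star (w k s) * w k t)), ← Finset.smul_sum, h2]
    simp [Finset.sum_smul]
  have e2 (l j) (m : n) : ∑ k, c l k m * star (c j k m) = (∑ k, star (b j k m) * b l k m) • 1 := by
    have h1 (k : n) : c l k m * star (c j k m)
        = ∑ s, ∑ t, (star (b j t m) * b l s m) • (w k s * star (w k t)) := by
      simp only [hc, Matrix.of_apply, star_sum, star_smul, Finset.sum_mul_sum, smul_mul_smul_comm,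
        mul_comm]
    have h2 (s t : n) : ∑ k, w k s * star (w k t) = if s = t then 1 else 0 := by
      rw [← Matrix.one_apply, ← hw.transpose_mul]
      simp [Matrix.mul_apply]
    simp only [h1]
    rw [Finset.sum_comm]
    simp only [fun s => Finset.sum_comm (γ := n) (s := Finset.univ) (t := Finset.univ)
      (f := fun k t => (star (b j t m) * b l s m) • (w k s * star (w k t))), ← Finset.smul_sum, h2]
    simp [Finset.sum_smul]
  have hMM : Mᴴ * M = 1 := by
    ext l j
    simp only [Matrix.mul_apply, conjTranspose_apply]
    rw [← sum_star_mul_of_orthonormal hb (fun i => M i l) (fun i => M i j)]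
    simp only [← hcM]
    rw [Finset.sum_comm]
    simp only [e1, ← Finset.sum_smul]
    rw [Finset.sum_comm, hb, Matrix.one_apply]
    split_ifs <;> simp
  have hMM' : Mᵀ * M.map star = 1 := by
    ext l j
    simp only [Matrix.mul_apply, transpose_apply, Matrix.map_apply]
    rw [← sum_mul_star_of_orthonormal hb (fun i => M i l) (fun i => M i j)]
    simp only [← hcM]
    rw [Finset.sum_comm]
    simp only [e2, ← Finset.sum_smul]
    rw [Finset.sum_comm, hb, Matrix.one_apply]
    simp only [eq_comm (a := j)]
    split_ifs <;> simp
  -- Now `M` is onto, and `Mᴴ` applied to the coordinates of `z` gives those of the preimage.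
  have hM1 := mul_conjTranspose_eq_one_of_biisometry hMM hMM'
  set x := fun i => ∑ k', ∑ m', star (b i k' m') • z k' m' with hx
  set y := Mᴴ *ᵥ x with hy
  have hxy : M *ᵥ y = x := by rw [hy, Matrix.mulVec_mulVec, hM1, Matrix.one_mulVec]
  refine ⟨Matrix.of fun l m => ∑ j, b j l m • y j, fun φ => ?_, ?_⟩
  · have : (Matrix.of fun l m => ∑ j, b j l m • y j).map φ = ∑ j, φ (y j) • b j := by
      ext l m
      simp [Matrix.sum_apply, mul_comm]
    rw [this]
    exact Submodule.sum_mem _ fun j _ => Submodule.smul_mem _ _ (hbV j)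
  · ext k m
    rw [expand z hz k m]
    change ∑ i, b i k m • x i = _
    rw [← hxy]
    simp only [Matrix.mulVec, dotProduct, Matrix.mul_apply, Matrix.of_apply, Finset.smul_sum,
      Finset.mul_sum, mul_smul_comm]
    rw [Finset.sum_comm, Finset.sum_comm (s := (Finset.univ : Finset n))]
    refine Finset.sum_congr rfl fun j _ => ?_
    simp only [← smul_mul_assoc, ← Finset.sum_mul]
    rw [← hcM]
    rfl

/-- Solve `w = w * y` with all slices of `y` in the slice algebra; cancelling `w` leaves `y = 1`.
This replaces a state that restricts to the counit, which need not exist. -/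
theorem one_mem_sliceSpan [Nontrivial A] (hw : IsBiunitaryCorep Δ w) : 1 ∈ sliceSpan w := by
  obtain ⟨y, hy, h⟩ := hw.exists_eq_mul (map_mem_sliceSpan w)
  have hy1 : y = 1 := by
    have := congrArg (wᴴ * ·) h
    simp only [← Matrix.mul_assoc, hw.conjTranspose_mul, Matrix.one_mul] at this
    exact this.symm
  obtain ⟨φ⟩ : Nonempty (State A) := inferInstance
  have := hy φ
  rwa [hy1, Matrix.map_one _ (map_zero φ) φ.map_one] at this

/-- Solving `1 = w * y` gives `y = wᴴ`, whose slices are the adjoints of the slices of `w`. -/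
theorem conjTranspose_mem_sliceSpan [Nontrivial A] (hw : IsBiunitaryCorep Δ w)
    {X : Matrix n n ℂ} (hX : X ∈ sliceSpan w) : Xᴴ ∈ sliceSpan w := by
  obtain ⟨y, hy, h⟩ := hw.exists_eq_mul (z := 1) fun φ => by
    rw [Matrix.map_one _ (map_zero φ) φ.map_one]; exact hw.one_mem_sliceSpan
  have hy1 : y = wᴴ := by
    have := congrArg (wᴴ * ·) h
    simp only [← Matrix.mul_assoc, hw.conjTranspose_mul, Matrix.one_mul, Matrix.mul_one] at this
    exact this.symm
  induction hX using Submodule.span_induction with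
  | mem X hX =>
    obtain ⟨φ, rfl⟩ := hX
    have h1 := hy φ
    have h2 : (w.map φ)ᴴ = y.map φ := by
      ext i j
      simp [hy1, φ.apply_star]
    change (w.map φ)ᴴ ∈ _
    rwa [h2]
  | zero => rw [conjTranspose_zero]; exact zero_mem _
  | add X Y _ _ hX hY => rw [conjTranspose_add]; exact add_mem hX hY
  | smul r X _ hX => rw [conjTranspose_smul]; exact Submodule.smul_mem _ _ hX

/-- A linear relation between the coefficients of a corepresentation is satisfied by the
coefficients of the trivial one. -/
theorem sum_eq_zero [Nontrivial A] (hw : IsBiunitaryCorep Δ w) {c : Matrix n n ℂ}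
    (hc : ∑ i, ∑ j, c i j • w i j = 0) : ∑ i, c i i = 0 := by
  have key (X : Matrix n n ℂ) (hX : X ∈ sliceSpan w) : ∑ i, ∑ j, c i j * X i j = 0 := by
    induction hX using Submodule.span_induction with
    | mem X hX =>
      obtain ⟨φ, rfl⟩ := hX
      have := congrArg φ hc
      simpa using this
    | zero => simp
    | add X Y _ _ hX hY =>
      simp only [Matrix.add_apply, mul_add, Finset.sum_add_distrib, hX, hY, add_zero]
    | smul r X _ hX =>
      simp only [Matrix.smul_apply, smul_eq_mul, mul_left_comm _ r, ← Finset.mul_sum, hX, mul_zero]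
  simpa [Matrix.one_apply] using key 1 hw.one_mem_sliceSpan

end IsBiunitaryCorep

end QuantumPerm
namespace QuantumPerm
open Matrix

/-! ### The counit -/

namespace QuantumPermutationGroup

variable {N : ℕ} {A : Type u} [CStarAlgebra A] (G : QuantumPermutationGroup N A)

/-- The evaluation of a noncommutative polynomial at the generators. -/
def evalGen : FreeAlgebra ℂ (Fin N × Fin N) →ₐ[ℂ] A :=
  FreeAlgebra.lift ℂ fun p => G.u p.1 p.2

/-- The evaluation of a noncommutative polynomial at the entries of the identity matrix. -/
def evalOne (N : ℕ) : FreeAlgebra ℂ (Fin N × Fin N) →ₐ[ℂ] ℂ :=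
  FreeAlgebra.lift ℂ fun p => if p.1 = p.2 then 1 else 0

/-- Sums of polynomials correspond to direct sums and products to tensor products. The same
coefficients `c` serve for the identity matrix, because both constructions take identity matrices to
identity matrices. -/
theorem exists_corep_of_polynomial [Nontrivial A] (f : FreeAlgebra ℂ (Fin N × Fin N)) :
    ∃ (n : Type) (_ : Fintype n) (_ : DecidableEq n) (w : Matrix n n A) (c : Matrix n n ℂ),
      IsBiunitaryCorep G.comul w ∧ G.evalGen f = ∑ i, ∑ j, c i j • w i j ∧
        evalOne N f = ∑ i, c i i := by
  induction f using FreeAlgebra.induction with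
  | grade0 r =>
    refine ⟨Unit, inferInstance, inferInstance, 1, Matrix.of fun _ _ => r, IsBiunitaryCorep.one,
      ?_, ?_⟩
    · rw [AlgHom.commutes, Algebra.algebraMap_eq_smul_one]; simp
    · rw [AlgHom.commutes]; simp
  | grade1 p =>
    refine ⟨Fin N, inferInstance, inferInstance, G.u, Matrix.single p.1 p.2 1,
      G.isBiunitaryCorep, ?_, ?_⟩
    · rw [evalGen, FreeAlgebra.lift_ι_apply]
      simp [Matrix.single_apply, ite_and]
    · rw [evalOne, FreeAlgebra.lift_ι_apply]
      simp [Matrix.single_apply, ite_and]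
      simp [eq_comm]
  | mul f g hf hg =>
    obtain ⟨n, _, _, w, c, hw, hf1, hf2⟩ := hf
    obtain ⟨m, _, _, v, d, hv, hg1, hg2⟩ := hg
    refine ⟨n × m, inferInstance, inferInstance, tensorMatrix w v,
      Matrix.of fun p q => c p.1 q.1 * d p.2 q.2, hw.tensor hv, ?_, ?_⟩
    · rw [map_mul, hf1, hg1]
      simp only [Fintype.sum_prod_type, tensorMatrix, Matrix.of_apply, Finset.sum_mul_sum,
        smul_mul_smul_comm]
    · rw [map_mul, hf2, hg2]
      simp only [Fintype.sum_prod_type, Matrix.of_apply, Finset.sum_mul_sum]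
  | add f g hf hg =>
    obtain ⟨n, _, _, w, c, hw, hf1, hf2⟩ := hf
    obtain ⟨m, _, _, v, d, hv, hg1, hg2⟩ := hg
    refine ⟨n ⊕ m, inferInstance, inferInstance, fromBlocks w 0 0 v,
      fromBlocks c 0 0 d, hw.directSum hv, ?_, ?_⟩
    · rw [map_add, hf1, hg1]
      simp
    · rw [map_add, hf2, hg2]
      simp

theorem evalOne_eq_zero [Nontrivial A] {f : FreeAlgebra ℂ (Fin N × Fin N)}
    (hf : G.evalGen f = 0) : evalOne N f = 0 := by
  obtain ⟨n, _, _, w, c, hw, hf1, hf2⟩ := G.exists_corep_of_polynomial f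
  rw [hf2]
  exact hw.sum_eq_zero (hf1 ▸ hf)

theorem star_u (i j : Fin N) : star (G.u i j) = G.u i j :=
  (G.magic.isStarProjection i j).isSelfAdjoint.star_eq

theorem star_gen (i j : Fin N) : star (G.gen i j) = G.gen i j :=
  Subtype.ext (G.star_u i j)

/-- The evaluation of a noncommutative polynomial at the generators, as a regular function. -/
def evalRegular : FreeAlgebra ℂ (Fin N × Fin N) →ₐ[ℂ] G.regular :=
  FreeAlgebra.lift ℂ fun p => G.gen p.1 p.2

theorem coe_evalRegular (f : FreeAlgebra ℂ (Fin N × Fin N)) :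
    (G.evalRegular f : A) = G.evalGen f := by
  have : (G.regular.subtype.toAlgHom).comp G.evalRegular = G.evalGen := by
    ext p
    simp [evalRegular, evalGen, gen]
  exact DFunLike.congr_fun this f

/-- No case for the adjoint is needed: the generators are self-adjoint, so the algebra they generate
is already closed under `star`. -/
theorem regular_induction {P : G.regular → Prop} (gen : ∀ i j, P (G.gen i j))
    (algebraMap : ∀ r : ℂ, P (algebraMap ℂ _ r)) (add : ∀ x y, P x → P y → P (x + y))
    (mul : ∀ x y, P x → P y → P (x * y)) (x : G.regular) : P x := by
  have key (x : A) (hx : x ∈ Algebra.adjoin ℂ (Set.range fun p : Fin N × Fin N => G.u p.1 p.2)) :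
      ∃ hx : x ∈ G.regular, P ⟨x, hx⟩ := by
    induction hx using Algebra.adjoin_induction with
    | mem x hx => obtain ⟨p, rfl⟩ := hx; exact ⟨_, gen p.1 p.2⟩
    | algebraMap r => exact ⟨_, algebraMap r⟩
    | add x y _ _ hx hy =>
      obtain ⟨hx, hx'⟩ := hx
      obtain ⟨hy, hy'⟩ := hy
      exact ⟨_, add _ _ hx' hy'⟩
    | mul x y _ _ hx hy =>
      obtain ⟨hx, hx'⟩ := hx
      obtain ⟨hy, hy'⟩ := hy
      exact ⟨_, mul _ _ hx' hy'⟩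
  obtain ⟨x, hx⟩ := x
  refine (key x ?_).2
  have hs : star (Set.range fun p : Fin N × Fin N => G.u p.1 p.2)
      = Set.range fun p : Fin N × Fin N => G.u p.1 p.2 := by
    ext y
    rw [Set.mem_star]
    constructor
    · rintro ⟨p, hp⟩
      exact ⟨p, by rw [← star_star y, ← hp]; exact (G.star_u _ _).symm⟩
    · rintro ⟨p, rfl⟩
      exact ⟨p, (G.star_u _ _).symm⟩
  have h2 : x ∈ (StarAlgebra.adjoin ℂ (Set.range fun p : Fin N × Fin N =>
    G.u p.1 p.2)).toSubalgebra := hx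
  rwa [StarAlgebra.adjoin_toSubalgebra, hs, Set.union_self] at h2

theorem evalRegular_surjective : Function.Surjective G.evalRegular := by
  intro x
  induction x using G.regular_induction with
  | gen i j => exact ⟨FreeAlgebra.ι ℂ (i, j), by simp [evalRegular]⟩
  | algebraMap r => exact ⟨algebraMap ℂ _ r, AlgHom.commutes _ _⟩
  | add x y hx hy =>
    obtain ⟨f, rfl⟩ := hx
    obtain ⟨g, rfl⟩ := hy
    exact ⟨f + g, map_add _ _ _⟩
  | mul x y hx hy =>
    obtain ⟨f, rfl⟩ := hx
    obtain ⟨g, rfl⟩ := hy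
    exact ⟨f * g, map_mul _ _ _⟩

theorem exists_algHom_evalRegular [Nontrivial A] :
    ∃ ε : G.regular →ₐ[ℂ] ℂ, ∀ f, ε (G.evalRegular f) = evalOne N f := by
  have hker (f g) (h : G.evalRegular f = G.evalRegular g) : evalOne N f = evalOne N g := by
    have h1 : G.evalGen (f - g) = 0 := by
      rw [map_sub, ← coe_evalRegular, ← coe_evalRegular, h, sub_self]
    rw [← sub_eq_zero, ← map_sub]
    exact G.evalOne_eq_zero h1
  choose s hs using G.evalRegular_surjective
  refine ⟨AlgHom.ofLinearMap ⟨⟨fun x => evalOne N (s x), fun x y => ?_⟩, fun r x => ?_⟩ ?_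
    fun x y => ?_, fun f => hker _ _ (hs _)⟩
  · rw [← map_add]; exact hker _ _ (by rw [map_add, hs, hs, hs])
  · rw [← map_smul]; exact hker _ _ (by rw [map_smul, hs, hs]; rfl)
  · rw [← map_one (evalOne N)]; exact hker _ _ (by rw [map_one, hs])
  · change evalOne N _ = evalOne N _ * evalOne N _
    rw [← map_mul]; exact hker _ _ (by rw [map_mul, hs, hs, hs])

/-- The counit of a quantum permutation group. -/
theorem exists_isCounit [Nontrivial A] : ∃ ε : G.regular →⋆ₐ[ℂ] ℂ, G.IsCounit ε := by
  obtain ⟨ε, hε⟩ := G.exists_algHom_evalRegular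
  have hgen (i j) : ε (G.gen i j) = if i = j then 1 else 0 := by
    have := hε (FreeAlgebra.ι ℂ (i, j))
    rwa [evalRegular, evalOne, FreeAlgebra.lift_ι_apply, FreeAlgebra.lift_ι_apply] at this
  suffices hstar : ∀ x, ε (star x) = star (ε x) from ⟨⟨ε, hstar⟩, hgen⟩
  intro x
  induction x using G.regular_induction with
  | gen i j => rw [star_gen, hgen]; split_ifs <;> simp
  | algebraMap r => rw [← algebraMap_star_comm, AlgHom.commutes, AlgHom.commutes]; rfl
  | add x y hx hy => rw [star_add, map_add, map_add, hx, hy, star_add]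
  | mul x y hx hy => rw [star_mul, map_mul, map_mul, hx, hy, star_mul]

end QuantumPermutationGroup
end QuantumPerm
namespace QuantumPerm

/-! ### Universal completions -/

theorem QuantumPermutationGroup.deterministic_nonempty_of_isUniversal {N : ℕ} {A : Type u}
    [CStarAlgebra A] [Nontrivial A] (G : QuantumPermutationGroup N A) (h : G.IsUniversal) :
    G.deterministic.Nonempty := by
  obtain ⟨ε, hε⟩ := G.exists_isCounit
  -- Targets in the universal property live in the universe of `A`, so the counit is viewed as
  -- taking values in the multiples of the unit of `A`; any state recovers the scalar.
  let c : ℂ →⋆ₐ[ℂ] A :=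
    { Algebra.ofId ℂ A with map_star' := fun r => algebraMap_star_comm r }
  obtain ⟨ρ, hρ⟩ := h A (c.comp ε)
  obtain ⟨φ⟩ : Nonempty (State A) := inferInstance
  refine G.deterministic_nonempty_of_isStateOn hε ⟨φ.comp ρ, fun x => ?_⟩
  rw [State.comp_apply, hρ]
  exact φ.map_algebraMap _

/-! ### Extension of *-homomorphisms by continuity -/

/-- A *-homomorphism that is bounded in terms of one with dense range extends along it. -/
theorem exists_starAlgHom_extension {D : Type*} [Ring D] [StarRing D] [Algebra ℂ D]
    {A : Type*} [CStarAlgebra A] {B : Type*} [CStarAlgebra B] (f : D →⋆ₐ[ℂ] A) (g : D →⋆ₐ[ℂ] B)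
    (hf : ∀ (a : A) (r : ℝ), 0 < r → ∃ d, ‖a - f d‖ < r) {C : ℝ} (hC : ∀ d, ‖g d‖ ≤ C * ‖f d‖) :
    ∃ h : A →⋆ₐ[ℂ] B, ∀ d, h (f d) = g d := by
  replace hf : DenseRange f := Metric.denseRange_iff.mpr fun a r hr => by
    simpa only [dist_eq_norm] using hf a r hr
  let F : D →ₗ[ℂ] A := f.toAlgHom.toLinearMap
  let E : D →ₗ[ℂ] B := g.toAlgHom.toLinearMap
  let h := E.extendOfNorm F
  have hh (d : D) : h (f d) = g d := LinearMap.extendOfNorm_eq (f := E) (e := F) hf ⟨C, hC⟩ d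
  have hc : Continuous h := h.continuous
  have hmul (x y : A) : h (x * y) = h x * h y := by
    refine hf.induction_on₂ (p := fun x y => h (x * y) = h x * h y)
      (isClosed_eq (by fun_prop) (by fun_prop)) (fun a b => ?_) x y
    rw [← map_mul, hh, hh, hh, map_mul]
  have hstar (x : A) : h (star x) = star (h x) := by
    refine hf.induction_on (p := fun x => h (star x) = star (h x)) x
      (isClosed_eq (by fun_prop) (by fun_prop)) (fun a => ?_)
    rw [← StarHomClass.map_star, hh, hh, StarHomClass.map_star]
  have hone : h 1 = 1 := by rw [← map_one f, hh, map_one]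
  exact ⟨⟨AlgHom.ofLinearMap h.toLinearMap hone hmul, hstar⟩, hh⟩

/-! ### States on products and vectors in tensor products of GNS spaces -/

section PairRep

variable {A : Type u} [CStarAlgebra A] {B : Type v} [CStarAlgebra B]

theorem State.denseRange_rep_vec (φ : State A) : DenseRange fun a => φ.rep a φ.vec := by
  let := CStarAlgebra.spectralOrder A
  have := CStarAlgebra.spectralOrderedRing A
  have key (a : A) : φ.rep a φ.vec
      = ((φ.toPos.toPreGNS a : φ.toPos.PreGNS) : Completion φ.toPos.PreGNS) := by
    change φ.toPos.gnsNonUnitalStarAlgHom a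
      ((φ.toPos.toPreGNS 1 : φ.toPos.PreGNS) : Completion φ.toPos.PreGNS) = _
    rw [PositiveLinearMap.gnsNonUnitalStarAlgHom_apply_coe]
    simp
  have h : DenseRange ((↑) : φ.toPos.PreGNS → Completion φ.toPos.PreGNS) :=
    Completion.denseRange_coe
  have h2 : Set.range (fun a => φ.rep a φ.vec)
      = Set.range ((↑) : φ.toPos.PreGNS → Completion φ.toPos.PreGNS) := by
    ext x
    constructor
    · rintro ⟨a, rfl⟩
      exact ⟨_, (key a).symm⟩
    · rintro ⟨a, rfl⟩
      exact ⟨φ.toPos.ofPreGNS a, key _⟩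
  have h3 : Dense (Set.range fun a => φ.rep a φ.vec) := by rw [h2]; exact h
  exact h3

theorem pairRep_tmul_pairVec (p : State A × State B) (a : A) (b : B) :
    (show PairH p →L[ℂ] PairH p from pairRep p (a ⊗ₜ b)) (pairVec p)
      = HTensor.incl (p.1.rep a p.1.vec ⊗ₜ[ℂ] p.2.rep b p.2.vec) := by
  change repTensor p.1.rep p.2.rep (a ⊗ₜ b) (pairVec p) = _
  rw [repTensor_tmul, pairVec, opTensor_incl, TensorProduct.mapL_tmul]

/-- The product vector is cyclic because both factors are: approximate the vectors of an elementary
tensor one at a time, then pass to sums and limits. -/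
theorem denseRange_pairRep_pairVec (p : State A × State B) :
    DenseRange fun z : A ⊗[ℂ] B => (show PairH p →L[ℂ] PairH p from pairRep p z) (pairVec p) := by
  let L : A ⊗[ℂ] B →ₗ[ℂ] PairH p :=
    { toFun := fun z => (show PairH p →L[ℂ] PairH p from pairRep p z) (pairVec p)
      map_add' := fun x y => by
        rw [map_add]; rfl
      map_smul' := fun r x => by
        rw [map_smul]; rfl }
  let K := (LinearMap.range L).topologicalClosure
  have hK : IsClosed (K : Set (PairH p)) := Submodule.isClosed_topologicalClosure _
  have h1 (x : p.1.H) (y : p.2.H) : HTensor.incl (x ⊗ₜ[ℂ] y) ∈ K := by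
    have hc (x : p.1.H) : Continuous fun y : p.2.H => HTensor.incl (x ⊗ₜ[ℂ] y) := by
      let T : p.2.H →ₗ[ℂ] PairH p :=
        { toFun := fun y => HTensor.incl (x ⊗ₜ[ℂ] y)
          map_add' := fun a b => by rw [TensorProduct.tmul_add, HTensor.incl_add]
          map_smul' := fun r a => by rw [TensorProduct.tmul_smul, HTensor.incl_smul]; rfl }
      exact (T.mkContinuous ‖x‖ fun y => by
        change ‖HTensor.incl (x ⊗ₜ[ℂ] y)‖ ≤ _
        rw [HTensor.norm_incl, TensorProduct.norm_tmul]).continuous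
    have hc' (y : p.2.H) : Continuous fun x : p.1.H => HTensor.incl (x ⊗ₜ[ℂ] y) := by
      let T : p.1.H →ₗ[ℂ] PairH p :=
        { toFun := fun x => HTensor.incl (x ⊗ₜ[ℂ] y)
          map_add' := fun a b => by rw [TensorProduct.add_tmul, HTensor.incl_add]
          map_smul' := fun r a => by
            rw [← TensorProduct.smul_tmul', HTensor.incl_smul]; rfl }
      exact (T.mkContinuous ‖y‖ fun x => by
        change ‖HTensor.incl (x ⊗ₜ[ℂ] y)‖ ≤ _
        rw [HTensor.norm_incl, TensorProduct.norm_tmul, mul_comm]).continuous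
    refine p.1.denseRange_rep_vec.induction_on (p := fun x => HTensor.incl (x ⊗ₜ[ℂ] y) ∈ K) x
      (hK.preimage (hc' y)) fun a => ?_
    refine p.2.denseRange_rep_vec.induction_on
      (p := fun y => HTensor.incl (p.1.rep a p.1.vec ⊗ₜ[ℂ] y) ∈ K) y
      (hK.preimage (hc _)) fun b => ?_
    exact Submodule.le_topologicalClosure _ ⟨a ⊗ₜ b, pairRep_tmul_pairVec p a b⟩
  have h2 (t : p.1.H ⊗[ℂ] p.2.H) : HTensor.incl t ∈ K := by
    induction t with
    | zero =>
      have := K.zero_mem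
      rwa [show HTensor.incl (0 : p.1.H ⊗[ℂ] p.2.H) = 0 from Completion.coe_zero]
    | add x y hx hy => rw [HTensor.incl_add]; exact K.add_mem hx hy
    | tmul x y => exact h1 x y
  intro v
  exact HTensor.denseRange_incl.induction_on (p := fun v => v ∈ K) v hK h2

/-- The functional `φ ⊗ ψ` on the algebraic tensor product. -/
noncomputable def pairFunctional (p : State A × State B) : A ⊗[ℂ] B →ₗ[ℂ] ℂ :=
  (pairState p).toLinearMap ∘ₗ MinTensor.of.toAlgHom.toLinearMap

theorem pairFunctional_tmul (p : State A × State B) (a : A) (b : B) :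
    pairFunctional p (a ⊗ₜ b) = p.1 a * p.2 b := pairState_tmin p a b

theorem pairFunctional_star_mul_self (p : State A × State B) (z : A ⊗[ℂ] B) :
    pairFunctional p (star z * z)
      = ((‖(show PairH p →L[ℂ] PairH p from pairRep p z) (pairVec p)‖ ^ 2 : ℝ) : ℂ) := by
  change ⟪pairVec p, (show PairH p →L[ℂ] PairH p from pairRep p (star z * z)) (pairVec p)⟫_ℂ = _
  rw [map_mul, StarHomClass.map_star]
  change ⟪pairVec p, (star (show PairH p →L[ℂ] PairH p from pairRep p z) *
    (show PairH p →L[ℂ] PairH p from pairRep p z)) (pairVec p)⟫_ℂ = _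
  rw [mul_apply_eq_comp, ContinuousLinearMap.star_eq_adjoint,
    ContinuousLinearMap.adjoint_inner_right, inner_self_eq_norm_sq_to_K]
  norm_cast

/-- The norm of a minimal tensor product is determined by the functionals `φ ⊗ ψ`. -/
theorem norm_of_le {y : A ⊗[ℂ] B} {C : ℝ} (hC : 0 ≤ C)
    (h : ∀ (p : State A × State B) (z : A ⊗[ℂ] B),
      (pairFunctional p (star (y * z) * (y * z))).re
        ≤ C ^ 2 * (pairFunctional p (star z * z)).re) :
    ‖(MinTensor.of y : MinTensor A B)‖ ≤ C := by
  change ‖(spatialRep A B y : lp (fun p : State A × State B => PairOp p) ∞)‖ ≤ C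
  refine lp.norm_le_of_forall_le hC fun p => ?_
  change ‖(show PairH p →L[ℂ] PairH p from pairRep p y)‖ ≤ C
  refine ContinuousLinearMap.opNorm_le_bound _ hC fun v => ?_
  -- On the cyclic orbit the squared norms are values of the product functional, so the operator
  -- bound is exactly the hypothesis.
  refine (denseRange_pairRep_pairVec p).induction_on
    (p := fun v => ‖(show PairH p →L[ℂ] PairH p from pairRep p y) v‖ ≤ C * ‖v‖) v
    (isClosed_le (by fun_prop) (by fun_prop)) fun z => ?_
  have h1 := h p z
  rw [pairFunctional_star_mul_self, pairFunctional_star_mul_self, Complex.ofReal_re,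
    Complex.ofReal_re, ← mul_pow, map_mul] at h1
  exact le_of_sq_le_sq h1 (by positivity)

end PairRep
end QuantumPerm
-- The minimal tensor square of `A × ℂ`
namespace QuantumPerm

section Mix

variable {A : Type u} [CStarAlgebra A] {B : Type v} [CStarAlgebra B]

/-- A convex combination of two states. -/
noncomputable def State.mix (s : ℝ) (h0 : 0 ≤ s) (h1 : s ≤ 1) (φ ψ : State A) : State A where
  toLinearMap := (s : ℂ) • φ.toLinearMap + ((1 - s : ℝ) : ℂ) • ψ.toLinearMap
  nonneg' a := add_nonneg (mul_nonneg (by exact_mod_cast h0) (φ.nonneg a))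
    (mul_nonneg (by exact_mod_cast sub_nonneg.mpr h1) (ψ.nonneg a))
  map_one' := by
    change (s : ℂ) * φ 1 + ((1 - s : ℝ) : ℂ) * ψ 1 = 1
    rw [φ.map_one, ψ.map_one]
    push_cast
    ring

/-- States of `A × ℂ` are convex combinations of states of `A` and the second projection. -/
theorem State.exists_eq_mix [Nontrivial A] (φ : State (A × ℂ)) :
    ∃ (s : ℝ) (_ : 0 ≤ s) (_ : s ≤ 1) (φ₁ : State A),
      ∀ x, φ x = s * φ₁ x.1 + ((1 - s : ℝ) : ℂ) * x.2 := by
  have he : star ((1, 0) : A × ℂ) * (1, 0) = (1, 0) := by ext <;> simp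
  have he' : star ((0, 1) : A × ℂ) * (0, 1) = (0, 1) := by ext <;> simp
  have h0 := φ.nonneg (1, 0)
  have h0' := φ.nonneg (0, 1)
  rw [he] at h0
  rw [he'] at h0'
  have hsum : φ (1, 0) + φ (0, 1) = 1 := by
    have h1 : ((1, 0) : A × ℂ) + (0, 1) = 1 := by ext <;> simp
    rw [← map_add, h1, φ.map_one]
  obtain ⟨s, hs⟩ : ∃ s : ℝ, φ (1, 0) = s :=
    ⟨(φ (1, 0)).re, Complex.ext rfl (by simpa using (Complex.le_def.mp h0).2.symm)⟩
  have hs' : φ (0, 1) = ((1 - s : ℝ) : ℂ) := by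
    rw [hs] at hsum; push_cast; exact eq_sub_of_add_eq' hsum
  rw [hs] at h0
  rw [hs'] at h0'
  have hs0 : 0 ≤ s := by exact_mod_cast h0
  have hs1 : s ≤ 1 := by
    have : 0 ≤ 1 - s := by exact_mod_cast h0'
    linarith
  have hdec (x : A × ℂ) : φ x = φ (x.1, 0) + ((1 - s : ℝ) : ℂ) * x.2 := by
    have : x = (x.1, 0) + x.2 • ((0, 1) : A × ℂ) := by ext <;> simp
    conv_lhs => rw [this]
    rw [map_add, map_smul, hs', smul_eq_mul, mul_comm x.2]
  rcases hs0.eq_or_lt with h | h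
  -- If the weight `s` of the first summand is zero, then `φ` vanishes there by Cauchy-Schwarz and
  -- any state can serve as `φ₁`. Otherwise the restriction is rescaled by `s⁻¹`.
  · obtain ⟨ψ⟩ : Nonempty (State A) := inferInstance
    refine ⟨s, hs0, hs1, ψ, fun x => ?_⟩
    have h2 : φ (x.1, 0) = 0 := by
      have h3 := φ.norm_sq_apply_le ((x.1, 0) * (1, 0))
      have h4 := h3.trans (φ.re_apply_mul_le (x.1, 0) (1, 0))
      rw [he, hs, ← h] at h4
      have h5 : ((x.1, 0) * (1, 0) : A × ℂ) = (x.1, 0) := by ext <;> simp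
      rw [h5] at h4
      simpa using h4
    rw [hdec, h2, ← h]
    simp
  · have hs2 : (s : ℂ) ≠ 0 := by exact_mod_cast h.ne'
    refine ⟨s, hs0, hs1, ⟨(s : ℂ)⁻¹ • (φ.toLinearMap ∘ₗ LinearMap.inl ℂ A ℂ), fun a => ?_, ?_⟩,
      fun x => ?_⟩
    · change 0 ≤ (s : ℂ)⁻¹ * φ (star a * a, 0)
      have h1 : star ((a, 0) : A × ℂ) * (a, 0) = (star a * a, 0) := by ext <;> simp
      rw [← h1]
      refine mul_nonneg ?_ (φ.nonneg _)
      rw [← Complex.ofReal_inv]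
      exact_mod_cast inv_nonneg.mpr hs0
    · change (s : ℂ)⁻¹ * φ (1, 0) = 1
      rw [hs, inv_mul_cancel₀ hs2]
    · rw [hdec]
      change _ = (s : ℂ) * ((s : ℂ)⁻¹ * φ (x.1, 0)) + _
      rw [← mul_assoc, mul_inv_cancel₀ hs2, one_mul]

theorem MinTensor.denseRange_of : DenseRange (MinTensor.of : A ⊗[ℂ] B → MinTensor A B) := by
  let T := (spatialRep A B).range.topologicalClosure
  let g : A ⊗[ℂ] B → T := fun x =>
    ⟨spatialRep A B x, StarSubalgebra.le_topologicalClosure _ ⟨x, rfl⟩⟩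
  have key : DenseRange g := by
    intro x
    rw [Topology.IsInducing.subtypeVal.closure_eq_preimage_closure_image, Set.mem_preimage,
      ← Set.range_comp]
    exact x.2
  exact key

end Mix

section AddPoint

variable {A : Type u} [CStarAlgebra A] {B : Type v} [CStarAlgebra B]
  (p : B →⋆ₐ[ℂ] A) (q : B →⋆ₐ[ℂ] ℂ)

/-- The minimal tensor square of `A × ℂ`, expanded. -/
abbrev SquareProd (A : Type u) [CStarAlgebra A] : Type u := MinTensor A A × A × A × ℂ

/-- The image in the expanded tensor square of the elementary tensor `b ⊗ 1`. -/
noncomputable def addPointLeft : B →⋆ₐ[ℂ] SquareProd A where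
  toFun b := (tmin (p b) 1, p b, algebraMap ℂ A (q b), q b)
  map_one' := by ext1 <;> simp [tmin_one]
  map_mul' x y := by
    have h : tmin (p x * p y) (1 : A) = tmin (p x) 1 * tmin (p y) 1 := by rw [← tmin_mul, one_mul]
    ext1 <;> simp [h]
  map_zero' := by ext1 <;> simp [tmin_zero_left]
  map_add' x y := by
    ext1 <;> simp [tmin, TensorProduct.add_tmul]
  commutes' r := by
    have h : tmin (algebraMap ℂ A r) (1 : A) = algebraMap ℂ _ r := by
      rw [Algebra.algebraMap_eq_smul_one, tmin_smul_left, tmin_one, ← Algebra.algebraMap_eq_smul_one]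
    have hp : p (algebraMap ℂ B r) = algebraMap ℂ A r := AlgHomClass.commutes p r
    have hq : q (algebraMap ℂ B r) = r := AlgHomClass.commutes q r
    rw [hp, hq, h]
    rfl
  map_star' x := by
    have h : tmin (star (p x)) (1 : A) = star (tmin (p x) 1) := by rw [← tmin_star, star_one]
    have h2 := algebraMap_star_comm (A := A) (q x)
    rw [StarHomClass.map_star, StarHomClass.map_star]
    exact Prod.ext h (Prod.ext rfl (Prod.ext h2 rfl))

/-- The image in the expanded tensor square of the elementary tensor `1 ⊗ b`. -/
noncomputable def addPointRight : B →⋆ₐ[ℂ] SquareProd A where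
  toFun b := (tmin 1 (p b), algebraMap ℂ A (q b), p b, q b)
  map_one' := by ext1 <;> simp [tmin_one]
  map_mul' x y := by
    have h : tmin (1 : A) (p x * p y) = tmin 1 (p x) * tmin 1 (p y) := by rw [← tmin_mul, one_mul]
    ext1 <;> simp [h]
  map_zero' := by ext1 <;> simp [tmin_zero_right]
  map_add' x y := by
    ext1 <;> simp [tmin, TensorProduct.tmul_add]
  commutes' r := by
    have h : tmin (1 : A) (algebraMap ℂ A r) = algebraMap ℂ _ r := by
      rw [Algebra.algebraMap_eq_smul_one, tmin_smul_right, tmin_one,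
        ← Algebra.algebraMap_eq_smul_one]
    have hp : p (algebraMap ℂ B r) = algebraMap ℂ A r := AlgHomClass.commutes p r
    have hq : q (algebraMap ℂ B r) = r := AlgHomClass.commutes q r
    rw [hp, hq, h]
    rfl
  map_star' x := by
    have h : tmin (1 : A) (star (p x)) = star (tmin 1 (p x)) := by rw [← tmin_star, star_one]
    have h2 := algebraMap_star_comm (A := A) (q x)
    rw [StarHomClass.map_star, StarHomClass.map_star]
    exact Prod.ext h (Prod.ext h2 rfl)

theorem addPoint_commute (x y : B) :
    Commute (addPointLeft p q x) (addPointRight p q y) := by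
  refine Prod.ext ?_ (Prod.ext ?_ (Prod.ext ?_ ?_))
  · change tmin (p x) 1 * tmin 1 (p y) = tmin 1 (p y) * tmin (p x) 1
    rw [← tmin_mul, ← tmin_mul]; simp
  · exact (Algebra.commutes _ _).symm
  · exact Algebra.commutes _ _
  · exact mul_comm _ _

/-- The map from the algebraic tensor square to the expanded one. -/
noncomputable def addPointAlgHom : B ⊗[ℂ] B →ₐ[ℂ] SquareProd A :=
  Algebra.TensorProduct.lift (addPointLeft p q).toAlgHom (addPointRight p q).toAlgHom
    (addPoint_commute p q)

theorem addPointAlgHom_tmul (x y : B) : addPointAlgHom p q (x ⊗ₜ y)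
    = (tmin (p x) (p y), q y • p x, q x • p y, q x * q y) := by
  rw [addPointAlgHom, Algebra.TensorProduct.lift_tmul]
  refine Prod.ext ?_ (Prod.ext ?_ (Prod.ext ?_ rfl))
  · change tmin (p x) 1 * tmin 1 (p y) = _
    rw [← tmin_mul, one_mul, mul_one]
  · change p x * algebraMap ℂ A (q y) = _
    rw [Algebra.algebraMap_eq_smul_one, mul_smul_comm, mul_one]
  · change algebraMap ℂ A (q x) * p y = _
    rw [Algebra.algebraMap_eq_smul_one, smul_mul_assoc, one_mul]

/-- The minimal tensor square of `A × ℂ`, expanded, as a C*-algebra. -/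
def SquareAddPoint (A : Type u) [CStarAlgebra A] : Type u := SquareProd A

noncomputable instance : CStarAlgebra (SquareAddPoint A) :=
  inferInstanceAs (CStarAlgebra (MinTensor A A × A × A × ℂ))

/-- The identification of the product with its C*-algebra structure. -/
noncomputable def squareMk (A : Type u) [CStarAlgebra A] :
    SquareProd A →⋆ₐ[ℂ] SquareAddPoint A where
  toFun x := x
  map_one' := rfl
  map_mul' _ _ := rfl
  map_zero' := rfl
  map_add' _ _ := rfl
  commutes' _ := rfl
  map_star' _ := rfl

/-- The inverse of `squareMk`. -/
noncomputable def squareVal (A : Type u) [CStarAlgebra A] :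
    SquareAddPoint A →⋆ₐ[ℂ] SquareProd A where
  toFun x := x
  map_one' := rfl
  map_mul' _ _ := rfl
  map_zero' := rfl
  map_add' _ _ := rfl
  commutes' _ := rfl
  map_star' _ := rfl

theorem norm_squareMk (x : SquareProd A) : ‖squareMk A x‖ = ‖x‖ := rfl

/-- The map from the algebraic tensor square, as a *-homomorphism. -/
noncomputable def addPointHom : B ⊗[ℂ] B →⋆ₐ[ℂ] SquareAddPoint A where
  toAlgHom := (squareMk A).toAlgHom.comp (addPointAlgHom p q)
  map_star' z := by
    change addPointAlgHom p q (star z) = star (addPointAlgHom p q z)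
    induction z with
    | zero => rw [star_zero, map_zero, star_zero]
    | add x y hx hy => rw [star_add, map_add, map_add, hx, hy, star_add]
    | tmul x y =>
      rw [TensorProduct.star_tmul, addPointAlgHom_tmul, addPointAlgHom_tmul,
        StarHomClass.map_star, StarHomClass.map_star, StarHomClass.map_star, StarHomClass.map_star]
      refine Prod.ext ?_ (Prod.ext ?_ (Prod.ext ?_ ?_))
      · exact tmin_star _ _
      · exact (star_smul _ _).symm
      · exact (star_smul _ _).symm
      · change star (q x) * star (q y) = star (q x * q y)
        rw [star_mul, mul_comm]

theorem addPointHom_tmul (x y : B) : addPointHom p q (x ⊗ₜ y)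
    = squareMk A (tmin (p x) (p y), q y • p x, q x • p y, q x * q y) :=
  congrArg (squareMk A) (addPointAlgHom_tmul p q x y)

/-- Only the component in `MinTensor A A` has to be approximated; the other three are attained
exactly. -/
theorem exists_norm_sub_addPointHom_lt (hpq : ∀ a c, ∃ b, p b = a ∧ q b = c)
    (x : SquareAddPoint A) (r : ℝ) (hr : 0 < r) :
    ∃ y, ‖x - addPointHom p q y‖ < r := by
  have h1 (t : A ⊗[ℂ] A) : ∃ y, addPointHom p q y = squareMk A (MinTensor.of t, 0, 0, 0) := by
    induction t with
    | zero => exact ⟨0, by rw [map_zero, map_zero]; rfl⟩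
    | add x y hx hy =>
      obtain ⟨x', hx⟩ := hx
      obtain ⟨y', hy⟩ := hy
      exact ⟨x' + y', by rw [map_add, hx, hy, map_add, ← map_add]; simp⟩
    | tmul a b =>
      obtain ⟨a', ha, ha'⟩ := hpq a 0
      obtain ⟨b', hb, hb'⟩ := hpq b 0
      exact ⟨a' ⊗ₜ b', by rw [addPointHom_tmul, ha, ha', hb, hb']; simp [tmin]⟩
  obtain ⟨x, a, b, c⟩ : SquareProd A := x
  obtain ⟨t, ht⟩ := Metric.denseRange_iff.mp MinTensor.denseRange_of x r hr
  obtain ⟨y, hy⟩ := h1 t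
  obtain ⟨e, he, he'⟩ := hpq 0 1
  obtain ⟨a', ha, ha'⟩ := hpq a 0
  obtain ⟨b', hb, hb'⟩ := hpq b 0
  obtain ⟨c', hc, hc'⟩ := hpq 0 c
  -- As `e` corresponds to `(0, 1)`, the last three tensors contribute only to the second, third and
  -- fourth components, with values `a`, `b` and `c`.
  refine ⟨y + a' ⊗ₜ e + e ⊗ₜ b' + c' ⊗ₜ e, ?_⟩
  have h2 : addPointHom p q (y + a' ⊗ₜ e + e ⊗ₜ b' + c' ⊗ₜ e)
      = squareMk A (MinTensor.of t, a, b, c) := by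
    rw [map_add, map_add, map_add, hy, addPointHom_tmul, addPointHom_tmul, addPointHom_tmul,
      he, he', ha, ha', hb, hb', hc, hc', ← map_add, ← map_add, ← map_add]
    simp [tmin_zero_left, tmin_zero_right]
  change ‖squareMk A (x, a, b, c) - addPointHom p q _‖ < r
  rw [h2, ← map_sub, norm_squareMk]
  have h3 : ((x, a, b, c) - (MinTensor.of t, a, b, c) : SquareProd A)
      = (x - MinTensor.of t, 0, 0, 0) := by simp; rfl
  rw [h3, Prod.norm_def]
  simpa [dist_eq_norm] using ht

/-- States of `B` are mixtures of states of `A` and the point `q`, so every product functional on `B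
⊗ B` factors through `addPointHom` by a state `Ω`. Positivity of `Ω` then yields the estimate
required by `norm_of_le`. -/
theorem norm_of_le_addPointHom (hφ : ∀ φ : State B, ∃ (s : ℝ) (_ : 0 ≤ s) (_ : s ≤ 1)
      (φ₁ : State A), ∀ x, φ x = s * φ₁ (p x) + ((1 - s : ℝ) : ℂ) * q x) (y : B ⊗[ℂ] B) :
    ‖(MinTensor.of y : MinTensor B B)‖ ≤ ‖addPointHom p q y‖ := by
  refine norm_of_le (norm_nonneg _) fun π => ?_
  obtain ⟨s, hs0, hs1, φ, hφ'⟩ := hφ π.1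
  obtain ⟨t, ht0, ht1, ψ, hψ⟩ := hφ π.2
  let p₂ := (StarAlgHom.snd ℂ (MinTensor A A) (A × A × ℂ)).comp (squareVal A)
  let p₃ := (StarAlgHom.snd ℂ A (A × ℂ)).comp p₂
  let Ω : State (SquareAddPoint A) := State.mix s hs0 hs1
    (State.mix t ht0 ht1 ((φ.prod ψ).comp ((StarAlgHom.fst ℂ _ _).comp (squareVal A)))
      (φ.comp ((StarAlgHom.fst ℂ _ _).comp p₂)))
    (State.mix t ht0 ht1 (ψ.comp ((StarAlgHom.fst ℂ _ _).comp p₃))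
      (State.ofStarAlgHom ((StarAlgHom.snd ℂ _ _).comp p₃)))
  let F := addPointHom p q
  have hΩ (z : B ⊗[ℂ] B) : pairFunctional π z = Ω (F z) := by
    induction z with
    | zero => rw [map_zero, map_zero, map_zero]
    | add x y hx hy => rw [map_add, map_add, map_add, hx, hy]
    | tmul x y =>
      rw [pairFunctional_tmul, hφ', hψ]
      change _ = Ω (addPointHom p q (x ⊗ₜ y))
      rw [addPointHom_tmul]
      change _ = (s : ℂ) * ((t : ℂ) * φ.prod ψ (tmin (p x) (p y))
          + ((1 - t : ℝ) : ℂ) * φ (q y • p x))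
        + ((1 - s : ℝ) : ℂ) * ((t : ℂ) * ψ (q x • p y) + ((1 - t : ℝ) : ℂ) * (q x * q y))
      rw [State.prod_tmin, map_smul, map_smul, smul_eq_mul, smul_eq_mul]
      ring
  intro z
  rw [hΩ, hΩ, map_mul F, map_mul F, map_mul F,
    StarHomClass.map_star, StarHomClass.map_star, map_mul F]
  exact Ω.re_apply_mul_le (F y) (F z)

/-- If `(p, q)` identifies `B` with `A × ℂ`, then the expanded tensor square maps to the minimal
tensor square of `B`. -/
theorem exists_hom_squareAddPoint (hpq : ∀ a c, ∃ b, p b = a ∧ q b = c)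
    (hφ : ∀ φ : State B, ∃ (s : ℝ) (_ : 0 ≤ s) (_ : s ≤ 1)
      (φ₁ : State A), ∀ x, φ x = s * φ₁ (p x) + ((1 - s : ℝ) : ℂ) * q x) :
    ∃ h : SquareAddPoint A →⋆ₐ[ℂ] MinTensor B B, ∀ x y,
      h (squareMk A (tmin (p x) (p y), q y • p x, q x • p y, q x * q y)) = tmin x y := by
  obtain ⟨h, hh⟩ := exists_starAlgHom_extension (addPointHom p q) (MinTensor.of (A := B) (B := B))
    (exists_norm_sub_addPointHom_lt p q hpq) (C := 1)
    fun z => (norm_of_le_addPointHom p q hφ z).trans (one_mul _).ge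
  exact ⟨h, fun x y => by rw [← addPointHom_tmul, hh]; rfl⟩

end AddPoint
end QuantumPerm
-- Adjoining the counit to a completion, and coamenability
namespace QuantumPerm

theorem IsMagicUnitary.map {N : ℕ} {A : Type u} [CStarAlgebra A] {B : Type v} [CStarAlgebra B]
    {D : StarSubalgebra ℂ A} {u : Matrix (Fin N) (Fin N) A} (hu : IsMagicUnitary u)
    {w : Matrix (Fin N) (Fin N) D} (hw : ∀ i k, (w i k : A) = u i k) (j : D →⋆ₐ[ℂ] B) :
    IsMagicUnitary (Matrix.of fun i k => j (w i k)) where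
  isStarProjection i k := by
    have h1 : w i k * w i k = w i k := Subtype.ext (by
      rw [MulMemClass.coe_mul, hw, (hu.isStarProjection i k).isIdempotentElem.eq])
    have h2 : star (w i k) = w i k := Subtype.ext (by
      rw [StarMemClass.coe_star, hw, (hu.isStarProjection i k).isSelfAdjoint.star_eq])
    refine ⟨?_, ?_⟩
    · change j (w i k) * j (w i k) = j (w i k)
      rw [← map_mul, h1]
    · change star (j (w i k)) = j (w i k)
      rw [← StarHomClass.map_star, h2]
  row_sum i := by
    have h : ∑ k, w i k = 1 := Subtype.ext (by
      rw [AddSubmonoidClass.coe_finsetSum, OneMemClass.coe_one, ← hu.row_sum i]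
      simp only [hw])
    simp only [Matrix.of_apply]
    rw [← map_sum, h, map_one]
  col_sum k := by
    have h : ∑ i, w i k = 1 := Subtype.ext (by
      rw [AddSubmonoidClass.coe_finsetSum, OneMemClass.coe_one, ← hu.col_sum k]
      simp only [hw])
    simp only [Matrix.of_apply]
    rw [← map_sum, h, map_one]

theorem IsMagicUnitary.conjTranspose {N : ℕ} {A : Type u} [CStarAlgebra A]
    {u : Matrix (Fin N) (Fin N) A} (hu : IsMagicUnitary u) : u.conjTranspose = u.transpose :=
  hu.transpose.map_star

namespace QuantumPermutationGroup

variable {N : ℕ} {A : Type u} [CStarAlgebra A] (G : QuantumPermutationGroup N A)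

/-- If `(p, q)` identifies `B` with `A × ℂ`, and the regular functions have dense image in `B`
under the map with components the inclusion and the counit, then `B` is another completion of the
regular functions. -/
theorem exists_sameRegular {B : Type u} [CStarAlgebra B] [Nontrivial B]
    (p : B →⋆ₐ[ℂ] A) (q : B →⋆ₐ[ℂ] ℂ) (hpq : ∀ a c, ∃ b, p b = a ∧ q b = c)
    (hφ : ∀ φ : State B, ∃ (s : ℝ) (_ : 0 ≤ s) (_ : s ≤ 1)
      (φ₁ : State A), ∀ x, φ x = s * φ₁ (p x) + ((1 - s : ℝ) : ℂ) * q x)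
    (j : G.regular →⋆ₐ[ℂ] B) (hp : ∀ x, p (j x) = x)
    (hq : ∀ i k, q (j (G.gen i k)) = if i = k then 1 else 0) (hj : DenseRange j) :
    ∃ H : QuantumPermutationGroup N B, (∀ i k, H.u i k = j (G.gen i k)) ∧ G.SameRegular H := by
  obtain ⟨h, hh⟩ := exists_hom_squareAddPoint p q hpq hφ
  let v : Matrix (Fin N) (Fin N) B := Matrix.of fun i k => j (G.gen i k)
  have hv : IsMagicUnitary v := G.magic.map (fun _ _ => rfl) j
  have h1 := hv.mul_transpose
  have h2 : v.transpose * v = 1 := by simpa using hv.transpose.mul_transpose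
  -- The comultiplication of `A × ℂ` in expanded form: on `(a, c)` it is `(Δ a, a, a, c)`, since
  -- slicing either leg of `Δ` by the counit gives the identity.
  let D : B →⋆ₐ[ℂ] SquareProd A := (G.comul.comp p).prod (p.prod (p.prod q))
  have hle (x : G.regular) : j x ∈ StarAlgebra.adjoin ℂ (Set.range fun s : Fin N × Fin N =>
      v s.1 s.2) := by
    induction x using G.regular_induction with
    | gen i k => exact StarAlgebra.subset_adjoin ℂ _ ⟨(i, k), rfl⟩
    | algebraMap r => rw [AlgHomClass.commutes]; exact algebraMap_mem _ r
    | add x y hx hy => rw [map_add]; exact add_mem hx hy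
    | mul x y hx hy => rw [map_mul]; exact mul_mem hx hy
  let H : QuantumPermutationGroup N B :=
    { u := v
      unitary := by
        rw [Unitary.mem_iff, Matrix.star_eq_conjTranspose, hv.conjTranspose]
        exact ⟨h2, h1⟩
      isUnit_transpose := ⟨⟨v.transpose, v, h2, h1⟩, rfl⟩
      generates := by
        rw [eq_top_iff]
        intro b _
        rw [← SetLike.mem_coe, StarSubalgebra.topologicalClosure_coe]
        exact closure_mono (by rintro _ ⟨x, rfl⟩; exact hle x) (hj b)
      comul := h.comp ((squareMk A).comp D)
      comul_u := by
        intro i k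
        have hD : D (v i k) = ∑ l, (tmin (p (v i l)) (p (v l k)), q (v l k) • p (v i l),
            q (v i l) • p (v l k), q (v i l) * q (v l k)) := by
          have hpv (i k : Fin N) : p (v i k) = G.u i k := hp _
          have hqv (i k : Fin N) : q (v i k) = if i = k then 1 else 0 := hq i k
          rw [Prod.ext_iff, Prod.ext_iff, Prod.ext_iff]
          simp only [Prod.fst_sum, Prod.snd_sum]
          change G.comul (p (v i k)) = _ ∧ p (v i k) = _ ∧ p (v i k) = _ ∧ q (v i k) = _
          simp only [hpv, hqv, G.comul_u]
          simp
        change h (squareMk A (D (v i k))) = _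
        rw [hD, map_sum, map_sum]
        simp only [hh]
      magic := hv }
  refine ⟨H, fun _ _ => rfl, ?_⟩
  let e := j.codRestrict H.regular hle
  have he : Function.Bijective e := by
    -- Injectivity: `p ∘ j` is the inclusion of the regular functions in `A`.
    refine ⟨(StarAlgHom.injective_codRestrict _ _ _).mpr fun x y hxy => Subtype.ext ?_, fun y => ?_⟩
    · rw [← hp, ← hp, hxy]
    · induction y using H.regular_induction with
      | gen i k => exact ⟨G.gen i k, rfl⟩
      | algebraMap r => exact ⟨algebraMap ℂ _ r, AlgHomClass.commutes e r⟩
      | add x y hx hy =>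
        obtain ⟨a, rfl⟩ := hx
        obtain ⟨b, rfl⟩ := hy
        exact ⟨a + b, map_add e a b⟩
      | mul x y hx hy =>
        obtain ⟨a, rfl⟩ := hx
        obtain ⟨b, rfl⟩ := hy
        exact ⟨a * b, map_mul e a b⟩
  exact ⟨StarAlgEquiv.ofBijective e he, fun _ _ => rfl⟩

theorem dense_regular (a : A) (r : ℝ) (hr : 0 < r) : ∃ x : G.regular, ‖a - x‖ < r := by
  have ha : a ∈ (StarAlgebra.adjoin ℂ (Set.range fun p : Fin N × Fin N =>
    G.u p.1 p.2)).topologicalClosure := by rw [G.generates]; trivial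
  rw [← SetLike.mem_coe, StarSubalgebra.topologicalClosure_coe, Metric.mem_closure_iff] at ha
  obtain ⟨b, hb, h⟩ := ha r hr
  exact ⟨⟨b, hb⟩, by rwa [← dist_eq_norm]⟩

/-- A bounded counit extends to a character. An unbounded one makes `A × ℂ` a completion, and
coamenability carries its second projection back to a character of `A` with the values of the
counit. -/
theorem deterministic_nonempty_of_isCoamenable [Nontrivial A] (h : G.IsCoamenable) :
    G.deterministic.Nonempty := by
  obtain ⟨ε, hε⟩ := G.exists_isCounit
  by_cases hb : ∃ C : ℝ, ∀ x, ‖ε x‖ ≤ C * ‖(x : A)‖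
  · obtain ⟨C, hC⟩ := hb
    obtain ⟨f, hf⟩ := exists_starAlgHom_extension G.regular.subtype ε G.dense_regular hC
    exact G.deterministic_nonempty_of_isStateOn hε ⟨State.ofStarAlgHom f, hf⟩
  · push Not at hb
    let j : G.regular →⋆ₐ[ℂ] A × ℂ := G.regular.subtype.prod ε
    -- Unboundedness yields elements of small norm with counit 1, so `(0, 1)` lies in the closure of
    -- the graph.
    have hj1 (r : ℝ) (hr : 0 < r) : ∃ x : G.regular, ‖(x : A)‖ < r ∧ ε x = 1 := by
      obtain ⟨x, hx⟩ := hb r⁻¹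
      have hx0 : 0 < ‖ε x‖ := lt_of_le_of_lt (by positivity) hx
      refine ⟨(ε x)⁻¹ • x, ?_, ?_⟩
      · change ‖(ε x)⁻¹ • (x : A)‖ < r
        rw [norm_smul, norm_inv, inv_mul_lt_iff₀ hx0]
        rwa [inv_mul_lt_iff₀ hr, mul_comm] at hx
      · rw [map_smul, smul_eq_mul, inv_mul_cancel₀ (norm_pos_iff.mp hx0)]
    have hj : DenseRange j := by
      rw [Metric.denseRange_iff]
      rintro ⟨a, c⟩ r hr
      obtain ⟨x, hx⟩ := G.dense_regular a (r / 2) (half_pos hr)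
      -- Approximate `a` by `x`, then correct the counit by a multiple of `y` of norm below `r / 2`;
      -- the `+ 1` keeps the denominator positive when no correction is needed.
      obtain ⟨y, hy, hy1⟩ := hj1 (r / 2 / (‖c - ε x‖ + 1)) (by positivity)
      refine ⟨x + (c - ε x) • y, ?_⟩
      have h1 : ε (x + (c - ε x) • y) = c := by
        rw [map_add, map_smul, hy1, smul_eq_mul, mul_one, add_sub_cancel]
      change dist (a, c) ((x + (c - ε x) • y : A), ε (x + (c - ε x) • y)) < r
      rw [h1, Prod.dist_eq, dist_self, max_eq_left dist_nonneg, dist_eq_norm, ← sub_sub]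
      refine (norm_sub_le _ _).trans_lt ?_
      rw [← add_halves r]
      refine add_lt_add hx ?_
      rw [lt_div_iff₀ (by positivity)] at hy
      rw [norm_smul]
      nlinarith [norm_nonneg (y : A)]
    obtain ⟨H, hH, hs⟩ := G.exists_sameRegular (B := A × ℂ) (StarAlgHom.fst ℂ A ℂ)
      (StarAlgHom.snd ℂ A ℂ) (fun a c => ⟨(a, c), rfl, rfl⟩) State.exists_eq_mix j (fun _ => rfl)
      hε hj
    obtain ⟨e, he⟩ := h _ H hs
    refine ⟨State.ofStarAlgHom ((StarAlgHom.snd ℂ A ℂ).comp (e : A →⋆ₐ[ℂ] A × ℂ)), 1, ?_⟩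
    ext i k
    have h1 : (e (G.u i k)).2 = if i = k then 1 else 0 := by
      rw [he, hH]
      exact hε i k
    refine h1.trans ?_
    simp [permMatrix, eq_comm]

end QuantumPermutationGroup
end QuantumPerm
namespace QuantumPerm
open Matrix Module

/-! ### Fixed vectors of corepresentations -/

/-- The traces of the powers of a contraction bound the dimension of its space of fixed vectors. -/
theorem finrank_le_of_norm_trace_pow_le {n : Type*} [Fintype n] [DecidableEq n]
    {M : Matrix n n ℂ} (hM : ‖toEuclideanCLM (𝕜 := ℂ) M‖ ≤ 1) {C : ℝ}
    (hC : ∀ m : ℕ, ‖trace (M ^ (m + 1))‖ ≤ C) {F : Submodule ℂ (n → ℂ)}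
    (hF : ∀ ξ ∈ F, M *ᵥ ξ = ξ) : (finrank ℂ F : ℝ) ≤ C := by
  set f := toEuclideanCLM (𝕜 := ℂ) M with hf
  set K : Submodule ℂ (EuclideanSpace ℂ n) :=
    LinearMap.eqLocus (f : EuclideanSpace ℂ n →ₗ[ℂ] EuclideanSpace ℂ n) LinearMap.id with hK
  let b := EuclideanSpace.basisFun n ℂ
  have hFK : finrank ℂ F ≤ finrank ℂ K := by
    let e : F →ₗ[ℂ] EuclideanSpace ℂ n :=
      (WithLp.linearEquiv 2 ℂ (n → ℂ)).symm.toLinearMap ∘ₗ F.subtype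
    have he (x : F) : e x ∈ K := by
      change f (WithLp.toLp 2 x.1) = WithLp.toLp 2 x.1
      rw [hf, toEuclideanCLM_toLp, hF _ x.2]
    refine LinearMap.finrank_le_finrank_of_injective (f := e.codRestrict K he) ?_
    intro x y hxy
    have h1 := congrArg (fun z : K => (z : EuclideanSpace ℂ n)) hxy
    exact Subtype.ext ((WithLp.linearEquiv 2 ℂ (n → ℂ)).symm.injective h1)
  have hpow (m : ℕ) (x : EuclideanSpace ℂ n) : f^[m] x = toEuclideanCLM (𝕜 := ℂ) (M ^ m) x := by
    rw [map_pow, ← hf]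
    induction m with
    | zero => rfl
    | succ m ih => rw [Function.iterate_succ_apply', ih, pow_succ']; rfl
  have htr (m : ℕ) : ∑ i, ⟪b i, f^[m] (b i)⟫_ℂ = trace (M ^ m) := by
    simp only [hpow, trace, diag_apply]
    refine Finset.sum_congr rfl fun i _ => ?_
    simp only [b, EuclideanSpace.basisFun_apply, EuclideanSpace.inner_single_left]
    rw [ofLp_toEuclideanCLM]
    simp
  have htrP : ∑ i, ⟪b i, (K.orthogonalProjectionOnto (b i) : EuclideanSpace ℂ n)⟫_ℂ
      = (finrank ℂ K : ℂ) := by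
    let P : EuclideanSpace ℂ n →ₗ[ℂ] EuclideanSpace ℂ n := K.subtype ∘ₗ
      (K.orthogonalProjectionOnto : EuclideanSpace ℂ n →ₗ[ℂ] K)
    have hP : LinearMap.IsProj K P :=
      ⟨fun x => (K.orthogonalProjectionOnto x).2, fun x hx =>
        congrArg Subtype.val (K.orthogonalProjectionOnto_mem_subspace_eq_self ⟨x, hx⟩)⟩
    rw [← hP.trace, LinearMap.trace_eq_sum_inner P b]
    rfl
  -- Mean ergodic theorem: the averages of the powers of a contraction converge to the orthogonal
  -- projection onto the fixed vectors, whose trace is the dimension.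
  have hlim : Filter.Tendsto (fun N : ℕ => ∑ i, ⟪b i, birkhoffAverage ℂ f id N (b i)⟫_ℂ)
      Filter.atTop (nhds (finrank ℂ K : ℂ)) := by
    rw [← htrP]
    refine tendsto_finsetSum _ fun i _ => Filter.Tendsto.inner tendsto_const_nhds ?_
    exact f.tendsto_birkhoffAverage_orthogonalProjection hM (b i)
  have havg (N : ℕ) : ∑ i, ⟪b i, birkhoffAverage ℂ f id N (b i)⟫_ℂ
      = (N : ℂ)⁻¹ * ∑ m ∈ Finset.range N, trace (M ^ m) := by
    simp only [birkhoffAverage, birkhoffSum, inner_smul_right, inner_sum, id, ← Finset.mul_sum]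
    rw [Finset.sum_comm]
    simp only [htr]
  have hC0 : 0 ≤ C := (norm_nonneg _).trans (hC 0)
  -- The zeroth power is not covered by `hC`; it contributes `card n / N`, which vanishes in the
  -- limit.
  have hle (N : ℕ) (hN : 0 < N) : ‖∑ i, ⟪b i, birkhoffAverage ℂ f id N (b i)⟫_ℂ‖
      ≤ Fintype.card n * (N : ℝ)⁻¹ + C := by
    have hN' : (0 : ℝ) < N := by exact_mod_cast hN
    rw [havg, norm_mul, norm_inv, Complex.norm_natCast]
    obtain ⟨k, rfl⟩ := Nat.exists_eq_succ_of_ne_zero hN.ne'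
    rw [Finset.sum_range_succ', pow_zero, trace_one]
    have h1 : ‖∑ m ∈ Finset.range k, trace (M ^ (m + 1)) + (Fintype.card n : ℂ)‖
        ≤ k.succ * C + Fintype.card n := by
      refine (norm_add_le _ _).trans ?_
      rw [Complex.norm_natCast]
      refine add_le_add (((norm_sum_le _ _).trans (Finset.sum_le_sum fun m _ => hC m)).trans ?_)
        le_rfl
      rw [Finset.sum_const, Finset.card_range, nsmul_eq_mul]
      gcongr
      exact Nat.le_succ k
    calc _ ≤ ((k.succ : ℕ) : ℝ)⁻¹ * (k.succ * C + Fintype.card n) := by gcongr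
      _ = _ := by field_simp; ring
  have h2 : (finrank ℂ K : ℝ) ≤ C := by
    have h3 : Filter.Tendsto (fun N : ℕ => (Fintype.card n : ℝ) * (N : ℝ)⁻¹ + C) Filter.atTop
        (nhds (Fintype.card n * 0 + C)) :=
      (tendsto_inv_atTop_nhds_zero_nat.const_mul _).add_const _
    rw [mul_zero, zero_add] at h3
    have h4 := le_of_tendsto_of_tendsto hlim.norm h3
      (Filter.eventually_atTop.mpr ⟨1, fun N hN => hle N hN⟩)
    rwa [Complex.norm_natCast] at h4
  exact (Nat.cast_le.mpr hFK).trans h2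

namespace IsBiunitaryCorep

variable {A : Type u} [CStarAlgebra A] {Δ : A →⋆ₐ[ℂ] MinTensor A A}
  {n : Type*} [Fintype n] [DecidableEq n] {w : Matrix n n A}

/-- Cauchy-Schwarz for `φ` in each coordinate, followed by `wᴴ * w = 1`. -/
theorem norm_toEuclideanCLM_map_le (hw : IsBiunitaryCorep Δ w) (φ : State A) :
    ‖toEuclideanCLM (𝕜 := ℂ) (w.map φ)‖ ≤ 1 := by
  refine ContinuousLinearMap.opNorm_le_bound _ zero_le_one fun ξ => ?_
  rw [one_mul, ← sq_le_sq₀ (norm_nonneg _) (norm_nonneg _), EuclideanSpace.norm_sq_eq,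
    ofLp_toEuclideanCLM]
  let a (i : n) : A := ∑ j, ξ j • w i j
  have ha (i : n) : (w.map φ *ᵥ ξ) i = φ (a i) := by
    simp only [a, mulVec, dotProduct, map_apply, map_sum, map_smul, smul_eq_mul, mul_comm]
  have h1 (j k : n) : ∑ i, star (w i j) * w i k = if j = k then 1 else 0 := by
    rw [← one_apply, ← hw.conjTranspose_mul]
    simp [mul_apply]
  have h2 : ∑ i, star (a i) * a i = ∑ j, (star (ξ j) * ξ j) • (1 : A) := by
    simp only [a, star_sum, star_smul, Finset.sum_mul_sum, smul_mul_smul_comm]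
    rw [Finset.sum_comm]
    simp only [fun j => Finset.sum_comm (γ := n) (s := Finset.univ) (t := Finset.univ)
      (f := fun i k => (star (ξ j) * ξ k) • (star (w i j) * w i k)), ← Finset.smul_sum, h1]
    simp
  calc ∑ i, ‖(w.map φ *ᵥ ξ) i‖ ^ 2 ≤ ∑ i, (φ (star (a i) * a i)).re :=
        Finset.sum_le_sum fun i _ => by rw [ha]; exact φ.norm_sq_apply_le _
    _ = (φ (∑ i, star (a i) * a i)).re := by rw [map_sum, Complex.re_sum]
    _ = ‖ξ‖ ^ 2 := by
      rw [h2, map_sum, EuclideanSpace.norm_sq_eq, Complex.re_sum]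
      refine Finset.sum_congr rfl fun j _ => ?_
      rw [map_smul, φ.map_one, smul_eq_mul, mul_one]
      have h3 := Complex.normSq_eq_conj_mul_self (z := ξ j)
      rw [← Complex.normSq_eq_norm_sq]
      exact (congrArg Complex.re h3).symm

/-- Convolution powers of `φ`. The zeroth power is excluded: it would require a state with slice 1.
-/
theorem exists_map_eq_pow (hw : IsBiunitaryCorep Δ w) (φ : State A) (m : ℕ) :
    ∃ ψ : State A, w.map ψ = w.map φ ^ (m + 1) := by
  induction m with
  | zero => exact ⟨φ, by rw [zero_add, pow_one]⟩
  | succ m ih =>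
    obtain ⟨ψ, hψ⟩ := ih
    exact ⟨(ψ.prod φ).comp Δ, by rw [hw.map_conv, hψ, ← pow_succ]⟩

/-- The norm of the character of a corepresentation is at least the dimension of the space of its
fixed vectors. -/
theorem finrank_le_norm_trace [Nontrivial A] (hw : IsBiunitaryCorep Δ w)
    {F : Submodule ℂ (n → ℂ)} (hF : ∀ ξ ∈ F, ∀ i, ∑ j, ξ j • w i j = ξ i • 1) :
    (finrank ℂ F : ℝ) ≤ ‖∑ i, w i i‖ := by
  obtain ⟨φ⟩ : Nonempty (State A) := inferInstance
  refine finrank_le_of_norm_trace_pow_le (hw.norm_toEuclideanCLM_map_le φ) (fun m => ?_)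
    fun ξ hξ => ?_
  · obtain ⟨ψ, hψ⟩ := hw.exists_map_eq_pow φ m
    rw [← hψ]
    have h1 : trace (w.map ψ) = ψ (∑ i, w i i) := by
      rw [map_sum]
      rfl
    rw [h1]
    exact ψ.norm_apply_le _
  · ext i
    have h1 := congrArg φ (hF ξ hξ i)
    simpa [mulVec, dotProduct, mul_comm, φ.map_one] using h1

/-- The commutant of the slices of a corepresentation. -/
def _root_.QuantumPerm.commutant (V : Submodule ℂ (Matrix n n ℂ)) : Submodule ℂ (Matrix n n ℂ) where
  carrier := {Z | ∀ X ∈ V, X * Z = Z * X}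
  zero_mem' X _ := by simp
  add_mem' hY hZ X hX := by rw [mul_add, add_mul, hY X hX, hZ X hX]
  smul_mem' r Z hZ X hX := by rw [Matrix.mul_smul, Matrix.smul_mul, hZ X hX]

/-- `Z` commutes with the slices iff `w Z = Z w`, and then `w Z wᴴ = Z` makes `Z` a fixed vector of
`w ⊗ w̄`. The character of that corepresentation is `χ χ*`, of norm `‖χ‖²`. -/
theorem finrank_commutant_le [Nontrivial A] (hw : IsBiunitaryCorep Δ w) :
    (finrank ℂ (commutant (sliceSpan w)) : ℝ) ≤ ‖∑ i, w i i‖ ^ 2 := by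
  let e : Matrix n n ℂ ≃ₗ[ℂ] (n × n → ℂ) := (LinearEquiv.curry ℂ ℂ n n).symm
  have h1 := (hw.tensor hw.conj).finrank_le_norm_trace
    (F := (commutant (sliceSpan w)).map (e : Matrix n n ℂ →ₗ[ℂ] (n × n → ℂ))) ?_
  · rw [LinearEquiv.finrank_map_eq] at h1
    refine h1.trans_eq ?_
    rw [Fintype.sum_prod_type, sq, ← CStarRing.norm_self_mul_star (x := ∑ i, w i i), star_sum,
      Finset.sum_mul_sum]
    rfl
  · rintro _ ⟨Z, hZ, rfl⟩ ⟨i, j⟩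
    -- States separate points, so commuting with every slice lifts to an identity over `A`.
    have h2 (l : n) : ∑ k, Z k l • w i k = ∑ k, Z i k • w k l := by
      refine State.eq_of_forall fun φ => ?_
      have h3 := congrFun (congrFun (hZ _ (map_mem_sliceSpan w φ)) i) l
      simpa [mul_apply, mul_comm] using h3
    have h4 (k : n) : ∑ l, w k l * star (w j l) = if k = j then 1 else 0 := by
      rw [← one_apply, ← hw.mul_conjTranspose]
      simp [mul_apply]
    rw [Fintype.sum_prod_type]
    change ∑ k, ∑ l, Z k l • (w i k * star (w j l)) = Z i j • 1
    rw [Finset.sum_comm]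
    simp only [← smul_mul_assoc, ← Finset.sum_mul, h2]
    simp only [Finset.sum_mul, smul_mul_assoc]
    rw [Finset.sum_comm]
    simp only [← Finset.smul_sum, h4]
    simp

end IsBiunitaryCorep
end QuantumPerm
namespace QuantumPerm
open Matrix Module

/-! ### The dimension of a commutant -/

section

variable {n : Type*} [Fintype n] [DecidableEq n]

theorem trace_mulLeft_comp_mulRight (P Q : Matrix n n ℂ) :
    LinearMap.trace ℂ _ (LinearMap.mulLeft ℂ P ∘ₗ LinearMap.mulRight ℂ Q)
      = trace P * trace Q := by
  rw [LinearMap.trace_eq_matrix_trace ℂ (Matrix.stdBasis ℂ n n), trace, Fintype.sum_prod_type,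
    trace, trace, Finset.sum_mul_sum]
  refine Finset.sum_congr rfl fun i _ => Finset.sum_congr rfl fun j _ => ?_
  rw [diag_apply, LinearMap.toMatrix_apply, Matrix.stdBasis_eq_single]
  change (P * (single i j (1 : ℂ) * Q) : Matrix n n ℂ) i j = P i i * Q j j
  rw [mul_apply, Finset.sum_eq_single i (fun k _ hk => by simp [mul_apply, hk.symm])
    (by simp)]
  simp

/-- With `z = ∑ b i * (b i)ᴴ` for an orthonormal basis of `V`, the trace of `z` is `dim V` and that
of `z⁻¹` is the dimension of the commutant. Cauchy-Schwarz for `1 = z^(1/2) z^(-1/2)` gives the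
bound. -/
theorem card_sq_le_finrank_mul_finrank_commutant (V : Submodule ℂ (Matrix n n ℂ))
    (hmul : ∀ X ∈ V, ∀ Y ∈ V, X * Y ∈ V) (hstar : ∀ X ∈ V, Xᴴ ∈ V) (hone : 1 ∈ V) :
    Fintype.card n ^ 2 ≤ finrank ℂ V * finrank ℂ (commutant V) := by
  obtain ⟨b, hbV, hb, hexp⟩ := exists_hilbertSchmidt_basis V
  have htrace (X Y : Matrix n n ℂ) : ∑ k, ∑ m, star (X k m) * Y k m = trace (Xᴴ * Y) := by
    simp only [trace, diag_apply, mul_apply, conjTranspose_apply]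
    exact Finset.sum_comm
  simp only [htrace] at hb hexp
  -- Expanding `X * b i` and `(b j)ᴴ * X` in the basis and its adjoints produces the same
  -- coefficients `trace ((b j)ᴴ * (X * b i))`.
  have hcomm (Y X : Matrix n n ℂ) (hX : X ∈ V) :
      X * ∑ i, b i * Y * (b i)ᴴ = (∑ i, b i * Y * (b i)ᴴ) * X := by
    have h1 (i) : X * b i = ∑ j, trace ((b j)ᴴ * (X * b i)) • b j := hexp _ (hmul _ hX _ (hbV i))
    have h2 (j) : (b j)ᴴ * X = ∑ i, trace ((b j)ᴴ * (X * b i)) • (b i)ᴴ := by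
      have h3 := congrArg conjTranspose (hexp _ (hmul _ (hstar X hX) _ (hbV j)))
      rw [conjTranspose_mul, conjTranspose_conjTranspose, conjTranspose_sum] at h3
      rw [h3]
      refine Finset.sum_congr rfl fun i _ => ?_
      rw [conjTranspose_smul, ← trace_conjTranspose, conjTranspose_mul, conjTranspose_mul,
        conjTranspose_conjTranspose, conjTranspose_conjTranspose, Matrix.mul_assoc]
    have h4 (i) : X * (b i * Y * (b i)ᴴ)
        = ∑ j, trace ((b j)ᴴ * (X * b i)) • (b j * Y * (b i)ᴴ) := by
      rw [← Matrix.mul_assoc, ← Matrix.mul_assoc]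
      conv_lhs => rw [h1]
      simp only [Finset.sum_mul, Matrix.smul_mul]
    have h5 (j) : b j * Y * (b j)ᴴ * X
        = ∑ i, trace ((b j)ᴴ * (X * b i)) • (b j * Y * (b i)ᴴ) := by
      rw [Matrix.mul_assoc]
      conv_lhs => rw [h2]
      simp only [Finset.mul_sum, Matrix.mul_smul]
    rw [Finset.mul_sum, Finset.sum_mul]
    simp only [h4, h5]
    exact Finset.sum_comm
  set z : Matrix n n ℂ := ∑ i, b i * (b i)ᴴ with hz
  have hzcomm (X : Matrix n n ℂ) (hX : X ∈ V) : X * z = z * X := by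
    simpa using hcomm 1 X hX
  have h1exp : (1 : Matrix n n ℂ) = ∑ i, trace (b i)ᴴ • b i := by
    simpa using hexp 1 hone
  have hzH : zᴴ = z := by simp [hz, conjTranspose_sum]
  -- A kernel vector of `z` is killed by every `(b i)ᴴ`, hence by 1, which lies in their span.
  have hunit : IsUnit z.det := by
    rw [isUnit_iff_ne_zero]
    intro hdet
    obtain ⟨ξ, hξ0, hξ⟩ := exists_mulVec_eq_zero_iff.mpr hdet
    have h3 : ∑ i, star ((b i)ᴴ *ᵥ ξ) ⬝ᵥ ((b i)ᴴ *ᵥ ξ) = 0 := by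
      have h4 := congrArg (star ξ ⬝ᵥ ·) hξ
      simp only [dotProduct_zero, hz, sum_mulVec, dotProduct_sum] at h4
      rw [← h4]
      refine Finset.sum_congr rfl fun i _ => ?_
      rw [star_mulVec, conjTranspose_conjTranspose, ← dotProduct_mulVec, mulVec_mulVec]
    rw [Finset.sum_eq_zero_iff_of_nonneg fun i _ => dotProduct_star_self_nonneg _] at h3
    have h5 (i) : (b i)ᴴ *ᵥ ξ = 0 := dotProduct_star_self_eq_zero.mp (h3 i (Finset.mem_univ i))
    apply hξ0
    have h6 := congrArg (fun M : Matrix n n ℂ => Mᴴ *ᵥ ξ) h1exp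
    simpa [conjTranspose_sum, sum_mulVec, smul_mulVec, h5] using h6
  have hzi : z⁻¹ * z = 1 := nonsing_inv_mul z hunit
  have hiz : z * z⁻¹ = 1 := mul_nonsing_inv z hunit
  have hizcomm (X : Matrix n n ℂ) (hX : X ∈ V) : X * z⁻¹ = z⁻¹ * X := by
    calc X * z⁻¹ = z⁻¹ * z * X * z⁻¹ := by rw [hzi, Matrix.one_mul]
      _ = z⁻¹ * (X * z) * z⁻¹ := by rw [hzcomm X hX, Matrix.mul_assoc z⁻¹ z X]
      _ = z⁻¹ * X := by rw [Matrix.mul_assoc, Matrix.mul_assoc, hiz, Matrix.mul_one]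
  -- Averaging over the basis, normalized by `z⁻¹`, is a projection onto the commutant, so its trace
  -- counts the dimension.
  let E : Matrix n n ℂ →ₗ[ℂ] Matrix n n ℂ :=
    ∑ i, LinearMap.mulLeft ℂ (b i * z⁻¹) ∘ₗ LinearMap.mulRight ℂ (b i)ᴴ
  have hE (Y : Matrix n n ℂ) : E Y = ∑ i, b i * (z⁻¹ * Y) * (b i)ᴴ := by
    simp [E, LinearMap.sum_apply, Matrix.mul_assoc]
  have hproj : LinearMap.IsProj (commutant V) E := by
    refine ⟨fun Y X hX => ?_, fun Y hY => ?_⟩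
    · rw [hE]
      exact hcomm _ X hX
    · have h1 (i) : b i * (z⁻¹ * Y) * (b i)ᴴ = z⁻¹ * (b i * (b i)ᴴ) * Y := by
        rw [← Matrix.mul_assoc, hizcomm _ (hbV i), Matrix.mul_assoc,
          ← hY _ (hstar _ (hbV i))]
        simp only [Matrix.mul_assoc]
      rw [hE]
      simp only [h1]
      rw [← Finset.sum_mul, ← Finset.mul_sum, ← hz, hzi, Matrix.one_mul]
  have htrE : trace z⁻¹ = (finrank ℂ (commutant V) : ℂ) := by
    rw [← hproj.trace, map_sum]
    simp only [trace_mulLeft_comp_mulRight]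
    conv_lhs => rw [← Matrix.one_mul z⁻¹, h1exp]
    simp only [Finset.sum_mul, Matrix.smul_mul, trace_sum, trace_smul, smul_eq_mul, mul_comm]
  have htrz : trace z = (finrank ℂ V : ℂ) := by
    rw [hz, trace_sum]
    simp only [trace_mul_comm (b _), hb]
    simp
  -- The quadratic in `t` is the trace of `Y z Y` for `Y = 1 - t z⁻¹`; its discriminant is the
  -- Cauchy-Schwarz inequality.
  have hpos (t : ℝ) : 0 ≤ (finrank ℂ (commutant V) : ℝ) * (t * t)
      + (-2 * Fintype.card n) * t + finrank ℂ V := by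
    set Y : Matrix n n ℂ := 1 - (t : ℂ) • z⁻¹ with hY
    have hYH : Yᴴ = Y := by
      rw [hY, conjTranspose_sub, conjTranspose_one, conjTranspose_smul,
        conjTranspose_nonsing_inv, hzH]
      simp
    have h1 : trace (Yᴴ * z * Y) = ∑ i, trace (((b i)ᴴ * Y)ᴴ * ((b i)ᴴ * Y)) := by
      rw [hz, Finset.mul_sum, Finset.sum_mul, trace_sum]
      refine Finset.sum_congr rfl fun i _ => ?_
      rw [conjTranspose_mul, conjTranspose_conjTranspose]
      simp only [Matrix.mul_assoc]
    have h2 : 0 ≤ trace (Yᴴ * z * Y) := by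
      rw [h1]
      exact Finset.sum_nonneg fun i _ => (posSemidef_conjTranspose_mul_self _).trace_nonneg
    have h3 : trace (Yᴴ * z * Y) = ((finrank ℂ (commutant V) : ℝ) * (t * t)
      + (-2 * Fintype.card n) * t + finrank ℂ V : ℝ) := by
      have h4 : Y * z * Y = z - (2 * t : ℂ) • 1 + (t * t : ℂ) • z⁻¹ := by
        have h5 : Y * z = z - (t : ℂ) • 1 := by
          rw [hY, sub_mul, Matrix.one_mul, Matrix.smul_mul, hzi]
        rw [h5, hY, mul_sub, sub_mul, Matrix.mul_one, Matrix.mul_one, Matrix.mul_smul, sub_mul, hiz,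
          Matrix.smul_mul, Matrix.one_mul, smul_sub, smul_smul, two_mul, add_smul]
        abel
      rw [hYH, h4, trace_add, trace_sub, trace_smul, trace_smul, trace_one, htrE, htrz]
      push_cast
      simp only [smul_eq_mul]
      ring
    rw [h3] at h2
    exact_mod_cast h2
  have h := discrim_le_zero hpos
  rw [discrim] at h
  have h' : (Fintype.card n : ℝ) ^ 2 ≤ finrank ℂ V * finrank ℂ (commutant V) := by nlinarith
  exact_mod_cast h'

end

namespace IsBiunitaryCorep

variable {A : Type u} [CStarAlgebra A] {Δ : A →⋆ₐ[ℂ] MinTensor A A}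
  {n : Type*} [Fintype n] [DecidableEq n] {w : Matrix n n A}

/-- The norm of the character of a corepresentation, in terms of the number of its linearly
independent coefficients. -/
theorem card_sq_le [Nontrivial A] (hw : IsBiunitaryCorep Δ w) :
    (Fintype.card n : ℝ) ^ 2 ≤ finrank ℂ (sliceSpan w) * ‖∑ i, w i i‖ ^ 2 := by
  have h := card_sq_le_finrank_mul_finrank_commutant (sliceSpan w)
    (fun _ hX _ hY => hw.mul_mem_sliceSpan hX hY) (fun _ hX => hw.conjTranspose_mem_sliceSpan hX)
    hw.one_mem_sliceSpan
  have h' : (Fintype.card n : ℝ) ^ 2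
      ≤ finrank ℂ (sliceSpan w) * finrank ℂ (commutant (sliceSpan w)) := by exact_mod_cast h
  exact h'.trans (mul_le_mul_of_nonneg_left hw.finrank_commutant_le (Nat.cast_nonneg _))

end IsBiunitaryCorep
end QuantumPerm
namespace QuantumPerm
open Matrix Module

/-! ### Corepresentations with coefficients that commute up to sign -/

theorem exists_prod_eq_smul_of_perm {A : Type*} [Ring A] [Algebra ℂ A] {σ : Type*} (f : σ → A)
    (hf : ∀ p q, f p * f q = f q * f p ∨ f p * f q = -(f q * f p)) {l l' : List σ}
    (h : l.Perm l') : ∃ s : ℂ, (l.map f).prod = s • (l'.map f).prod := by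
  induction h with
  | nil => exact ⟨1, by simp⟩
  | cons x _ ih =>
    obtain ⟨s, hs⟩ := ih
    exact ⟨s, by simp [hs]⟩
  | swap x y l =>
    rcases hf x y with h | h
    · exact ⟨1, by simp [← mul_assoc, h]⟩
    · exact ⟨-1, by simp [← mul_assoc, h]⟩
  | trans _ _ ih ih' =>
    obtain ⟨s, hs⟩ := ih
    obtain ⟨t, ht⟩ := ih'
    exact ⟨s * t, by rw [hs, ht, smul_smul]⟩

/-- The number of linearly independent products of `k` letters that commute up to sign grows
polynomially. -/
theorem finrank_sliceSpan_le {A : Type u} [CStarAlgebra A] {σ : Type*} [Fintype σ] [DecidableEq σ]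
    (f : σ → A) (hf : ∀ p q, f p * f q = f q * f p ∨ f p * f q = -(f q * f p))
    {n : Type*} [Fintype n] [DecidableEq n] {w : Matrix n n A} {k : ℕ}
    (hw : ∀ i j, ∃ l : List σ, l.length = k ∧ w i j = (l.map f).prod) :
    finrank ℂ (sliceSpan w) ≤ (k + 1) ^ Fintype.card σ := by
  choose l hl hwl using hw
  -- Up to a scalar a product depends only on how often each letter occurs, and each count lies
  -- between 0 and `k`.
  let c (i j : n) : σ → Fin (k + 1) := fun p =>
    ⟨(l i j).count p, Nat.lt_succ_of_le (List.count_le_length.trans_eq (hl i j))⟩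
  have hX (d : σ → Fin (k + 1)) : ∃ x : A, ∀ i j, c i j = d → ∃ s : ℂ, w i j = s • x := by
    by_cases h : ∃ i j, c i j = d
    · obtain ⟨i, j, rfl⟩ := h
      refine ⟨w i j, fun i' j' h => ?_⟩
      rw [hwl, hwl]
      refine exists_prod_eq_smul_of_perm f hf (List.perm_iff_count.mpr fun p => ?_)
      exact congrArg Fin.val (congrFun h p)
    · exact ⟨0, fun i j hij => absurd ⟨i, j, hij⟩ h⟩
  choose x hx using hX
  choose s hs using fun i j => hx (c i j) i j rfl
  let M (d : σ → Fin (k + 1)) : Matrix n n ℂ := Matrix.of fun i j => if c i j = d then s i j else 0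
  have hle : sliceSpan w ≤ Submodule.span ℂ (Set.range M) := by
    refine Submodule.span_le.mpr ?_
    rintro _ ⟨φ, rfl⟩
    have : w.map φ = ∑ d, φ (x d) • M d := by
      ext i j
      rw [map_apply, hs, map_smul, Matrix.sum_apply, smul_eq_mul, mul_comm]
      simp [M]
    change w.map φ ∈ _
    rw [this]
    exact Submodule.sum_mem _ fun d _ => Submodule.smul_mem _ _ (Submodule.subset_span ⟨d, rfl⟩)
  refine (Submodule.finrank_mono hle).trans ((finrank_range_le_card M).trans_eq ?_)
  simp

namespace IsBiunitaryCorep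

variable {A : Type u} [CStarAlgebra A] {Δ : A →⋆ₐ[ℂ] MinTensor A A}
  {m : Type} [Fintype m] [DecidableEq m] {v : Matrix m m A}

theorem exists_tensorPower (hv : IsBiunitaryCorep Δ v) (k : ℕ) :
    ∃ (n : Type) (_ : Fintype n) (_ : DecidableEq n) (w : Matrix n n A), IsBiunitaryCorep Δ w ∧
      Fintype.card n = Fintype.card m ^ k ∧ ∑ i, w i i = (∑ i, v i i) ^ k ∧
      ∀ i j, ∃ l : List (m × m), l.length = k ∧ w i j = (l.map fun p => v p.1 p.2).prod := by
  induction k with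
  | zero => exact ⟨Unit, _, _, 1, one, by simp, by simp, fun i j => ⟨[], rfl, by simp⟩⟩
  | succ k ih =>
    obtain ⟨n, _, _, w, hw, hcard, htr, hl⟩ := ih
    refine ⟨m × n, _, _, tensorMatrix v w, hv.tensor hw, ?_, ?_, fun i j => ?_⟩
    · rw [Fintype.card_prod, hcard, pow_succ']
    · rw [pow_succ', ← htr, Finset.sum_mul_sum, Fintype.sum_prod_type]
      rfl
    · obtain ⟨l, hlk, h⟩ := hl i.2 j.2
      refine ⟨(i.1, j.1) :: l, by simp [hlk], ?_⟩
      rw [List.map_cons, List.prod_cons, ← h]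
      rfl

/-- A corepresentation with coefficients that commute up to sign has a character of maximal
norm. -/
theorem card_le_norm_trace [Nontrivial A] (hv : IsBiunitaryCorep Δ v)
    (hcomm : ∀ p q : m × m, v p.1 p.2 * v q.1 q.2 = v q.1 q.2 * v p.1 p.2 ∨
      v p.1 p.2 * v q.1 q.2 = -(v q.1 q.2 * v p.1 p.2)) :
    (Fintype.card m : ℝ) ≤ ‖∑ i, v i i‖ := by
  obtain ⟨d, hd⟩ : ∃ d : ℝ, d = Fintype.card m := ⟨_, rfl⟩
  rw [← hd]
  set x := ‖∑ i, v i i‖ with hx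
  set N := Fintype.card (m × m) with hN
  -- `card_sq_le` for the `k`-th tensor power, whose slice algebra has dimension at most `(k + 1) ^
  -- N`.
  have key (k : ℕ) : (d ^ 2) ^ k ≤ ((k + 1 : ℕ) : ℝ) ^ N * (x ^ 2) ^ k := by
    obtain ⟨n, _, _, w, hw, hcard, htr, hl⟩ := hv.exists_tensorPower k
    have h1 := hw.card_sq_le
    have h2 := finrank_sliceSpan_le _ hcomm hl
    rw [hcard, htr, Nat.cast_pow, pow_right_comm, ← hd] at h1
    refine h1.trans (mul_le_mul (by exact_mod_cast h2) ?_ (by positivity) (by positivity))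
    rw [← pow_mul, mul_comm 2, pow_mul]
    exact pow_le_pow_left₀ (norm_nonneg _) (norm_pow_le _ _) 2
  by_contra! hlt
  have hx0 : 0 ≤ x := norm_nonneg _
  have hd0 : 0 < d := hx0.trans_lt hlt
  set r := x ^ 2 / d ^ 2 with hr
  have hr1 : r < 1 := by
    rw [hr, div_lt_one (by positivity)]
    exact pow_lt_pow_left₀ hlt hx0 two_ne_zero
  have hr0 : 0 ≤ r := by positivity
  -- The extra factor `r` matches the exponent to the base `k + 1`, so the right side has the form
  -- `n ^ N * r ^ n` and tends to 0.
  have h3 (k : ℕ) : r ≤ ((k + 1 : ℕ) : ℝ) ^ N * r ^ (k + 1) := by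
    have h4 := key k
    have h5 : 1 ≤ ((k + 1 : ℕ) : ℝ) ^ N * r ^ k := by
      rw [hr, div_pow, ← mul_div_assoc, le_div_iff₀ (by positivity), one_mul]
      exact h4
    calc r = 1 * r := (one_mul r).symm
      _ ≤ ((k + 1 : ℕ) : ℝ) ^ N * r ^ k * r := by gcongr
      _ = _ := by rw [mul_assoc, pow_succ]
  have h4 := (tendsto_pow_const_mul_const_pow_of_abs_lt_one N
    (by rwa [abs_of_nonneg hr0] : |r| < 1)).comp (Filter.tendsto_add_atTop_nat 1)
  have h5 : r ≤ 0 := ge_of_tendsto' h4 h3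
  have h6 : x = 0 := by
    have : r = 0 := le_antisymm h5 hr0
    rw [hr, div_eq_zero_iff] at this
    rcases this with h | h
    · exact pow_eq_zero_iff two_ne_zero |>.mp h
    · exact absurd h (by positivity)
  -- For `x = 0` the first power already gives `d² ≤ 0`.
  have h7 := key 1
  rw [h6] at h7
  have : 0 < d ^ 2 := by positivity
  simp at h7
  linarith

end IsBiunitaryCorep
end QuantumPerm
namespace QuantumPerm
open Matrix Module

/-! ### Four points -/

/-- The character table of the Klein four-group, on `Fin 4` with bitwise addition. -/
def kleinSign : Fin 4 → Fin 4 → ℤ :=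
  ![![1, 1, 1, 1], ![1, -1, 1, -1], ![1, 1, -1, -1], ![1, -1, -1, 1]]

theorem zero_xor_fin (a : Fin 4) : 0 ^^^ a = a := by revert a; decide

theorem xor_fin_eq_zero {b d : Fin 4} : b ^^^ d = 0 ↔ b = d := by revert b d; decide

theorem kleinSign_zero_left (i : Fin 4) : kleinSign 0 i = 1 := by revert i; decide

theorem kleinSign_mul (a b i : Fin 4) : kleinSign a i * kleinSign b i = kleinSign (a ^^^ b) i := by
  revert a b i; decide

theorem sum_kleinSign_mul (e l m : Fin 4) :
    ∑ p, kleinSign p l * kleinSign (e ^^^ p) m = if l = m then 4 * kleinSign e l else 0 := by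
  revert e l m; decide

theorem sum_kleinSign (b : Fin 4) : ∑ j, kleinSign b j = if b = 0 then 4 else 0 := by
  revert b; decide

/-- The convolution theorem for the Klein four-group. It is applied to the multiplication of `A` and
to the elementary tensors in `MinTensor A A`. -/
theorem sum_bilin_kleinSign {X Y Z : Type*} [AddCommGroup X] [Module ℂ X] [AddCommGroup Y]
    [Module ℂ Y] [AddCommGroup Z] [Module ℂ Z] (β : X →ₗ[ℂ] Y →ₗ[ℂ] Z) (x : Fin 4 → X)
    (y : Fin 4 → Y) (e : Fin 4) :
    ∑ p, β (∑ l, (kleinSign p l : ℂ) • x l) (∑ m, (kleinSign (e ^^^ p) m : ℂ) • y m)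
      = (4 : ℂ) • ∑ l, (kleinSign e l : ℂ) • β (x l) (y l) := by
  have h (l m : Fin 4) : ∑ p, (kleinSign p l : ℂ) * kleinSign (e ^^^ p) m
      = if l = m then 4 * (kleinSign e l : ℂ) else 0 := by
    have := congrArg (Int.cast : ℤ → ℂ) (sum_kleinSign_mul e l m)
    push_cast at this
    exact this
  calc _ = ∑ p, ∑ l, ∑ m, ((kleinSign p l : ℂ) * kleinSign (e ^^^ p) m) • β (x l) (y m) := by
        simp only [map_sum, LinearMap.sum_apply, map_smul, LinearMap.smul_apply, Finset.smul_sum,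
          smul_smul]
        refine Finset.sum_congr rfl fun p _ => ?_
        rw [Finset.sum_comm]
        simp only [mul_comm]
    _ = ∑ l, ∑ m, (∑ p, (kleinSign p l : ℂ) * kleinSign (e ^^^ p) m) • β (x l) (y m) := by
        rw [Finset.sum_comm]
        refine Finset.sum_congr rfl fun l _ => ?_
        rw [Finset.sum_comm]
        simp only [Finset.sum_smul]
    _ = _ := by
        simp only [h, ite_smul, zero_smul, Finset.sum_ite_eq, Finset.mem_univ, if_true,
          Finset.smul_sum, smul_smul]

section

variable {A : Type u} [CStarAlgebra A]

/-- The transform of the rows of a matrix. -/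
noncomputable def kleinRow (u : Matrix (Fin 4) (Fin 4) A) (i b : Fin 4) : A :=
  ∑ j, (kleinSign b j : ℂ) • u i j

/-- A matrix in the basis of the characters of the Klein four-group. -/
noncomputable def kleinMatrix (u : Matrix (Fin 4) (Fin 4) A) : Matrix (Fin 4) (Fin 4) A :=
  Matrix.of fun a b => ∑ i, (kleinSign a i : ℂ) • (4⁻¹ : ℂ) • kleinRow u i b

theorem kleinMatrix_transpose (u : Matrix (Fin 4) (Fin 4) A) :
    kleinMatrix uᵀ = (kleinMatrix u)ᵀ := by
  ext a b
  simp only [kleinMatrix, kleinRow, of_apply, transpose_apply, Finset.smul_sum]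
  rw [Finset.sum_comm]
  refine Finset.sum_congr rfl fun i _ => Finset.sum_congr rfl fun j _ => ?_
  simp only [smul_smul]
  congr 1
  ring

end

variable {A : Type u} [CStarAlgebra A] {u : Matrix (Fin 4) (Fin 4) A}

theorem kleinRow_mul [Nontrivial A] (hu : IsMagicUnitary u) (i b d : Fin 4) :
    kleinRow u i b * kleinRow u i d = kleinRow u i (b ^^^ d) := by
  simp only [kleinRow, Finset.sum_mul_sum, smul_mul_smul_comm]
  refine Finset.sum_congr rfl fun j _ => ?_
  rw [Finset.sum_eq_single j (fun k _ hk => by rw [hu.mul_eq_zero_of_ne i hk.symm, smul_zero])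
    (by simp), (hu.isStarProjection i j).isIdempotentElem.eq, ← kleinSign_mul, Int.cast_mul]

/-- The multiplication rule for the columns of the transformed matrix. -/
theorem sum_kleinMatrix_mul [Nontrivial A] (hu : IsMagicUnitary u) (e b d : Fin 4) :
    ∑ a, kleinMatrix u a b * kleinMatrix u (e ^^^ a) d = kleinMatrix u e (b ^^^ d) := by
  have h := sum_bilin_kleinSign (LinearMap.mul ℂ A) (fun i => (4⁻¹ : ℂ) • kleinRow u i b)
    (fun i => (4⁻¹ : ℂ) • kleinRow u i d) e
  refine h.trans ?_
  change _ = ∑ i, (kleinSign e i : ℂ) • (4⁻¹ : ℂ) • kleinRow u i (b ^^^ d)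
  rw [Finset.smul_sum]
  refine Finset.sum_congr rfl fun i _ => ?_
  rw [LinearMap.mul_apply', smul_mul_smul_comm, kleinRow_mul hu, smul_smul, smul_smul, smul_smul]
  congr 1
  ring

theorem kleinMatrix_zero_left (hu : IsMagicUnitary u) (b : Fin 4) :
    kleinMatrix u 0 b = if b = 0 then 1 else 0 := by
  simp only [kleinMatrix, kleinRow, of_apply, kleinSign_zero_left, Int.cast_one, one_smul]
  rw [← Finset.smul_sum, Finset.sum_comm]
  simp only [← Finset.smul_sum, hu.col_sum, ← Finset.sum_smul]
  rw [← Int.cast_sum, sum_kleinSign]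
  split_ifs <;> simp

theorem kleinMatrix_zero_right (hu : IsMagicUnitary u) (a : Fin 4) :
    kleinMatrix u a 0 = if a = 0 then 1 else 0 := by
  rw [← kleinMatrix_zero_left hu.transpose, kleinMatrix_transpose, transpose_apply]

theorem trace_kleinMatrix (u : Matrix (Fin 4) (Fin 4) A) :
    ∑ a, kleinMatrix u a a = ∑ i, u i i := by
  have h (i j : Fin 4) : ∑ a, (kleinSign a i : ℂ) * kleinSign a j = if i = j then 4 else 0 := by
    have := congrArg (Int.cast : ℤ → ℂ) (sum_kleinSign_mul 0 i j)
    simp only [zero_xor_fin, kleinSign_zero_left] at this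
    push_cast at this
    simpa using this
  simp only [kleinMatrix, kleinRow, of_apply, Finset.smul_sum]
  rw [Finset.sum_comm]
  refine Finset.sum_congr rfl fun i _ => ?_
  rw [Finset.sum_comm]
  simp only [smul_smul, mul_left_comm _ (4⁻¹ : ℂ), ← Finset.sum_smul, ← Finset.mul_sum, h]
  simp

theorem map_star_kleinMatrix (hu : IsMagicUnitary u) :
    (kleinMatrix u).map star = kleinMatrix u := by
  ext a b
  have h (i j : Fin 4) : star (u i j) = u i j := (hu.isStarProjection i j).isSelfAdjoint.star_eq
  simp [kleinMatrix, kleinRow, h]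

theorem conjTranspose_kleinMatrix (hu : IsMagicUnitary u) :
    (kleinMatrix u)ᴴ = (kleinMatrix u)ᵀ := by
  rw [← kleinMatrix_transpose, ← map_star_kleinMatrix hu.transpose, kleinMatrix_transpose]
  rfl

theorem transpose_mul_kleinMatrix [Nontrivial A] (hu : IsMagicUnitary u) :
    (kleinMatrix u)ᵀ * kleinMatrix u = 1 := by
  ext b d
  have h := sum_kleinMatrix_mul hu 0 b d
  simp only [zero_xor_fin, kleinMatrix_zero_left hu, xor_fin_eq_zero] at h
  simpa [mul_apply, one_apply] using h

theorem kleinMatrix_mul_transpose [Nontrivial A] (hu : IsMagicUnitary u) :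
    kleinMatrix u * (kleinMatrix u)ᵀ = 1 := by
  have h := transpose_mul_kleinMatrix hu.transpose
  rwa [kleinMatrix_transpose, transpose_transpose] at h

/-- `kleinMatrix u` is `u` conjugated by half the character table, a symmetric orthogonal matrix. -/
theorem isBiunitaryCorep_kleinMatrix [Nontrivial A] (hu : IsMagicUnitary u)
    {Δ : A →⋆ₐ[ℂ] MinTensor A A} (hΔ : ∀ i j, Δ (u i j) = ∑ k, tmin (u i k) (u k j)) :
    IsBiunitaryCorep Δ (kleinMatrix u) := by
  have h1 := transpose_mul_kleinMatrix hu
  have h2 := kleinMatrix_mul_transpose hu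
  refine ⟨fun i j => ?_, ?_, ?_, ?_, ?_⟩
  · let β : A →ₗ[ℂ] A →ₗ[ℂ] MinTensor A A :=
      (TensorProduct.mk ℂ A A).compr₂ (MinTensor.of (A := A) (B := A)).toAlgHom.toLinearMap
    have h := sum_bilin_kleinSign β (fun l => (4⁻¹ : ℂ) • kleinRow uᵀ l i)
      (fun l => (4⁻¹ : ℂ) • kleinRow u l j) 0
    simp only [zero_xor_fin] at h
    have h3 (k : Fin 4) : kleinMatrix u i k
        = ∑ l, (kleinSign k l : ℂ) • (4⁻¹ : ℂ) • kleinRow uᵀ l i := by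
      rw [← transpose_transpose u, kleinMatrix_transpose]
      rfl
    have h4 : ∑ k, tmin (kleinMatrix u i k) (kleinMatrix u k j) = (4 : ℂ) • ∑ l,
        (kleinSign 0 l : ℂ) • tmin ((4⁻¹ : ℂ) • kleinRow uᵀ l i) ((4⁻¹ : ℂ) • kleinRow u l j) := by
      refine (Finset.sum_congr rfl fun k _ => ?_).trans h
      rw [h3]
      rfl
    rw [h4]
    simp only [kleinMatrix, kleinRow, of_apply, kleinSign_zero_left, map_sum, map_smul, hΔ,
      tmin_smul_left, tmin_smul_right, tmin_sum_left, tmin_sum_right, transpose_apply,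
      Finset.smul_sum, smul_smul]
    rw [Finset.sum_comm, Finset.sum_congr rfl fun l _ => Finset.sum_comm, Finset.sum_comm]
    refine Finset.sum_congr rfl fun l _ => Finset.sum_congr rfl fun q _ =>
      Finset.sum_congr rfl fun k _ => ?_
    congr 1
    push_cast
    ring
  all_goals simp only [conjTranspose_kleinMatrix hu, map_star_kleinMatrix hu, h1, h2]

theorem sum_eq_of_ne {M : Type*} [AddCommMonoid M] (f : Fin 4 → M) {a c : Fin 4} (ha : a ≠ 0)
    (hc : c ≠ 0) (hac : a ≠ c) : ∑ i, f i = f 0 + f (a ^^^ c) + f a + f c := by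
  have h : (Finset.univ : Finset (Fin 4)) = {0, a ^^^ c, a, c} ∧ 0 ∉ ({a ^^^ c, a, c} : Finset (Fin 4))
      ∧ a ^^^ c ∉ ({a, c} : Finset (Fin 4)) ∧ a ∉ ({c} : Finset (Fin 4)) := by
    revert a c; decide
  rw [h.1, Finset.sum_insert h.2.1, Finset.sum_insert h.2.2.1, Finset.sum_insert h.2.2.2,
    Finset.sum_singleton]
  abel

/-- Row 0 vanishes off the corner, so of the four terms in `sum_kleinMatrix_mul` with `e = a ^^^ c`
only those for rows `a` and `c` survive. -/
theorem kleinMatrix_mul_add [Nontrivial A] (hu : IsMagicUnitary u) {a b c d : Fin 4} (ha : a ≠ 0)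
    (hb : b ≠ 0) (hc : c ≠ 0) (hd : d ≠ 0) (hac : a ≠ c) :
    kleinMatrix u a b * kleinMatrix u c d + kleinMatrix u c b * kleinMatrix u a d
      = kleinMatrix u (a ^^^ c) (b ^^^ d) := by
  have h := sum_kleinMatrix_mul hu (a ^^^ c) b d
  have h1 : ∀ a c : Fin 4, (a ^^^ c) ^^^ a = c ∧ (a ^^^ c) ^^^ c = a := by decide
  rw [sum_eq_of_ne _ ha hc hac, (h1 a c).1, (h1 a c).2, xor_fin_eq_zero.mpr rfl,
    kleinMatrix_zero_left hu, kleinMatrix_zero_left hu, if_neg hb, if_neg hd, zero_mul, mul_zero, zero_add, zero_add] at h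
  exact h

theorem kleinMatrix_mul_add' [Nontrivial A] (hu : IsMagicUnitary u) {a b c d : Fin 4} (ha : a ≠ 0)
    (hb : b ≠ 0) (hc : c ≠ 0) (hd : d ≠ 0) (hbd : b ≠ d) :
    kleinMatrix u a b * kleinMatrix u c d + kleinMatrix u a d * kleinMatrix u c b
      = kleinMatrix u (a ^^^ c) (b ^^^ d) := by
  have h := kleinMatrix_mul_add hu.transpose hb ha hd hc hbd
  simpa only [kleinMatrix_transpose, transpose_apply] using h

/-- Entries with an index 0 are scalars. Distinct entries in the same nontrivial row or column
anticommute, because the right side of the product rule vanishes. Entries in different rows and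
columns commute, by comparing the row and column versions of that rule. -/
theorem kleinMatrix_commute_or [Nontrivial A] (hu : IsMagicUnitary u) (a b c d : Fin 4) :
    kleinMatrix u a b * kleinMatrix u c d = kleinMatrix u c d * kleinMatrix u a b ∨
      kleinMatrix u a b * kleinMatrix u c d = -(kleinMatrix u c d * kleinMatrix u a b) := by
  have h0 (a b : Fin 4) (x : A) (hab : a = 0 ∨ b = 0) :
      kleinMatrix u a b * x = x * kleinMatrix u a b := by
    rcases hab with rfl | rfl
    · rw [kleinMatrix_zero_left hu]; split_ifs <;> simp
    · rw [kleinMatrix_zero_right hu]; split_ifs <;> simp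
  have hx (b : Fin 4) : b ^^^ b = 0 := xor_fin_eq_zero.mpr rfl
  have hn {a c : Fin 4} (h : a ≠ c) : a ^^^ c ≠ 0 := mt xor_fin_eq_zero.mp h
  by_cases h : (a = 0 ∨ b = 0) ∨ (c = 0 ∨ d = 0)
  · rcases h with h | h
    · exact Or.inl (h0 a b _ h)
    · exact Or.inl (h0 c d _ h).symm
  push Not at h
  obtain ⟨⟨ha, hb⟩, hc, hd⟩ := h
  by_cases hac : a = c
  · subst hac
    by_cases hbd : b = d
    · subst hbd; exact Or.inl rfl
    · right
      have h := kleinMatrix_mul_add' hu ha hb hc hd hbd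
      rw [hx, kleinMatrix_zero_left hu, if_neg (hn hbd)] at h
      exact eq_neg_of_add_eq_zero_left h
  · by_cases hbd : b = d
    · subst hbd
      right
      have h := kleinMatrix_mul_add hu ha hb hc hd hac
      rw [hx, kleinMatrix_zero_right hu, if_neg (hn hac)] at h
      exact eq_neg_of_add_eq_zero_left h
    · left
      have h1 := kleinMatrix_mul_add hu hc hb ha hd (Ne.symm hac)
      have h2 := kleinMatrix_mul_add' hu hc hb ha hd hbd
      exact add_left_cancel (h1.trans h2.symm)

theorem IsMagicUnitary.four_le_norm_trace [Nontrivial A] (hu : IsMagicUnitary u)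
    {Δ : A →⋆ₐ[ℂ] MinTensor A A} (hΔ : ∀ i j, Δ (u i j) = ∑ k, tmin (u i k) (u k j)) :
    4 ≤ ‖∑ i, u i i‖ := by
  have h := (isBiunitaryCorep_kleinMatrix hu hΔ).card_le_norm_trace
    fun p q => kleinMatrix_commute_or hu p.1 p.2 q.1 q.2
  rw [trace_kleinMatrix] at h
  simpa using h

/-- If the sum of the diagonal entries has maximal norm, then some state is the identity. -/
theorem QuantumPermutationGroup.deterministic_nonempty_of_le_norm {N : ℕ} [Nontrivial A]
    (G : QuantumPermutationGroup N A) (h : (N : ℝ) ≤ ‖∑ i, G.u i i‖) :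
    G.deterministic.Nonempty := by
  have hp (i j : Fin N) : star (G.u i j) * G.u i j = G.u i j := by
    rw [(G.magic.isStarProjection i j).isSelfAdjoint.star_eq,
      (G.magic.isStarProjection i j).isIdempotentElem.eq]
  have hsa : IsSelfAdjoint (∑ i, G.u i i) :=
    isSelfAdjoint_sum _ fun i _ => (G.magic.isStarProjection i i).isSelfAdjoint
  -- At a state attaining the norm, the `N` diagonal values, each at most 1, add up to at least `N`;
  -- so all are 1, and the row sums annihilate the remaining entries.
  obtain ⟨φ, hφ⟩ := State.exists_norm_apply_eq hsa
  have h0 (i j : Fin N) : 0 ≤ φ (G.u i j) := by rw [← hp]; exact φ.nonneg _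
  have hsum (i : Fin N) : ∑ j, φ (G.u i j) = 1 := by
    rw [← map_sum, G.magic.row_sum, φ.map_one]
  have hle (i j : Fin N) : φ (G.u i j) ≤ 1 := by
    rw [← hsum i]
    exact Finset.single_le_sum (f := fun j => φ (G.u i j)) (fun k _ => h0 i k) (Finset.mem_univ j)
  have hdiag : ∑ i : Fin N, φ (G.u i i) = ∑ i : Fin N, 1 := by
    refine le_antisymm (Finset.sum_le_sum fun i _ => hle i i) ?_
    have h1 : (0 : ℂ) ≤ ∑ i, φ (G.u i i) := Finset.sum_nonneg fun i _ => h0 i i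
    rw [← Complex.norm_of_nonneg' h1, ← map_sum, hφ]
    have h2 : ((N : ℝ) : ℂ) ≤ (‖∑ i, G.u i i‖ : ℝ) := Complex.real_le_real.mpr h
    simpa using h2
  have h1 (i : Fin N) : φ (G.u i i) = 1 :=
    (Finset.sum_eq_sum_iff_of_le fun i _ => hle i i).mp hdiag i (Finset.mem_univ i)
  refine ⟨φ, 1, ?_⟩
  ext i j
  change φ (G.u i j) = if (1 : Equiv.Perm (Fin N)) j = i then 1 else 0
  rw [Equiv.Perm.one_apply]
  split_ifs with hij
  · rw [hij, h1]
  · have h2 := hsum i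
    rw [← Finset.add_sum_erase _ _ (Finset.mem_univ i), h1, add_eq_left,
      Finset.sum_eq_zero_iff_of_nonneg fun k _ => h0 i k] at h2
    exact h2 j (Finset.mem_erase.mpr ⟨hij, Finset.mem_univ j⟩)

theorem QuantumPermutationGroup.deterministic_nonempty_of_four [Nontrivial A]
    (G : QuantumPermutationGroup 4 A) : G.deterministic.Nonempty :=
  G.deterministic_nonempty_of_le_norm (by simpa using G.magic.four_le_norm_trace G.comul_u)

end QuantumPerm

theorem mainTheorem5 {N : ℕ} {A : Type u} [CStarAlgebra A] [Nontrivial A]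
    (G : QuantumPerm.QuantumPermutationGroup N A) :
    (G.IsGroupUnderConv G.deterministic ∨ G.deterministic = ∅) ∧
    (∃ ε : G.regular →⋆ₐ[ℂ] ℂ, G.IsCounit ε ∧
      (G.IsGroupUnderConv G.deterministic ↔ G.IsStateOn ε)) ∧
    (G.IsCoamenable → G.IsGroupUnderConv G.deterministic) ∧
    (G.IsUniversal → G.IsGroupUnderConv G.deterministic) ∧
    (N = 4 → G.IsGroupUnderConv G.deterministic) := by
  rw [G.isGroupUnderConv_iff_nonempty]
  refine ⟨G.deterministic.eq_empty_or_nonempty.symm, ?_, G.deterministic_nonempty_of_isCoamenable,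
    G.deterministic_nonempty_of_isUniversal, ?_⟩
  · obtain ⟨ε, hε⟩ := G.exists_isCounit
    exact ⟨ε, hε, G.isStateOn_of_deterministic_nonempty hε,
      G.deterministic_nonempty_of_isStateOn hε⟩
  · rintro rfl
    exact G.deterministic_nonempty_of_four
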